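/- **Theorem 1.** Let $V\in C^1(\mathbb R)$ be non-negative, even, non-increasing on $[0,\infty)$, with $V(x)\to0$ as $|x|\to\infty$. For $\alpha>0$ consider the one-dimensional Fröhlich polaron localized by $V$, i.e. the Hamiltonian $$H_\alpha(V)=-\frac{d^2}{dx^2}+\int_{\mathbb R}a_k^\dagger a_k\,dk-\Big(\frac{\alpha}{2\pi}\Big)^{1/2}\int_{\mathbb R}\big(a_ke^{ikx}+a_k^\dagger e^{-ikx}\big)\,dk-\alpha^2V(\alpha x)$$ on $\mathcal F\otimes L^2(\mathbb R)$, where $\mathcal F$ is the symmetric Fock space over $L^2(\mathbb R,dk)$ and $[a_k,a_{k'}^\dagger]=\delta(k-k')$. It is understood as a quadratic form on the form domain of $-\frac{d^2}{dx^2}+\int a_k^\dagger a_k\,dk$, the interaction being the limit as $K\to\infty$ of its truncations to $|k|\le K$. Let $$E_\alpha(V)=\inf\{\langle\Psi,H_\alpha(V)\Psi\rangle:\ \|\Psi\|=1\},\qquad e(V)=\inf\Big\{\int_{\mathbb R}\big(u'^2-u^4-Vu^2\big)\,dx:\ u\in H^1(\mathbb R;\mathbb R),\ \int_{\mathbb R}u^2\,dx=1\Big\}.$$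 Then $E_\alpha(V)$ (for every $\alpha>0$) and $e(V)$ are finite, and $$\lim_{\alpha\to\infty}\frac{E_\alpha(V)}{\alpha^2}=e(V).$$ More precisely, $E_\alpha(V)\le\alpha^2e(V)$ for all $\alpha>0$, and there are constants $C,\alpha_0>0$ (depending only on $V$) such that $$E_\alpha(V)\ge\alpha^2e(V)-C\alpha^{71/49}\qquad\text{for all }\alpha\ge\alpha_0.$$ -/

import Mathlib

open MeasureTheory Filter Topology
open scoped ContDiff

/-! ### The one-dimensional Pekar functional -/

/-- `du` is the weak derivative of `u` on the real line. -/
def IsWeakDeriv (u du : ℝ → ℝ) : Prop :=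
  ∀ φ : ℝ → ℝ, ContDiff ℝ ∞ φ → HasCompactSupport φ →
    ∫ x, u x * deriv φ x = - ∫ x, du x * φ x

/-- The Pekar functional `∫ (u'² - u⁴ - V u²) dx` of a function `u` with derivative `du`. -/
noncomputable def pekarFunctional (V u du : ℝ → ℝ) : ℝ :=
  ∫ x, (du x ^ 2 - u x ^ 4 - V x * u x ^ 2)

/-- The values of the Pekar functional at the functions `u ∈ H¹(ℝ)` with `∫ u² = 1`. -/
def pekarValues (V : ℝ → ℝ) : Set ℝ :=
  {r | ∃ u du : ℝ → ℝ, MemLp u 2 volume ∧ MemLp du 2 volume ∧ IsWeakDeriv u du ∧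
    ∫ x, u x ^ 2 = 1 ∧ r = pekarFunctional V u du}

/-- The Pekar energy `e(V)`. -/
noncomputable def pekarEnergy (V : ℝ → ℝ) : ℝ := sInf (pekarValues V)

/-! ### The one-dimensional Fröhlich polaron

The Hilbert space `ℱ ⊗ L²(ℝ)`, where `ℱ` is the symmetric Fock space over `L²(ℝ, dk)`, is the
space of sequences `(ψ₀, ψ₁, ψ₂, …)` with `ψₙ ∈ L²(ℝ × ℝⁿ)` symmetric in the `n` phonon momenta
and `∑ ‖ψₙ‖² < ∞`. -/

/-- The electron position together with the momenta of `n` phonons. -/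
abbrev PolaronConfig (n : ℕ) : Type := ℝ × (Fin n → ℝ)

/-- `g` is the weak derivative of `f` with respect to the electron position. -/
def IsWeakElectronDeriv {n : ℕ} (f g : PolaronConfig n → ℂ) : Prop :=
  ∀ φ : PolaronConfig n → ℝ, ContDiff ℝ ∞ φ → HasCompactSupport φ →
    ∫ p, fderiv ℝ φ p (1, 0) • f p = - ∫ p, φ p • g p

/-- The elements of the form domain of `-d²/dx² + ∫ a†ₖ aₖ dk` in `ℱ ⊗ L²(ℝ)`, each with its weak
derivative in the electron position. This is also the form domain of the polaron Hamiltonian. -/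
structure PolaronState where
  /-- the `n`-phonon components -/
  ψ : (n : ℕ) → PolaronConfig n → ℂ
  /-- the derivatives of the components in the electron position -/
  dψ : (n : ℕ) → PolaronConfig n → ℂ
  memLp_ψ : ∀ n, MemLp (ψ n) 2 volume
  memLp_dψ : ∀ n, MemLp (dψ n) 2 volume
  symm : ∀ (n : ℕ) (σ : Equiv.Perm (Fin n)), ∀ᵐ p : PolaronConfig n, ψ n (p.1, p.2 ∘ σ) = ψ n p
  weakDeriv : ∀ n, IsWeakElectronDeriv (ψ n) (dψ n)
  summable_normSq : Summable fun n => ∫ p, ‖ψ n p‖ ^ 2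
  summable_kinetic : Summable fun n => ∫ p, ‖dψ n p‖ ^ 2
  summable_number : Summable fun n : ℕ => (n : ℝ) * ∫ p, ‖ψ n p‖ ^ 2

namespace PolaronState

/-- `‖Ψ‖²` -/
noncomputable def normSq (Ψ : PolaronState) : ℝ := ∑' n, ∫ p, ‖Ψ.ψ n p‖ ^ 2

/-- `⟨Ψ, -d²/dx² Ψ⟩ = ‖dΨ/dx‖²` -/
noncomputable def kinetic (Ψ : PolaronState) : ℝ := ∑' n, ∫ p, ‖Ψ.dψ n p‖ ^ 2

/-- `⟨Ψ, ∫ a†ₖ aₖ dk Ψ⟩` -/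
noncomputable def number (Ψ : PolaronState) : ℝ := ∑' n : ℕ, (n : ℝ) * ∫ p, ‖Ψ.ψ n p‖ ^ 2

/-- `⟨Ψ, W(x) Ψ⟩` for a function `W` of the electron position -/
noncomputable def potential (W : ℝ → ℝ) (Ψ : PolaronState) : ℝ :=
  ∑' n, ∫ p, W p.1 * ‖Ψ.ψ n p‖ ^ 2

/-- `⟨Ψ, ∫_{|k| ≤ K} aₖ e^{ikx} dk Ψ⟩`, where
`(aₖ Ψ)ₙ(x, k₁, …, kₙ) = √(n+1) ψₙ₊₁(x, k, k₁, …, kₙ)` -/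
noncomputable def annihilation (K : ℝ) (Ψ : PolaronState) : ℂ :=
  ∑' n : ℕ, ∫ p : PolaronConfig n, star (Ψ.ψ n p) *
    ∫ k in Set.Icc (-K) K, Complex.exp (Complex.I * k * p.1) *
      ((Real.sqrt (n + 1) : ℂ) * Ψ.ψ (n + 1) (p.1, Fin.cons k p.2))

/-- The expectation in `Ψ` of
`-d²/dx² + ∫ a†ₖ aₖ dk - (α/2π)^{1/2} ∫_{|k| ≤ K} (aₖ e^{ikx} + a†ₖ e^{-ikx}) dk - α² V(αx)`.
The expectations of `aₖ e^{ikx}` and of its adjoint `a†ₖ e^{-ikx}` are complex conjugates. -/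
noncomputable def cutoffEnergy (α : ℝ) (V : ℝ → ℝ) (K : ℝ) (Ψ : PolaronState) : ℝ :=
  Ψ.kinetic + Ψ.number - Real.sqrt (α / (2 * Real.pi)) * (2 * (Ψ.annihilation K).re)
    - α ^ 2 * Ψ.potential fun x => V (α * x)

/-- `⟨Ψ, H_α(V) Ψ⟩ = E`. The form factor of the interaction is not square integrable in `k`, so
the quadratic form of the interaction is the limit of its truncations to `|k| ≤ K`. -/
def HasEnergy (α : ℝ) (V : ℝ → ℝ) (Ψ : PolaronState) (E : ℝ) : Prop :=
  Tendsto (fun K => Ψ.cutoffEnergy α V K) atTop (𝓝 E)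

end PolaronState

/-- The values `⟨Ψ, H_α(V) Ψ⟩` with `‖Ψ‖ = 1`. -/
def polaronValues (α : ℝ) (V : ℝ → ℝ) : Set ℝ :=
  {E | ∃ Ψ : PolaronState, Ψ.normSq = 1 ∧ Ψ.HasEnergy α V E}

/-- The ground state energy `E_α(V)`. -/
noncomputable def polaronEnergy (α : ℝ) (V : ℝ → ℝ) : ℝ := sInf (polaronValues α V)

/-! Upper bound. For a fixed electron density the best classical phonon field is the one that the
density generates. The electron function `√α u(αx)` times the coherent state of that field has
energy exactly `α²` times the Pekar functional of `u` (`sq_mul_pekarFunctional_mem_polaronValues`).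

Lower bound. The interaction is first reduced to modes attached to cells in position space. The
plane wave `e^{ikx}` is replaced by its average over the cell of width `l` that contains `x`.
Averages over different cells are orthogonal in `k` by Plancherel, so each cell carries one
normalised mode. The difference between the plane wave and its average is the `x`-derivative of a
kernel whose squared norm in `L²(dk)` is at most `2πl`. Integration by parts therefore bounds its
contribution by `2√(αl)` times kinetic energy plus phonon number plus one, uniformly in the momentum
cutoff (`PolaronState.cell_energy_le`). Next the state is multiplied by a smooth window of radius
`R`, and the resulting inequality is averaged over all translates of the window
(`PolaronState.cell_lower_bound`). This costs a multiple of `1/R²`, and inside one window only about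
`2R/l` modes interact with the electron.

With finitely many modes the phonons can be made classical. When occupation numbers are truncated at
`N`, each field operator `b + b†` is a real symmetric matrix, and those of different modes act on
different tensor factors, so one real orthogonal matrix diagonalises them all
(`exists_joint_diagonalisation`). In the joint eigenbasis the fields are real numbers `z`, and `(b +
b†)² ≤ 4b†b + 2` bounds the phonon energy below by `z²/4 - 1/2` per mode. For fixed `z`, completing
the square and Cauchy–Schwarz on each cell produce the quartic term of the Pekar functional
(`classicalField_lower_bound`). The fraction `1 - k` of kinetic and phonon energy spent on the cell
error only perturbs the coefficients, which `pekar_stability` controls. Fock space is linked to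
occupation numbers by expanding in a Parseval system that contains the cell modes and grouping words
of modes by their occupation numbers (`word_lower_bound`, `mode_lower_bound`). The cutoffs in the
number of modes and in the number of phonons are then removed by limits.

The total error is a multiple of `α²√(αl) + R/l + 1/R² + 1`. The choice `l = α^(-15/7)`, `R =
α^(-5/7)` makes the first three terms equal to `α^(10/7)`, which is below the required `α^(71/49)`.
-/

set_option linter.unusedSectionVars false

/-! ### Weak directional derivatives as an identity for translates. -/

section ShiftIdentity

variable {E F : Type*} [NormedAddCommGroup E] [NormedSpace ℝ E] [FiniteDimensional ℝ E]
  [MeasurableSpace E] [BorelSpace E] {μ : Measure E} [μ.IsAddHaarMeasure]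
  [NormedAddCommGroup F] [NormedSpace ℝ F] [CompleteSpace F]

/-- For fixed `t` the map is a translation, so by Fubini preimages of null sets are null. This
allows almost-everywhere classes to be composed with `(x, t) ↦ x + t • e`. -/
theorem quasiMeasurePreserving_add_smul (e : E) (ν : Measure ℝ) [SFinite ν] :
    Measure.QuasiMeasurePreserving (fun q : E × ℝ => q.1 + q.2 • e) (μ.prod ν) μ := by
  refine ⟨by fun_prop, ?_⟩
  refine Measure.AbsolutelyContinuous.mk fun s hs h0 => ?_
  rw [Measure.map_apply (by fun_prop) hs,
    Measure.measure_prod_null ((by fun_prop : Measurable fun q : E × ℝ => q.1 + q.2 • e) hs)]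
  have : ∀ᵐ x ∂μ, x ∉ s := measure_eq_zero_iff_ae_notMem.1 h0
  have h2 : ∀ t : ℝ, ∀ᵐ x ∂μ, x + t • e ∉ s := fun t =>
    (measurePreserving_add_right μ (t • e)).quasiMeasurePreserving.ae this
  have hm : MeasurableSet {q : E × ℝ | q.1 + q.2 • e ∉ s} :=
    ((by fun_prop : Measurable fun q : E × ℝ => q.1 + q.2 • e) hs).compl
  have h3 := (Measure.ae_ae_comm (μ := μ) (ν := ν) (p := fun x t => x + t • e ∉ s) hm).2
    (ae_of_all _ h2)
  filter_upwards [h3] with x hx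
  exact measure_eq_zero_iff_ae_notMem.2 hx

/-- Since `‖g‖ ≤ 1 + ‖g‖²`, translation invariance bounds the integral over `B` uniformly in `t`,
and `I` has finite length. Supplies the integrability for the Fubini swaps below. -/
theorem MeasureTheory.MemLp.integrable_add_smul {g : E → F} (hg : MemLp g 2 μ) (e : E)
    {B : Set E} (hB : μ B ≠ ⊤) {I : Set ℝ} (hI : volume I ≠ ⊤) :
    Integrable (fun q : E × ℝ => g (q.1 + q.2 • e)) ((μ.restrict B).prod (volume.restrict I)) := by
  have : IsFiniteMeasure (μ.restrict B) := ⟨by simpa using hB.lt_top⟩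
  have : IsFiniteMeasure (volume.restrict I) := ⟨by simpa using hI.lt_top⟩
  have hmeas : AEStronglyMeasurable (fun q : E × ℝ => g (q.1 + q.2 • e))
      ((μ.restrict B).prod (volume.restrict I)) := by
    have h1 := hg.1.comp_quasiMeasurePreserving
      (quasiMeasurePreserving_add_smul (μ := μ) e (volume.restrict I))
    exact h1.mono_ac (Measure.AbsolutelyContinuous.prod Measure.restrict_le_self.absolutelyContinuous
      Measure.AbsolutelyContinuous.rfl)
  have hsh : ∀ t : ℝ, MemLp (fun p => g (p + t • e)) 2 μ := fun t =>
    hg.comp_measurePreserving (measurePreserving_add_right μ (t • e))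
  rw [integrable_prod_iff' hmeas]
  constructor
  · exact ae_of_all _ fun t => ((hsh t).mono_measure Measure.restrict_le_self).integrable (by norm_num)
  · have hm : AEStronglyMeasurable (fun t => ∫ x, ‖g (x + t • e)‖ ∂μ.restrict B)
        (volume.restrict I) := hmeas.norm.prod_swap.integral_prod_right'
    refine Integrable.mono' (integrable_const (μ.real B + ∫ x, ‖g x‖ ^ 2 ∂μ)) hm
      (ae_of_all _ fun t => ?_)
    rw [Real.norm_of_nonneg (integral_nonneg fun _ => norm_nonneg _)]
    have h2 : Integrable (fun x => ‖g (x + t • e)‖ ^ 2) μ := (hsh t).integrable_norm_pow (by norm_num)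
    calc ∫ x, ‖g (x + t • e)‖ ∂μ.restrict B
        ≤ ∫ x, (1 + ‖g (x + t • e)‖ ^ 2) ∂μ.restrict B := by
          refine integral_mono (((hsh t).mono_measure Measure.restrict_le_self).integrable
            (by norm_num)).norm ((integrable_const _).add h2.restrict) fun x => ?_
          nlinarith [sq_nonneg (‖g (x + t • e)‖ - 1), sq_nonneg (‖g (x + t • e)‖ + 1)]
      _ = μ.real B + ∫ x in B, ‖g (x + t • e)‖ ^ 2 ∂μ := by
          rw [integral_add (integrable_const _) h2.restrict]; simp [Measure.real]
      _ ≤ μ.real B + ∫ x, ‖g (x + t • e)‖ ^ 2 ∂μ := by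
          gcongr
          · exact ae_of_all _ fun x => sq_nonneg _
          · exact Measure.restrict_le_self
      _ = _ := by rw [(measurePreserving_add_right μ (t • e)).integral_comp
            (measurableEmbedding_addRight _) (fun x => ‖g x‖ ^ 2)]

theorem integral_uIoc_eq_sign_smul (h : ℝ) (u : ℝ → F) :
    ∫ t in (0:ℝ)..h, u t = (if 0 ≤ h then (1:ℝ) else -1) • ∫ t in Set.uIoc 0 h, u t :=
  intervalIntegral.intervalIntegral_eq_integral_uIoc _ _ _ _

/-- Test both sides against `φ`, move the translation onto `φ`, use the weak derivative for each
translated test function, and integrate in `t` by the fundamental theorem of calculus for the smooth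
`φ`. The result involves no test functions, so it can be restricted to lines and contracted with
phonon modes. -/
theorem shift_of_weakDeriv {f g : E → F} (hf : MemLp f 2 μ) (hg : MemLp g 2 μ) (e : E)
    (hw : ∀ φ : E → ℝ, ContDiff ℝ ∞ φ → HasCompactSupport φ →
      ∫ p, fderiv ℝ φ p e • f p ∂μ = - ∫ p, φ p • g p ∂μ) (h : ℝ) :
    ∀ᵐ p ∂μ, f (p + h • e) - f p = ∫ t in (0:ℝ)..h, g (p + t • e) := by
  have hIfin : volume (Set.uIoc 0 h) ≠ ⊤ := by simp [Set.uIoc]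
  have hfl : LocallyIntegrable f μ := hf.locallyIntegrable (by norm_num)
  have hfh : MemLp (fun p => f (p + h • e)) 2 μ :=
    hf.comp_measurePreserving (measurePreserving_add_right μ (h • e))
  have hfhl : LocallyIntegrable (fun p => f (p + h • e)) μ := hfh.locallyIntegrable (by norm_num)
  have hBint : ∀ B : Set E, μ B ≠ ⊤ →
      IntegrableOn (fun p => ∫ t in (0:ℝ)..h, g (p + t • e)) B μ := by
    intro B hB
    simp only [integral_uIoc_eq_sign_smul]
    have := (hg.integrable_add_smul e hB hIfin).integral_prod_left
    exact this.smul _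
  refine ae_eq_of_integral_contDiff_smul_eq (hfhl.sub hfl) ?_ ?_
  · rw [locallyIntegrable_iff]
    exact fun K hK => hBint K hK.measure_lt_top.ne
  · intro φ hφ hφc
    obtain ⟨C, hC⟩ := hφ.continuous.bounded_above_of_compact_support hφc
    have hK : μ (tsupport φ) ≠ ⊤ := hφc.isCompact.measure_lt_top.ne
    have hs0 : ∀ x, x ∉ tsupport φ → φ x = 0 := fun x hx => image_eq_zero_of_notMem_tsupport hx
    set G : E → F := fun y => fderiv ℝ φ y e • f y with hG
    have hcomp : ∀ (u : ℝ → E → F), (∀ t, ∫ p, φ p • u t p ∂μ = ∫ p in tsupport φ, φ p • u t p ∂μ) :=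
      fun u t => (setIntegral_eq_integral_of_forall_compl_eq_zero
        fun x hx => by rw [hs0 x hx, zero_smul]).symm
    -- right side
    have hR : ∫ p, φ p • (∫ t in (0:ℝ)..h, g (p + t • e)) ∂μ
        = ∫ t in (0:ℝ)..h, ∫ p, φ p • g (p + t • e) ∂μ := by
      rw [hcomp (fun _ p => ∫ t in (0:ℝ)..h, g (p + t • e)) 0]
      simp_rw [hcomp (fun t p => g (p + t • e))]
      simp only [integral_uIoc_eq_sign_smul]
      simp_rw [smul_comm (φ _) (if 0 ≤ h then (1:ℝ) else -1)]
      rw [integral_smul]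
      congr 1
      simp_rw [← integral_smul]
      rw [integral_integral_swap]
      refine Integrable.bdd_smul (C := C) ?_ ?_ ?_
      · exact hg.integrable_add_smul e hK hIfin
      · exact (hφ.continuous.comp continuous_fst).aestronglyMeasurable
      · exact ae_of_all _ fun q => hC q.1
    have hsub : ∀ t : ℝ, ∫ p, φ p • g (p + t • e) ∂μ = ∫ p, φ (p - t • e) • g p ∂μ := by
      intro t
      rw [← (measurePreserving_add_right μ (t • e)).integral_comp (measurableEmbedding_addRight _)
        (fun p => φ (p - t • e) • g p)]
      simp
    have hφt : ∀ t : ℝ, ContDiff ℝ ∞ (fun p => φ (p - t • e)) := fun t => by fun_prop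
    have hφtc : ∀ t : ℝ, HasCompactSupport (fun p => φ (p - t • e)) := fun t =>
      hφc.comp_homeomorph (Homeomorph.subRight (t • e))
    have hd : ∀ (t : ℝ) (p : E), fderiv ℝ (fun p : E => φ (p - t • e)) p = fderiv ℝ φ (p - t • e) := by
      intro t p
      exact fderiv_comp_sub (𝕜 := ℝ) (f := φ) (t • e)
    have hwt : ∀ t : ℝ, ∫ p, φ (p - t • e) • g p ∂μ
        = - ∫ p, fderiv ℝ φ (p - t • e) e • f p ∂μ := by
      intro t
      have := hw (fun p => φ (p - t • e)) (hφt t) (hφtc t)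
      simp only [hd] at this
      rw [this, neg_neg]
    -- swap for derivative
    have hdc : Continuous (fderiv ℝ φ) := hφ.continuous_fderiv (by simp)
    have hdcs : HasCompactSupport (fderiv ℝ φ) := hφc.fderiv (𝕜 := ℝ)
    obtain ⟨C', hC'⟩ := hdc.bounded_above_of_compact_support hdcs
    obtain ⟨r, hr⟩ := hdcs.isCompact.isBounded.subset_closedBall 0
    -- A ball that contains the support of the derivative of every translate of `φ` by `t • e` with
    -- `|t| ≤ |h|`; the double integral can be confined to a set of finite measure.
    set B : Set E := Metric.closedBall 0 (r + |h| * ‖e‖) with hBdef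
    have hBfin : μ B ≠ ⊤ := (isCompact_closedBall 0 _).measure_lt_top.ne
    have hzero : ∀ t ∈ Set.uIoc 0 h, ∀ p, p ∉ B → fderiv ℝ φ (p - t • e) = 0 := by
      intro t ht p hp
      apply image_eq_zero_of_notMem_tsupport
      intro hmem
      apply hp
      have h1 := hr hmem
      rw [mem_closedBall_zero_iff] at h1 ⊢
      have ht' : |t| ≤ |h| := by
        rcases Set.mem_uIoc.1 ht with h | h <;> rw [abs_le] <;> constructor <;>
          cases abs_cases ‹ℝ› <;> grind
      calc ‖p‖ = ‖(p - t • e) + t • e‖ := by simp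
        _ ≤ ‖p - t • e‖ + ‖t • e‖ := norm_add_le _ _
        _ ≤ r + |h| * ‖e‖ := by
            rw [norm_smul, Real.norm_eq_abs]; gcongr
    have hint2 : Integrable (fun q : E × ℝ => fderiv ℝ φ (q.1 - q.2 • e) e • f q.1)
        ((μ.restrict B).prod (volume.restrict (Set.uIoc 0 h))) := by
      have : IsFiniteMeasure (μ.restrict B) := ⟨by simpa using hBfin.lt_top⟩
      have : IsFiniteMeasure (volume.restrict (Set.uIoc 0 h)) := ⟨by simpa using hIfin.lt_top⟩
      refine Integrable.bdd_smul (C := C' * ‖e‖) ?_ ?_ ?_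
      · exact ((hf.mono_measure Measure.restrict_le_self).integrable (by norm_num)).comp_fst _
      · refine Continuous.aestronglyMeasurable ?_
        exact (hdc.comp (by fun_prop)).clm_apply continuous_const
      · exact ae_of_all _ fun q => (ContinuousLinearMap.le_opNorm _ _).trans
          (by gcongr; exact hC' _)
    have hftc : ∀ p, ∫ t in (0:ℝ)..h, fderiv ℝ φ (p - t • e) e = φ p - φ (p - h • e) := by
      intro p
      have hder : ∀ t ∈ Set.uIcc 0 h, HasDerivAt (fun t : ℝ => -φ (p - t • e))
          (fderiv ℝ φ (p - t • e) e) t := by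
        intro t _
        have h1 : HasFDerivAt φ (fderiv ℝ φ (p - t • e)) (p - t • e) :=
          (hφ.differentiable (by simp) _).hasFDerivAt
        have h2 : HasDerivAt (fun t : ℝ => p - t • e) (-e) t := by
          simpa using ((hasDerivAt_id t).smul_const e).const_sub p
        have h3 := (h1.comp_hasDerivAt t h2).neg
        rw [map_neg, neg_neg] at h3
        exact h3
      rw [intervalIntegral.integral_eq_sub_of_hasDerivAt hder]
      · simp; ring
      · apply Continuous.intervalIntegrable
        exact (hdc.comp (by fun_prop)).clm_apply continuous_const
    have hswap : ∫ t in (0:ℝ)..h, ∫ p, fderiv ℝ φ (p - t • e) e • f p ∂μ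
        = ∫ p, (φ p - φ (p - h • e)) • f p ∂μ := by
      have e1 : ∫ t in (0:ℝ)..h, ∫ p, fderiv ℝ φ (p - t • e) e • f p ∂μ
          = ∫ t in (0:ℝ)..h, ∫ p in B, fderiv ℝ φ (p - t • e) e • f p ∂μ := by
        refine intervalIntegral.integral_congr_ae (ae_of_all _ fun t ht => ?_)
        exact (setIntegral_eq_integral_of_forall_compl_eq_zero
          fun x hx => by simp [hzero t ht x hx]).symm
      have e2 : ∫ p, (φ p - φ (p - h • e)) • f p ∂μ
          = ∫ p in B, (φ p - φ (p - h • e)) • f p ∂μ := by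
        refine (setIntegral_eq_integral_of_forall_compl_eq_zero fun x hx => ?_).symm
        rw [← hftc, intervalIntegral.integral_congr_ae (g := fun _ => (0:ℝ))
          (ae_of_all _ fun t ht => by simp [hzero t ht x hx])]
        simp
      rw [e1, e2]
      simp_rw [← hftc]
      simp only [integral_uIoc_eq_sign_smul]
      rw [integral_integral_swap
        (f := fun (t : ℝ) (p : E) => fderiv ℝ φ (p - t • e) e • f p) hint2.swap, ← integral_smul]
      congr 1
      ext p
      rw [integral_smul_const, smul_assoc]
    have i1 : Integrable (fun p => φ p • f p) μ :=
      hfl.integrable_smul_left_of_hasCompactSupport hφ.continuous hφc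
    have i2 : Integrable (fun p => φ p • f (p + h • e)) μ :=
      hfhl.integrable_smul_left_of_hasCompactSupport hφ.continuous hφc
    have i3 : Integrable (fun p => φ (p - h • e) • f p) μ :=
      hfl.integrable_smul_left_of_hasCompactSupport (hφt h).continuous (hφtc h)
    have e3 : ∫ p, φ (p - h • e) • f p ∂μ = ∫ p, φ p • f (p + h • e) ∂μ := by
      rw [← (measurePreserving_add_right μ (h • e)).integral_comp (measurableEmbedding_addRight _)
        (fun p => φ (p - h • e) • f p)]
      simp
    rw [hR]
    simp_rw [hsub, hwt]
    rw [intervalIntegral.integral_neg, hswap]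
    simp only [sub_smul, smul_sub]
    rw [integral_sub i2 i1, integral_sub i1 i3, e3]
    abel

end ShiftIdentity

/-! ### Primitives of locally integrable functions: product rule and vanishing total integral. -/

section Primitive

variable {F : Type*} [NormedAddCommGroup F] [NormedSpace ℝ F] [CompleteSpace F]

/-- `u` agrees almost everywhere with a primitive of `du`. -/
def IsPrimitive (u du : ℝ → F) : Prop :=
  ∃ c, ∀ᵐ x, u x = c + ∫ t in (0:ℝ)..x, du t

theorem MeasureTheory.LocallyIntegrable.intervalIntegrable' {g : ℝ → F}
    (hg : LocallyIntegrable g volume) (a b : ℝ) : IntervalIntegrable g volume a b :=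
  (hg.integrableOn_isCompact isCompact_uIcc).intervalIntegrable

/-- A single good base point `x₀` suffices: the identity at `x₀` for almost every `s` describes `u`
at almost every `x = x₀ + s`. -/
theorem isPrimitive_of_shift_ae {u du : ℝ → F} (hdu : LocallyIntegrable du volume)
    (h : ∀ᵐ x, ∀ᵐ s : ℝ, u (x + s) - u x = ∫ t in (0:ℝ)..s, du (x + t)) :
    IsPrimitive u du := by
  obtain ⟨x₀, hx⟩ := h.exists
  refine ⟨u x₀ - ∫ t in (0:ℝ)..x₀, du t, ?_⟩
  have h2 := (measurePreserving_sub_right volume x₀).quasiMeasurePreserving.ae hx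
  filter_upwards [h2] with x hx
  have h3 : ∫ t in (0:ℝ)..(x - x₀), du (x₀ + t) = ∫ t in x₀..x, du t := by
    rw [intervalIntegral.integral_comp_add_left (f := du)]; simp
  have h4 : (∫ t in (0:ℝ)..x₀, du t) + ∫ t in x₀..x, du t = ∫ t in (0:ℝ)..x, du t :=
    intervalIntegral.integral_add_adjacent_intervals
      (hdu.intervalIntegrable' _ _) (hdu.intervalIntegrable' _ _)
  rw [h3, add_sub_cancel, sub_eq_iff_eq_add] at hx
  rw [hx, ← h4]; abel

theorem IsPrimitive.congr {u u' du du' : ℝ → F} (h : IsPrimitive u du) (hu : u =ᵐ[volume] u')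
    (hdu : du =ᵐ[volume] du') : IsPrimitive u' du' := by
  obtain ⟨c, hc⟩ := h
  refine ⟨c, ?_⟩
  filter_upwards [hc, hu] with x hx hx'
  rw [← hx', hx, intervalIntegral.integral_congr_ae (hdu.mono fun t ht _ => ht)]

/-- A function on a product that satisfies the shift identity in its first variable is a primitive
on almost every line. -/
theorem ae_isPrimitive_of_shift {Y : Type*} [MeasurableSpace Y] {ν : Measure Y} [SFinite ν]
    {f g : ℝ × Y → F} (hf : AEStronglyMeasurable f (volume.prod ν))
    (hg : AEStronglyMeasurable g (volume.prod ν))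
    (hgl : ∀ᵐ y ∂ν, LocallyIntegrable (fun x => g (x, y)) volume)
    (h : ∀ s : ℝ, ∀ᵐ p ∂(volume.prod ν), f (p.1 + s, p.2) - f p
      = ∫ t in (0:ℝ)..s, g (p.1 + t, p.2)) :
    ∀ᵐ y ∂ν, IsPrimitive (fun x => f (x, y)) (fun x => g (x, y)) := by
  -- Strongly measurable representatives make the set of good pairs `(p, s)` measurable, which is
  -- what exchanging "for all `s`, for almost every `p`" requires.
  set f' := hf.mk f with hf'
  set g' := hg.mk g with hg'
  have hfm : StronglyMeasurable f' := hf.stronglyMeasurable_mk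
  have hgm : StronglyMeasurable g' := hg.stronglyMeasurable_mk
  have line : ∀ {a b : ℝ × Y → F}, a =ᵐ[volume.prod ν] b →
      ∀ᵐ y ∂ν, (fun x => a (x, y)) =ᵐ[volume] (fun x => b (x, y)) := by
    intro a b hab
    have h1 : ∀ᵐ q ∂(ν.prod volume), a q.swap = b q.swap :=
      Measure.measurePreserving_swap.quasiMeasurePreserving.ae hab
    exact Measure.ae_ae_of_ae_prod h1
  have hmp : ∀ s : ℝ, MeasurePreserving (fun p : ℝ × Y => (p.1 + s, p.2)) (volume.prod ν)
      (volume.prod ν) := fun s =>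
    (measurePreserving_add_right volume s).prod (MeasurePreserving.id ν)
  have hshift : ∀ s : ℝ, ∀ᵐ p ∂(volume.prod ν), f' (p.1 + s, p.2) - f' p
      = ∫ t in (0:ℝ)..s, g' (p.1 + t, p.2) := by
    intro s
    have h1 := (hmp s).quasiMeasurePreserving.ae hf.ae_eq_mk
    have h2 : ∀ᵐ p : ℝ × Y ∂(volume.prod ν),
        (fun x => g (x, p.2)) =ᵐ[volume] (fun x => g' (x, p.2)) :=
      Measure.quasiMeasurePreserving_snd.ae (line hg.ae_eq_mk)
    filter_upwards [h s, h1, h2, hf.ae_eq_mk] with p hp hp1 hp2 hp3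
    have e1 : f' (p.1 + s, p.2) - f' p = f (p.1 + s, p.2) - f p := by rw [hp1, hp3]
    rw [e1, hp]
    refine intervalIntegral.integral_congr_ae ?_
    have := (measurePreserving_add_left volume p.1).quasiMeasurePreserving.ae hp2
    exact this.mono fun t ht _ => ht
  have hmeas : MeasurableSet {q : (ℝ × Y) × ℝ | f' (q.1.1 + q.2, q.1.2) - f' q.1
      = ∫ t in (0:ℝ)..q.2, g' (q.1.1 + t, q.1.2)} := by
    refine StronglyMeasurable.measurableSet_eq_fun ?_ ?_
    · exact (hfm.comp_measurable (by fun_prop)).sub (hfm.comp_measurable (by fun_prop))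
    -- Rescaling to the fixed interval from `0` to `1` turns the variable endpoint into a parameter
    -- of the integrand, so measurability of parametric integrals applies.
    · have : ∀ q : (ℝ × Y) × ℝ, ∫ t in (0:ℝ)..q.2, g' (q.1.1 + t, q.1.2)
          = q.2 • ∫ t in (0:ℝ)..1, g' (q.1.1 + q.2 * t, q.1.2) := by
        intro q
        rw [intervalIntegral.smul_integral_comp_mul_left (fun t => g' (q.1.1 + t, q.1.2))]
        simp
      simp_rw [this, intervalIntegral.integral_of_le zero_le_one]
      refine measurable_snd.stronglyMeasurable.smul ?_
      refine StronglyMeasurable.integral_prod_right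
        (f := fun (q : (ℝ × Y) × ℝ) (t : ℝ) => g' (q.1.1 + q.2 * t, q.1.2)) ?_
      exact hgm.comp_measurable (by fun_prop)
  have h3 := (Measure.ae_ae_comm (μ := volume.prod ν) (ν := (volume : Measure ℝ))
    (p := fun p s => f' (p.1 + s, p.2) - f' p = ∫ t in (0:ℝ)..s, g' (p.1 + t, p.2)) hmeas).2
    (ae_of_all _ hshift)
  have h4 : ∀ᵐ q ∂(ν.prod volume), ∀ᵐ s : ℝ, f' (q.2 + s, q.1) - f' (q.2, q.1)
      = ∫ t in (0:ℝ)..s, g' (q.2 + t, q.1) :=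
    Measure.measurePreserving_swap.quasiMeasurePreserving.ae h3
  filter_upwards [Measure.ae_ae_of_ae_prod h4, hgl, line hf.ae_eq_mk, line hg.ae_eq_mk]
    with y hy hy1 hy2 hy3
  refine IsPrimitive.congr (isPrimitive_of_shift_ae ?_ hy) hy2.symm hy3.symm
  exact hy1.congr hy3

/-- The case of a product with a one-point space. -/
theorem isPrimitive_of_shift {f g : ℝ → F} (hf : AEStronglyMeasurable f volume)
    (hg : LocallyIntegrable g volume)
    (h : ∀ s : ℝ, ∀ᵐ x, f (x + s) - f x = ∫ t in (0:ℝ)..s, g (x + t)) : IsPrimitive f g := by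
  have hq : Measure.QuasiMeasurePreserving (Prod.fst : ℝ × Unit → ℝ)
      (volume.prod (Measure.dirac ())) volume := Measure.quasiMeasurePreserving_fst
  have h1 := ae_isPrimitive_of_shift (ν := Measure.dirac ()) (f := fun p : ℝ × Unit => f p.1)
    (g := fun p => g p.1) (hf.comp_quasiMeasurePreserving hq)
    (hg.aestronglyMeasurable.comp_quasiMeasurePreserving hq) (ae_of_all _ fun _ => hg)
    (fun s => hq.ae (h s))
  obtain ⟨_, hy⟩ := h1.exists
  exact hy

/-- Increments are dominated by those of the scalar primitive of `‖g‖`, which is absolutely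
continuous. -/
theorem MeasureTheory.LocallyIntegrable.absolutelyContinuousOnInterval_integral {g : ℝ → F}
    (hg : LocallyIntegrable g volume) (c : F) (a b : ℝ) :
    AbsolutelyContinuousOnInterval (fun x => c + ∫ t in (0:ℝ)..x, g t) a b := by
  have hi : ∀ a b, IntervalIntegrable g volume a b := hg.intervalIntegrable'
  have hn : AbsolutelyContinuousOnInterval (fun x => ∫ t in a..x, ‖g t‖) a b :=
    (hi a b).norm.absolutelyContinuousOnInterval_intervalIntegral Set.left_mem_uIcc
  rw [absolutelyContinuousOnInterval_iff] at hn ⊢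
  intro ε hε
  obtain ⟨δ, hδ, H⟩ := hn ε hε
  refine ⟨δ, hδ, fun E hE hEδ => lt_of_le_of_lt (Finset.sum_le_sum fun i _ => ?_) (H E hE hEδ)⟩
  set x := (E.2 i).1
  set y := (E.2 i).2
  rw [dist_add_left, dist_comm, dist_comm (∫ t in a..x, _), dist_eq_norm, Real.dist_eq,
    intervalIntegral.integral_interval_sub_left (hi _ _) (hi _ _),
    intervalIntegral.integral_interval_sub_left (hi _ _).norm (hi _ _).norm]
  exact intervalIntegral.norm_integral_le_abs_integral_norm

/-- The difference of `f` and the primitive of `g` is absolutely continuous with zero derivative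
almost everywhere, hence constant. -/
theorem eq_add_integral_of_ac {f g : ℝ → F} (hg : LocallyIntegrable g volume)
    (hf : ∀ a b, AbsolutelyContinuousOnInterval f a b) (hd : ∀ᵐ x, HasDerivAt f (g x) x) (x : ℝ) :
    f x = f 0 + ∫ t in (0:ℝ)..x, g t := by
  have h1 : AbsolutelyContinuousOnInterval (fun x => f x - (0 + ∫ t in (0:ℝ)..x, g t)) 0 x :=
    (hf 0 x).fun_sub (hg.absolutelyContinuousOnInterval_integral 0 0 x)
  obtain ⟨C, hC⟩ := h1.const_of_ae_hasDerivAt_zero (by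
    filter_upwards [hd, _root_.LocallyIntegrable.ae_hasDerivAt_integral hg] with y hy hy2 _
    have h := hy.sub ((hy2 0).const_add 0)
    rw [sub_self] at h
    exact h)
  have h2 := hC x Set.right_mem_uIcc
  have h3 := hC 0 Set.left_mem_uIcc
  simp only [zero_add, intervalIntegral.integral_same, sub_zero] at h2 h3
  rw [h3, ← h2]; abel

/-- Both factors are replaced by their absolutely continuous representatives, whose product is
absolutely continuous and obeys the pointwise product rule almost everywhere. -/
theorem IsPrimitive.mul {𝕜 : Type*} [RCLike 𝕜] {u du v dv : ℝ → 𝕜} (hu : IsPrimitive u du)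
    (hv : IsPrimitive v dv) (hdu : LocallyIntegrable du volume)
    (hdv : LocallyIntegrable dv volume) :
    IsPrimitive (fun x => u x * v x) (fun x => du x * v x + u x * dv x) := by
  obtain ⟨c, hc⟩ := hu
  obtain ⟨d, hd⟩ := hv
  set U : ℝ → 𝕜 := fun x => c + ∫ t in (0:ℝ)..x, du t
  set W : ℝ → 𝕜 := fun x => d + ∫ t in (0:ℝ)..x, dv t
  have hU : ∀ a b, AbsolutelyContinuousOnInterval U a b :=
    hdu.absolutelyContinuousOnInterval_integral c
  have hW : ∀ a b, AbsolutelyContinuousOnInterval W a b :=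
    hdv.absolutelyContinuousOnInterval_integral d
  have cont : ∀ {f : ℝ → 𝕜}, (∀ a b, AbsolutelyContinuousOnInterval f a b) → Continuous f := by
    intro f hf
    refine continuous_iff_continuousAt.2 fun x => ?_
    exact (hf (x - 1) (x + 1)).continuousOn.continuousAt (by
      rw [Set.uIcc_of_le (by linarith)]; exact Icc_mem_nhds (by linarith) (by linarith))
  have hUV : LocallyIntegrable (fun x => du x * W x + U x * dv x) volume := by
    rw [← locallyIntegrableOn_univ] at *
    refine LocallyIntegrableOn.add ?_ ?_
    · simpa [mul_comm] using (hdu.continuousOn_mul (cont hW).continuousOn isOpen_univ.isLocallyClosed)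
    · exact hdv.continuousOn_mul (cont hU).continuousOn isOpen_univ.isLocallyClosed
  have key := eq_add_integral_of_ac hUV (f := fun x => U x * W x)
    (fun a b => (hU a b).fun_smul (hW a b)) (by
      filter_upwards [_root_.LocallyIntegrable.ae_hasDerivAt_integral hdu, _root_.LocallyIntegrable.ae_hasDerivAt_integral hdv] with x hx hy
      exact ((hx 0).const_add c).mul ((hy 0).const_add d))
  have h0 : IsPrimitive (fun x => U x * W x) (fun x => du x * W x + U x * dv x) :=
    ⟨_, ae_of_all _ key⟩
  refine h0.congr ?_ ?_
  · filter_upwards [hc, hd] with x h1 h2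
    rw [h1, h2]
  · filter_upwards [hc, hd] with x h1 h2
    rw [h1, h2]

/-- Integrability of `du` gives the continuous representative limits at both ends; integrability of
`u` forces these limits to be zero. This is the boundary-term-free integration by parts used
throughout. -/
theorem IsPrimitive.integral_eq_zero {u du : ℝ → F} (h : IsPrimitive u du)
    (hu : Integrable u) (hdu : Integrable du) : ∫ x, du x = 0 := by
  obtain ⟨c, hc⟩ := h
  set U : ℝ → F := fun x => c + ∫ t in (0:ℝ)..x, du t
  have hUi : Integrable U := hu.congr hc
  have htop : Tendsto U atTop (𝓝 (c + ∫ t in Set.Ioi 0, du t)) :=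
    tendsto_const_nhds.add (intervalIntegral_tendsto_integral_Ioi 0 hdu.integrableOn tendsto_id)
  have hbot : Tendsto U atBot (𝓝 (c - ∫ t in Set.Iic 0, du t)) := by
    have h1 := intervalIntegral_tendsto_integral_Iic 0 hdu.integrableOn tendsto_id
    refine (tendsto_const_nhds.sub h1).congr fun x => ?_
    simp only [id, U]
    rw [intervalIntegral.integral_symm]; abel
  have e1 : c + ∫ t in Set.Ioi 0, du t = 0 :=
    IntegrableAtFilter.eq_zero_of_tendsto (μ := volume) (hUi.integrableAtFilter _)
      (fun s hs => by
        obtain ⟨a, ha⟩ := mem_atTop_sets.1 hs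
        exact top_le_iff.1 (Real.volume_Ici (a := a) ▸ measure_mono ha)) htop
  have e2 : c - ∫ t in Set.Iic 0, du t = 0 :=
    IntegrableAtFilter.eq_zero_of_tendsto (μ := volume) (hUi.integrableAtFilter _)
      (fun s hs => by
        obtain ⟨a, ha⟩ := mem_atBot_sets.1 hs
        exact top_le_iff.1 (Real.volume_Iic (a := a) ▸ measure_mono ha)) hbot
  rw [← intervalIntegral.integral_Iic_add_Ioi hdu.integrableOn hdu.integrableOn (b := 0),
    ← sub_eq_zero.1 e2, e1]

end Primitive

/-! ### Functions in `H¹(ℝ)`: equivalence with primitives, scaling, and the bound on the quartic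
term. -/

theorem IsWeakDeriv.isPrimitive {u du : ℝ → ℝ} (hu : MemLp u 2 volume) (hdu : MemLp du 2 volume)
    (h : IsWeakDeriv u du) : IsPrimitive u du := by
  refine isPrimitive_of_shift hu.1 (hdu.locallyIntegrable (by norm_num)) fun s => ?_
  have := shift_of_weakDeriv (μ := volume) hu hdu (1 : ℝ) (fun φ hφ hφc => by
    have := h φ hφ hφc
    simp only [smul_eq_mul, fderiv_apply_one_eq_deriv]
    simp_rw [mul_comm (deriv φ _), mul_comm (φ _)]
    exact this) s
  simpa using this

theorem ContDiff.isPrimitive {F : Type*} [NormedAddCommGroup F] [NormedSpace ℝ F] [CompleteSpace F]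
    {φ : ℝ → F} (hφ : ContDiff ℝ 1 φ) : IsPrimitive φ (deriv φ) := by
  refine ⟨φ 0, ae_of_all _ fun x => ?_⟩
  rw [intervalIntegral.integral_deriv_eq_sub (fun y _ => hφ.differentiable (by norm_num) y)
    ((hφ.continuous_deriv (by norm_num)).intervalIntegrable _ _)]
  abel

/-- The product `u φ` is an integrable primitive with integrable derivative, so that derivative
integrates to zero. -/
theorem IsPrimitive.isWeakDeriv {u du : ℝ → ℝ} (h : IsPrimitive u du) (hu : MemLp u 2 volume)
    (hdu : MemLp du 2 volume) : IsWeakDeriv u du := by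
  intro φ hφ hφc
  have hd : Continuous (deriv φ) := hφ.continuous_deriv (by simp)
  have hul := hu.locallyIntegrable (by norm_num)
  have hdul := hdu.locallyIntegrable (by norm_num)
  have i1 : Integrable (fun x => u x * φ x) := by
    simpa [mul_comm] using hul.integrable_smul_left_of_hasCompactSupport hφ.continuous hφc
  have i2 : Integrable (fun x => u x * deriv φ x) := by
    simpa [mul_comm] using hul.integrable_smul_left_of_hasCompactSupport hd hφc.deriv
  have i3 : Integrable (fun x => du x * φ x) := by
    simpa [mul_comm] using hdul.integrable_smul_left_of_hasCompactSupport hφ.continuous hφc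
  have h1 := h.mul (hφ.of_le (by simp)).isPrimitive hdul hd.locallyIntegrable
  have h2 := h1.integral_eq_zero i1 (i3.add i2)
  rw [integral_add i3 i2] at h2
  linarith

theorem IsPrimitive.comp_mul_left {u du : ℝ → ℝ} (h : IsPrimitive u du) {a : ℝ} (ha : a ≠ 0)
    (b : ℝ) : IsPrimitive (fun x => b * u (a * x)) (fun x => b * a * du (a * x)) := by
  obtain ⟨c, hc⟩ := h
  refine ⟨b * c, ?_⟩
  have hq : Measure.QuasiMeasurePreserving (fun x : ℝ => a * x) volume volume := by
    refine ⟨by fun_prop, ?_⟩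
    rw [Real.map_volume_mul_left ha]
    exact Measure.smul_absolutelyContinuous
  filter_upwards [hq.ae hc] with x hx
  have h1 := intervalIntegral.smul_integral_comp_mul_left (a := 0) (b := x) du a
  rw [mul_zero, smul_eq_mul] at h1
  rw [hx, intervalIntegral.integral_const_mul, ← h1]
  ring

/-- `u(x)²` exceeds `u(y)²` by at most `∫ |2uu'| ≤ l ∫ u² + l⁻¹ ∫ u'²`; averaging over `y` in the
unit interval replaces `u(y)²` by at most `1`. The free weight `l` decides how much kinetic energy
is spent. -/
theorem IsPrimitive.ae_sq_le {u du : ℝ → ℝ} (h : IsPrimitive u du) (hu : MemLp u 2 volume)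
    (hdu : MemLp du 2 volume) (hu1 : ∫ x, u x ^ 2 = 1) {l : ℝ} (hl : 0 < l) :
    ∀ᵐ x, u x ^ 2 ≤ 1 + l + (∫ x, du x ^ 2) / l := by
  have hul := hu.locallyIntegrable (by norm_num)
  have hdul := hdu.locallyIntegrable (by norm_num)
  obtain ⟨c, hc⟩ := h.mul h hdul hdul
  have iu : Integrable (fun x => u x ^ 2) := hu.integrable_sq
  have idu : Integrable (fun x => du x ^ 2) := hdu.integrable_sq
  have iq : Integrable (fun x => du x * u x + u x * du x) :=
    (hdu.integrable_mul hu).add (hu.integrable_mul hdu)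
  have hQ : ∫ x, ‖du x * u x + u x * du x‖ ≤ l + (∫ x, du x ^ 2) / l := by
    calc ∫ x, ‖du x * u x + u x * du x‖ ≤ ∫ x, (l * u x ^ 2 + du x ^ 2 / l) := by
          refine integral_mono iq.norm ((iu.const_mul l).add (idu.div_const l)) fun x => ?_
          simp only [Real.norm_eq_abs]
          have e : l * u x ^ 2 + du x ^ 2 / l - (du x * u x + u x * du x)
              = (l * u x - du x) ^ 2 / l := by field_simp; ring
          have e' : l * u x ^ 2 + du x ^ 2 / l + (du x * u x + u x * du x)
              = (l * u x + du x) ^ 2 / l := by field_simp; ring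
          have p1 : 0 ≤ (l * u x - du x) ^ 2 / l := by positivity
          have p2 : 0 ≤ (l * u x + du x) ^ 2 / l := by positivity
          rw [abs_le]; constructor <;> linarith
      _ = _ := by
          rw [integral_add (iu.const_mul l) (idu.div_const l), integral_const_mul, hu1,
            integral_div, mul_one]
  filter_upwards [hc] with x hx
  have hxy : ∀ᵐ y, u x ^ 2 ≤ u y ^ 2 + (l + (∫ x, du x ^ 2) / l) := by
    filter_upwards [hc] with y hy
    have h1 : u x * u x - u y * u y = ∫ t in y..x, (du t * u t + u t * du t) := by
      rw [hx, hy, add_sub_add_left_eq_sub,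
        intervalIntegral.integral_interval_sub_left iq.intervalIntegrable iq.intervalIntegrable]
    have h2 : ∫ t in y..x, (du t * u t + u t * du t) ≤ ∫ x, ‖du x * u x + u x * du x‖ := by
      refine (Real.le_norm_self _).trans (intervalIntegral.norm_integral_le_integral_norm_uIoc.trans ?_)
      exact setIntegral_le_integral iq.norm (ae_of_all _ fun _ => norm_nonneg _)
    nlinarith
  have h3 : ∫ y in Set.Icc (0:ℝ) 1, u x ^ 2
      ≤ ∫ y in Set.Icc (0:ℝ) 1, (u y ^ 2 + (l + (∫ x, du x ^ 2) / l)) :=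
    setIntegral_mono_ae (integrable_const _) (iu.restrict.add (integrable_const _)) hxy
  rw [integral_add iu.restrict (integrable_const _)] at h3
  simp only [integral_const, MeasurableSet.univ, measureReal_restrict_apply, Set.univ_inter,
    Real.volume_real_Icc, sub_zero, smul_eq_mul] at h3
  have h4 : ∫ y in Set.Icc (0:ℝ) 1, u y ^ 2 ≤ 1 := hu1 ▸
    setIntegral_le_integral iu (ae_of_all _ fun _ => sq_nonneg _)
  norm_num at h3
  linarith

theorem IsPrimitive.integrable_pow_four {u du : ℝ → ℝ} (h : IsPrimitive u du)
    (hu : MemLp u 2 volume) (hdu : MemLp du 2 volume) (hu1 : ∫ x, u x ^ 2 = 1) :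
    Integrable (fun x => u x ^ 4) := by
  have hb := h.ae_sq_le hu hdu hu1 one_pos
  refine (hu.integrable_sq.const_mul (1 + 1 + (∫ x, du x ^ 2) / 1)).mono' (hu.1.pow 4) ?_
  filter_upwards [hb] with x hx
  rw [Real.norm_of_nonneg (by positivity)]
  nlinarith [sq_nonneg (u x)]

theorem IsPrimitive.integral_pow_four_le {u du : ℝ → ℝ} (h : IsPrimitive u du)
    (hu : MemLp u 2 volume) (hdu : MemLp du 2 volume) (hu1 : ∫ x, u x ^ 2 = 1) {l : ℝ}
    (hl : 0 < l) : ∫ x, u x ^ 4 ≤ 1 + l + (∫ x, du x ^ 2) / l := by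
  have hb := h.ae_sq_le hu hdu hu1 hl
  calc ∫ x, u x ^ 4 ≤ ∫ x, (1 + l + (∫ x, du x ^ 2) / l) * u x ^ 2 := by
        refine integral_mono_ae (h.integrable_pow_four hu hdu hu1) (hu.integrable_sq.const_mul _) ?_
        filter_upwards [hb] with x hx
        nlinarith [sq_nonneg (u x)]
    _ = _ := by rw [integral_const_mul, hu1, mul_one]

/-! ### The Pekar functional: boundedness, stability under perturbed coefficients, and classical
fields on cells. -/

section Pekar

variable {V : ℝ → ℝ}

theorem integrable_potential_mul {V : ℝ → ℝ} {B : ℝ} (hVm : AEStronglyMeasurable V volume)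
    (hV0 : ∀ x, 0 ≤ V x) (hVB : ∀ x, V x ≤ B) {u : ℝ → ℝ} (hu : Integrable u) :
    Integrable (fun x => V x * u x) :=
  hu.bdd_mul (c := B) hVm (ae_of_all _ fun x => by
    rw [Real.norm_of_nonneg (hV0 x)]; exact hVB x)

theorem integral_potential_mul_le {V : ℝ → ℝ} {B : ℝ} (hVm : AEStronglyMeasurable V volume)
    (hV0 : ∀ x, 0 ≤ V x) (hVB : ∀ x, V x ≤ B) {u : ℝ → ℝ} (hu : Integrable u)
    (hu0 : ∀ x, 0 ≤ u x) : ∫ x, V x * u x ≤ B * ∫ x, u x := by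
  rw [← integral_const_mul]
  exact integral_mono (integrable_potential_mul hVm hV0 hVB hu) (hu.const_mul _)
    fun x => mul_le_mul_of_nonneg_right (hVB x) (hu0 x)

theorem pekarFunctional_eq {B : ℝ} (hVm : AEStronglyMeasurable V volume)
    (hV0 : ∀ x, 0 ≤ V x) (hVB : ∀ x, V x ≤ B) {u du : ℝ → ℝ} (h : IsPrimitive u du)
    (hu : MemLp u 2 volume) (hdu : MemLp du 2 volume) (hu1 : ∫ x, u x ^ 2 = 1) :
    pekarFunctional V u du = (∫ x, du x ^ 2) - (∫ x, u x ^ 4) - ∫ x, V x * u x ^ 2 := by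
  have i4 := h.integrable_pow_four hu hdu hu1
  have iv := integrable_potential_mul hVm hV0 hVB hu.integrable_sq
  have i2 : Integrable (fun x => du x ^ 2 - u x ^ 4) := hdu.integrable_sq.sub i4
  rw [pekarFunctional, integral_sub i2 iv,
    integral_sub hdu.integrable_sq i4]

theorem bddBelow_pekarValues {B : ℝ} (hVm : AEStronglyMeasurable V volume)
    (hV0 : ∀ x, 0 ≤ V x) (hVB : ∀ x, V x ≤ B) : BddBelow (pekarValues V) := by
  refine ⟨-2 - B, ?_⟩
  rintro r ⟨u, du, hu, hdu, hw, hu1, rfl⟩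
  have hp := hw.isPrimitive hu hdu
  rw [pekarFunctional_eq hVm hV0 hVB hp hu hdu hu1]
  -- With weight `1` the kinetic terms cancel exactly, which leaves the bound `-2 - B`.
  have h1 := hp.integral_pow_four_le hu hdu hu1 one_pos
  have h2 := integral_potential_mul_le hVm hV0 hVB hu.integrable_sq fun x => sq_nonneg (u x)
  rw [hu1] at h2
  linarith

theorem nonempty_pekarValues : (pekarValues V).Nonempty := by
  let f : ContDiffBump (0 : ℝ) := ⟨1, 2, one_pos, one_lt_two⟩
  have hf : ContDiff ℝ ∞ f := f.contDiff
  have hfm : MemLp f 2 volume := f.continuous.memLp_of_hasCompactSupport f.hasCompactSupport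
  have hm : 0 < ∫ x, f x ^ 2 := by
    have h1 : ∫ x in Set.Icc (0:ℝ) 1, (1:ℝ) ≤ ∫ x in Set.Icc (0:ℝ) 1, f x ^ 2 := by
      refine setIntegral_mono_on (integrable_const _) hfm.integrable_sq.restrict
        measurableSet_Icc fun x hx => ?_
      rw [f.one_of_mem_closedBall (by
        rw [mem_closedBall_zero_iff, Real.norm_of_nonneg hx.1]; exact hx.2)]
      norm_num
    have h2 : ∫ x in Set.Icc (0:ℝ) 1, f x ^ 2 ≤ ∫ x, f x ^ 2 :=
      setIntegral_le_integral hfm.integrable_sq (ae_of_all _ fun _ => sq_nonneg _)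
    simp at h1
    linarith
  set s := (Real.sqrt (∫ x, f x ^ 2))⁻¹ with hs
  have hu : ContDiff ℝ ∞ (fun x => s * f x) := contDiff_const.mul hf
  have hc : HasCompactSupport (fun x => s * f x) := f.hasCompactSupport.mul_left
  have hm1 : MemLp (fun x => s * f x) 2 volume := hu.continuous.memLp_of_hasCompactSupport hc
  have hm2 : MemLp (deriv (fun x => s * f x)) 2 volume :=
    (hu.continuous_deriv (by simp)).memLp_of_hasCompactSupport hc.deriv
  refine ⟨_, fun x => s * f x, deriv (fun x => s * f x), hm1, hm2,
    (hu.of_le (by simp)).isPrimitive.isWeakDeriv hm1 hm2, ?_, rfl⟩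
  simp_rw [mul_pow]
  rw [integral_const_mul, hs, inv_pow, Real.sq_sqrt hm.le, inv_mul_cancel₀ hm.ne']

theorem isGLB_pekarEnergy {B : ℝ} (hVm : AEStronglyMeasurable V volume)
    (hV0 : ∀ x, 0 ≤ V x) (hVB : ∀ x, V x ≤ B) : IsGLB (pekarValues V) (pekarEnergy V) :=
  isGLB_csInf nonempty_pekarValues (bddBelow_pekarValues hVm hV0 hVB)

/-- The constant in the stability estimate for the Pekar problem with perturbed coefficients. -/
noncomputable def pekarStability (V : ℝ → ℝ) (B : ℝ) : ℝ := 2 * |pekarEnergy V| + 20 + 2 * B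

/-- Write `t`, `w`, `p` for the kinetic, quartic and potential integrals and `δ = 1 - k`. Since `1/k
≤ 1 + 2δ`, the right side is at least `(1 - 2δ)(t - w - p) + δ(t - 4w - 2p)`. The first bracket is
at least the Pekar energy, and the second is at least `-(20 + 2B)`. -/
theorem pekar_stability {B : ℝ} (hVm : AEStronglyMeasurable V volume)
    (hV0 : ∀ x, 0 ≤ V x) (hVB : ∀ x, V x ≤ B) {k : ℝ} (hk : 1 / 2 ≤ k) (hk1 : k ≤ 1)
    {u du : ℝ → ℝ} (h : IsPrimitive u du)
    (hu : MemLp u 2 volume) (hdu : MemLp du 2 volume) (hu1 : ∫ x, u x ^ 2 = 1) :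
    pekarEnergy V - pekarStability V B * (1 - k)
      ≤ k * (∫ x, du x ^ 2) - (∫ x, u x ^ 4) / k - ∫ x, V x * u x ^ 2 := by
  have h0 : pekarEnergy V ≤ pekarFunctional V u du :=
    (isGLB_pekarEnergy hVm hV0 hVB).1 ⟨u, du, hu, hdu, h.isWeakDeriv hu hdu, hu1, rfl⟩
  rw [pekarFunctional_eq hVm hV0 hVB h hu hdu hu1] at h0
  -- The weight `4` gives `t - 4w ≥ -20`, so the kinetic energy absorbs the quartic term.
  have h1 := h.integral_pow_four_le hu hdu hu1 (l := 4) (by norm_num)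
  have h2 := integral_potential_mul_le hVm hV0 hVB hu.integrable_sq fun x => sq_nonneg (u x)
  rw [hu1] at h2
  have hW : 0 ≤ ∫ x, u x ^ 4 := integral_nonneg fun x => by positivity
  unfold pekarStability
  set t := ∫ x, du x ^ 2
  set w := ∫ x, u x ^ 4
  set p := ∫ x, V x * u x ^ 2
  set e := pekarEnergy V
  have hkw : w / k ≤ w * (1 + 2 * (1 - k)) := by
    rw [div_le_iff₀ (by linarith)]
    nlinarith [mul_nonneg hW (mul_nonneg (sub_nonneg.2 hk1) (by linarith : (0:ℝ) ≤ 2 * k - 1))]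
  have he : -|e| ≤ e := neg_abs_le e
  have he' : e ≤ |e| := le_abs_self e
  have g1 : 0 ≤ (1 - k) := by linarith
  have a1 : (1 - 2 * (1 - k)) * e ≤ (1 - 2 * (1 - k)) * (t - w - p) :=
    mul_le_mul_of_nonneg_left h0 (by linarith)
  have a2 := mul_le_mul_of_nonneg_left h1 g1
  have a3 := mul_le_mul_of_nonneg_left h2 g1
  have a4 := mul_le_mul_of_nonneg_left he' g1
  linarith

theorem integral_comp_inv_mul {a : ℝ} (ha : 0 < a) (g : ℝ → ℝ) :
    ∫ x, g (a⁻¹ * x) = a * ∫ x, g x := by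
  rw [Measure.integral_comp_mul_left g a⁻¹, inv_inv, abs_of_pos ha, smul_eq_mul]

theorem MeasureTheory.MemLp.comp_mul_left_real {u : ℝ → ℝ} (hu : MemLp u 2 volume) {a : ℝ}
    (ha : a ≠ 0) : MemLp (fun x => u (a * x)) 2 volume := by
  have hq : Measure.QuasiMeasurePreserving (fun x : ℝ => a * x) volume volume := by
    refine ⟨by fun_prop, ?_⟩
    rw [Real.map_volume_mul_left ha]
    exact Measure.smul_absolutelyContinuous
  refine (memLp_two_iff_integrable_sq (hu.1.comp_quasiMeasurePreserving hq)).2 ?_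
  exact hu.integrable_sq.comp_mul_left' ha

/-- The unscaled bound for the normalised function `x ↦ (am)^(-1/2) u(x/a)`. The quartic term is not
quadratic in `u`, which is why it carries the extra factor `1/m`. -/
theorem pekar_stability_scaled {B : ℝ} (hVm : Continuous V)
    (hV0 : ∀ x, 0 ≤ V x) (hVB : ∀ x, V x ≤ B) {k : ℝ} (hk : 1 / 2 ≤ k) (hk1 : k ≤ 1) {a : ℝ}
    (ha : 0 < a) {u du : ℝ → ℝ} (h : IsPrimitive u du) (hu : MemLp u 2 volume)
    (hdu : MemLp du 2 volume) {m : ℝ} (hm : 0 < m) (hu1 : ∫ x, u x ^ 2 = m) :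
    a ^ 2 * (pekarEnergy V - pekarStability V B * (1 - k)) * m
      ≤ k * (∫ x, du x ^ 2) - a / (k * m) * (∫ x, u x ^ 4) - a ^ 2 * ∫ x, V (a * x) * u x ^ 2 := by
  set s := (Real.sqrt (a * m))⁻¹ with hs
  have hs2 : s ^ 2 = (a * m)⁻¹ := by rw [hs, inv_pow, Real.sq_sqrt (by positivity)]
  have hp := h.comp_mul_left (inv_ne_zero ha.ne') s
  have hm1 : MemLp (fun x => s * u (a⁻¹ * x)) 2 volume :=
    (hu.comp_mul_left_real (inv_ne_zero ha.ne')).const_mul s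
  have hm2 : MemLp (fun x => s * a⁻¹ * du (a⁻¹ * x)) 2 volume :=
    (hdu.comp_mul_left_real (inv_ne_zero ha.ne')).const_mul (s * a⁻¹)
  have e1 : ∫ x, (s * u (a⁻¹ * x)) ^ 2 = 1 := by
    simp_rw [mul_pow]
    rw [integral_const_mul, integral_comp_inv_mul ha (fun x => u x ^ 2), hu1, hs2]
    field_simp
  have key := pekar_stability hVm.aestronglyMeasurable hV0 hVB hk hk1 hp hm1 hm2 e1
  have e2 : ∫ x, (s * a⁻¹ * du (a⁻¹ * x)) ^ 2 = (∫ x, du x ^ 2) / (a ^ 2 * m) := by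
    simp_rw [mul_pow]
    rw [integral_const_mul, integral_comp_inv_mul ha (fun x => du x ^ 2), hs2]
    field_simp
  have e3 : ∫ x, (s * u (a⁻¹ * x)) ^ 4 = (∫ x, u x ^ 4) / (a * m ^ 2) := by
    simp_rw [mul_pow]
    rw [integral_const_mul, integral_comp_inv_mul ha (fun x => u x ^ 4),
      show s ^ 4 = (s ^ 2) ^ 2 by ring, hs2]
    field_simp
  have e4 : ∫ x, V x * (s * u (a⁻¹ * x)) ^ 2 = (∫ x, V (a * x) * u x ^ 2) / m := by
    have : ∀ x, V x * (s * u (a⁻¹ * x)) ^ 2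
        = (fun x => (a * m)⁻¹ * (V (a * x) * u x ^ 2)) (a⁻¹ * x) := by
      intro x
      simp only [mul_pow, hs2]
      rw [mul_inv_cancel_left₀ ha.ne']
      ring
    simp_rw [this]
    rw [integral_comp_inv_mul ha (fun x => (a * m)⁻¹ * (V (a * x) * u x ^ 2)), integral_const_mul]
    field_simp
  rw [e2, e3, e4] at key
  have := mul_le_mul_of_nonneg_left key (by positivity : 0 ≤ a ^ 2 * m)
  calc _ = a ^ 2 * m * (pekarEnergy V - pekarStability V B * (1 - k)) := by ring
    _ ≤ _ := this
    _ = _ := by field_simp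

/-- The energy of an electron in a classical field that is constant on each of finitely many
disjoint cells is bounded below by the Pekar energy. -/
theorem classicalField_lower_bound {B : ℝ} (hVm : Continuous V)
    (hV0 : ∀ x, 0 ≤ V x) (hVB : ∀ x, V x ≤ B) {k : ℝ} (hk : 1 / 2 ≤ k) (hk1 : k ≤ 1) {a : ℝ}
    (ha : 0 < a) {u du : ℝ → ℝ} (h : IsPrimitive u du) (hu : MemLp u 2 volume)
    (hdu : MemLp du 2 volume) {ι : Type*} (A : Finset ι) (Ω : ι → Set ℝ)
    (hΩ : ∀ i ∈ A, MeasurableSet (Ω i)) (hdis : (A : Set ι).PairwiseDisjoint Ω) {l : ℝ} (hl : 0 < l)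
    (hΩl : ∀ i ∈ A, volume (Ω i) ≤ ENNReal.ofReal l) (z : ι → ℝ) :
    a ^ 2 * (pekarEnergy V - pekarStability V B * (1 - k)) * (∫ x, u x ^ 2)
      ≤ k * (∫ x, du x ^ 2) - (a ^ 2 * ∫ x, V (a * x) * u x ^ 2)
        + (∑ i ∈ A, (k / 4 * z i ^ 2 * (∫ x, u x ^ 2)
          - Real.sqrt (a / l) * (z i * ∫ x in Ω i, u x ^ 2))) := by
  have hk0 : 0 < k := by linarith
  -- Zero mass is separated because the scaled bound divides by the mass; there only the nonnegative
  -- kinetic term survives.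
  rcases (integral_nonneg fun x => sq_nonneg (u x) : 0 ≤ ∫ x, u x ^ 2).eq_or_lt with h0 | hm
  · have hz : ∀ᵐ x, u x ^ 2 = 0 :=
      (integral_eq_zero_iff_of_nonneg (fun x => sq_nonneg (u x)) hu.integrable_sq).1 h0.symm
    have z1 : ∫ x, V (a * x) * u x ^ 2 = 0 :=
      integral_eq_zero_of_ae (hz.mono fun x hx => by simp only [hx, mul_zero]; rfl)
    have z2 : ∀ i, ∫ x in Ω i, u x ^ 2 = 0 := fun i =>
      integral_eq_zero_of_ae ((ae_restrict_of_ae hz).mono fun x hx => by simpa using hx)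
    simp only [← h0, z1, z2]
    have : 0 ≤ ∫ x, du x ^ 2 := integral_nonneg fun x => sq_nonneg _
    simp only [mul_zero, sub_zero, Finset.sum_const_zero, add_zero]
    positivity
  · set m := ∫ x, u x ^ 2 with hmdef
    have key := pekar_stability_scaled hVm hV0 hVB hk hk1 ha h hu hdu hm hmdef.symm
    have i4 : Integrable (fun x => u x ^ 4) := by
      have hs2 : ((Real.sqrt m)⁻¹) ^ 2 = m⁻¹ := by rw [inv_pow, Real.sq_sqrt hm.le]
      have := (h.comp_mul_left one_ne_zero (Real.sqrt m)⁻¹).integrable_pow_four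
        (by simpa using hu.const_mul (Real.sqrt m)⁻¹) (by simpa using hdu.const_mul (Real.sqrt m)⁻¹)
        (by simp only [one_mul, mul_pow, hs2]; rw [integral_const_mul, inv_mul_cancel₀ hm.ne'])
      simp only [one_mul, mul_pow] at this
      exact (integrable_const_mul_iff (IsUnit.mk0 _ (by positivity)) _).1 this
    -- Completing the square in `z i` leaves `-(a/(kml)) r²`, with `r` the mass in the cell, and
    -- Cauchy–Schwarz on a set of measure at most `l` gives `r² ≤ l ∫ u⁴`.
    have hcell : ∀ i ∈ A, -(a / (k * m)) * (∫ x in Ω i, u x ^ 4) ≤ k / 4 * z i ^ 2 * m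
          - Real.sqrt (a / l) * (z i * ∫ x in Ω i, u x ^ 2) := by
      intro i hi
      set r := ∫ x in Ω i, u x ^ 2
      have hfin : IsFiniteMeasure (volume.restrict (Ω i)) :=
        ⟨by simpa using (hΩl i hi).trans_lt ENNReal.ofReal_lt_top⟩
      have hr : r ^ 2 / l ≤ ∫ x in Ω i, u x ^ 4 := by
        -- Cauchy–Schwarz as a nonnegative variance; centring at `r / l` also covers sets of measure
        -- smaller than `l`.
        have h1 : 0 ≤ ∫ x in Ω i, (u x ^ 2 - r / l) ^ 2 := integral_nonneg fun x => sq_nonneg _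
        have h2 : ∫ x in Ω i, (u x ^ 2 - r / l) ^ 2
            = (∫ x in Ω i, u x ^ 4) - 2 * (r / l) * r + (r / l) ^ 2 * volume.real (Ω i) := by
          have : ∀ x, (u x ^ 2 - r / l) ^ 2 = u x ^ 4 - 2 * (r / l) * u x ^ 2 + (r / l) ^ 2 :=
            fun x => by ring
          have i5 : IntegrableOn (fun x => u x ^ 4 - 2 * (r / l) * u x ^ 2) (Ω i) :=
            i4.restrict.sub (hu.integrable_sq.restrict.const_mul _)
          simp_rw [this]
          rw [integral_add i5 (integrable_const _), integral_sub i4.restrict (hu.integrable_sq.restrict.const_mul _),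
            integral_const_mul]
          simp [mul_comm, r]
        have h3 : volume.real (Ω i) ≤ l := ENNReal.toReal_le_of_le_ofReal hl.le (hΩl i hi)
        have h4 := mul_le_mul_of_nonneg_left h3 (sq_nonneg (r / l))
        have h5 : (r / l) ^ 2 * l = r ^ 2 / l := by field_simp
        have h6 : 2 * (r / l) * r = 2 * (r ^ 2 / l) := by ring
        linarith
      have hsq : Real.sqrt (a / l) ^ 2 = a / l := Real.sq_sqrt (by positivity)
      have h1 : -(a / (k * m)) * (∫ x in Ω i, u x ^ 4) ≤ -(a / (k * m)) * (r ^ 2 / l) := by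
        have := mul_le_mul_of_nonneg_left hr (by positivity : 0 ≤ a / (k * m))
        linarith
      refine h1.trans ?_
      have h2 : k / 4 * z i ^ 2 * m - Real.sqrt (a / l) * (z i * r) + (a / (k * m)) * (r ^ 2 / l)
          = (k * m * z i / 2 - Real.sqrt (a / l) * r) ^ 2 / (k * m) := by
        have : (k * m * z i / 2 - Real.sqrt (a / l) * r) ^ 2
            = (k * m * z i / 2) ^ 2 - k * m * z i * Real.sqrt (a / l) * r + (a / l) * r ^ 2 := by
          linear_combination r ^ 2 * hsq
        rw [this]; field_simp; ring
      have h3 : 0 ≤ (k * m * z i / 2 - Real.sqrt (a / l) * r) ^ 2 / (k * m) := by positivity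
      linarith
    have hsum := Finset.sum_le_sum hcell
    rw [← Finset.mul_sum, ← integral_biUnion_finset A hΩ hdis fun i _ => i4.integrableOn] at hsum
    have h5 : ∫ x in ⋃ i ∈ A, Ω i, u x ^ 4 ≤ ∫ x, u x ^ 4 :=
      setIntegral_le_integral i4 (ae_of_all _ fun x => by positivity)
    have h6 := mul_le_mul_of_nonneg_left h5 (by positivity : 0 ≤ a / (k * m))
    linarith

end Pekar

/-! ### The truncated field operator of one mode. -/

section Jacobi

/-- The matrix of the annihilation operator of one mode, truncated at occupation number `N`. -/
noncomputable def loweringMatrix (N : ℕ) (p q : Fin (N + 1)) : ℝ :=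
  if (q : ℕ) = p + 1 then Real.sqrt (p + 1) else 0

/-- The matrix of the field operator `b + b†` of one mode, truncated at occupation number `N`. -/
noncomputable def fieldMatrix (N : ℕ) : Matrix (Fin (N + 1)) (Fin (N + 1)) ℝ :=
  fun p q => loweringMatrix N p q + loweringMatrix N q p

theorem fieldMatrix_isHermitian (N : ℕ) : (fieldMatrix N).IsHermitian := by
  ext p q
  simp [fieldMatrix, add_comm]

/-- `U p s` is the `p`-th entry of the `s`-th eigenvector and `z s` its eigenvalue; the identities
express `1`, `A` and `A²` in this basis. In coordinates they can be multiplied over modes. -/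
theorem Matrix.IsHermitian.exists_spectral_sum {n : Type*} [Fintype n] [DecidableEq n]
    {A : Matrix n n ℝ} (hA : A.IsHermitian) :
    ∃ (U : n → n → ℝ) (z : n → ℝ), (∀ p q, ∑ s, U p s * U q s = if p = q then 1 else 0) ∧
      (∀ p q, ∑ s, z s * (U p s * U q s) = A p q) ∧
      ∀ p q, ∑ s, z s ^ 2 * (U p s * U q s) = ∑ r, A p r * A r q := by
  set b := hA.eigenvectorBasis
  have h1 : ∀ p q, ∑ s, b s p * b s q = if p = q then 1 else 0 := by
    intro p q
    have h := b.sum_inner_mul_inner (EuclideanSpace.single p (1:ℝ)) (EuclideanSpace.single q (1:ℝ))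
    simp only [EuclideanSpace.inner_single_left, EuclideanSpace.inner_single_right] at h
    simpa [Pi.single_apply, eq_comm] using h
  have h2 : ∀ p s, ∑ q, A p q * b s q = hA.eigenvalues s * b s p := by
    intro p s
    have := congrFun (hA.mulVec_eigenvectorBasis s) p
    simpa [Matrix.mulVec, dotProduct] using this
  have h3 : ∀ p q, ∑ s, hA.eigenvalues s * (b s p * b s q) = A p q := by
    intro p q
    calc ∑ s, hA.eigenvalues s * (b s p * b s q) = ∑ s, ∑ r, A p r * b s r * b s q := by
          refine Finset.sum_congr rfl fun s _ => ?_
          rw [← Finset.sum_mul, h2]; ring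
      _ = ∑ r, A p r * ∑ s, b s r * b s q := by
          rw [Finset.sum_comm]
          simp_rw [Finset.mul_sum, mul_assoc]
      _ = A p q := by simp [h1]
  refine ⟨fun p s => b s p, hA.eigenvalues, h1, h3, fun p q => ?_⟩
  calc ∑ s, hA.eigenvalues s ^ 2 * (b s p * b s q)
      = ∑ s, ∑ r, A p r * (hA.eigenvalues s * (b s r * b s q)) := by
        refine Finset.sum_congr rfl fun s _ => ?_
        have : hA.eigenvalues s ^ 2 * (b s p * b s q)
            = hA.eigenvalues s * b s q * (hA.eigenvalues s * b s p) := by ring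
        rw [this, ← h2 p s, Finset.mul_sum]
        exact Finset.sum_congr rfl fun r _ => by ring
    _ = ∑ r, A p r * A r q := by
        rw [Finset.sum_comm]
        simp_rw [← Finset.mul_sum, h3]

theorem sum_loweringMatrix_sq_left_le (N : ℕ) (q : Fin (N + 1)) :
    ∑ p, loweringMatrix N p q ^ 2 ≤ q := by
  by_cases hq : (q : ℕ) = 0
  · rw [Finset.sum_eq_zero]
    · positivity
    · intro p _
      simp [loweringMatrix, hq]
  · have hlt : (q : ℕ) - 1 < N + 1 := by omega
    rw [Finset.sum_eq_single ⟨(q : ℕ) - 1, hlt⟩]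
    · unfold loweringMatrix
      split_ifs
      · rw [Real.sq_sqrt (by positivity)]
        have : (((q : ℕ) - 1 : ℕ) : ℝ) = (q : ℝ) - 1 := by
          rw [Nat.cast_sub (by omega)]; simp
        simp [this]
      · simp
    · intro p _ hp
      have : (q : ℕ) ≠ p + 1 := fun h => hp (Fin.ext (by simp; omega))
      simp [loweringMatrix, this]
    · simp

/-- The inequality is strict only at `p = N`, where truncation removes the entry that leads to
occupation number `N + 1`. -/
theorem sum_loweringMatrix_sq_right_le (N : ℕ) (p : Fin (N + 1)) :
    ∑ q, loweringMatrix N p q ^ 2 ≤ p + 1 := by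
  by_cases hp : (p : ℕ) + 1 < N + 1
  · rw [Finset.sum_eq_single ⟨(p : ℕ) + 1, hp⟩]
    · simp [loweringMatrix, Real.sq_sqrt (show (0:ℝ) ≤ p + 1 by positivity)]
    · intro q _ hq
      have : (q : ℕ) ≠ p + 1 := fun h => hq (Fin.ext (by simp; omega))
      simp [loweringMatrix, this]
    · simp
  · rw [Finset.sum_eq_zero]
    · positivity
    · intro q _
      have : (q : ℕ) ≠ p + 1 := by omega
      simp [loweringMatrix, this]

theorem norm_sum_sq_le_of_subsingleton {n : Type*} [Fintype n] [DecidableEq n] (r : n → ℝ)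
    (c : n → ℂ) (h : ∀ i j, r i ≠ 0 → r j ≠ 0 → i = j) :
    ‖∑ i, (r i : ℂ) * c i‖ ^ 2 ≤ ∑ i, r i ^ 2 * ‖c i‖ ^ 2 := by
  by_cases h0 : ∃ i, r i ≠ 0
  · obtain ⟨i, hi⟩ := h0
    have hz : ∀ j, j ≠ i → r j = 0 := fun j hj => by
      by_contra hne; exact hj (h j i hne hi)
    rw [Finset.sum_eq_single i (fun j _ hj => by simp [hz j hj]) (by simp),
      Finset.sum_eq_single i (fun j _ hj => by simp [hz j hj]) (by simp)]
    rw [norm_mul, mul_pow, Complex.norm_real, Real.norm_eq_abs, sq_abs]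
  · push Not at h0
    simp [h0]

/-- This is `(b + b†)² ≤ 2b†b + 2bb† = 4b†b + 2`, where truncation can only lower the middle
expression. The constant `2` is the zero-point energy that later costs `k/2` per mode. -/
theorem sum_norm_fieldMatrix_sq_le (N : ℕ) (c : Fin (N + 1) → ℂ) :
    ∑ p, ‖∑ q, (fieldMatrix N p q : ℂ) * c q‖ ^ 2 ≤ ∑ p : Fin (N + 1), (4 * ((p : ℕ) : ℝ) + 2) * ‖c p‖ ^ 2 := by
  have h1 : ∀ p, ‖∑ q, (fieldMatrix N p q : ℂ) * c q‖ ^ 2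
      ≤ 2 * ∑ q, loweringMatrix N p q ^ 2 * ‖c q‖ ^ 2
        + 2 * ∑ q, loweringMatrix N q p ^ 2 * ‖c q‖ ^ 2 := by
    intro p
    have e : ∑ q, (fieldMatrix N p q : ℂ) * c q = (∑ q, (loweringMatrix N p q : ℂ) * c q)
        + ∑ q, (loweringMatrix N q p : ℂ) * c q := by
      rw [← Finset.sum_add_distrib]
      refine Finset.sum_congr rfl fun q _ => ?_
      simp [fieldMatrix, add_mul]
    have a1 := norm_sum_sq_le_of_subsingleton (fun q => loweringMatrix N p q) c (by
      intro i j hi hj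
      simp only [loweringMatrix, ne_eq, ite_eq_right_iff, Classical.not_imp] at hi hj
      exact Fin.ext (by omega))
    have a2 := norm_sum_sq_le_of_subsingleton (fun q => loweringMatrix N q p) c (by
      intro i j hi hj
      simp only [loweringMatrix, ne_eq, ite_eq_right_iff, Classical.not_imp] at hi hj
      exact Fin.ext (by omega))
    rw [e]
    have a3 := norm_add_le (∑ q, (loweringMatrix N p q : ℂ) * c q)
      (∑ q, (loweringMatrix N q p : ℂ) * c q)
    have a4 := pow_le_pow_left₀ (norm_nonneg _) a3 2
    have a5 := add_sq_le (a := ‖∑ q, (loweringMatrix N p q : ℂ) * c q‖)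
      (b := ‖∑ q, (loweringMatrix N q p : ℂ) * c q‖)
    linarith
  refine (Finset.sum_le_sum fun p _ => h1 p).trans ?_
  rw [Finset.sum_add_distrib, ← Finset.mul_sum, ← Finset.mul_sum,
    Finset.sum_comm (f := fun p q => loweringMatrix N p q ^ 2 * ‖c q‖ ^ 2),
    Finset.sum_comm (f := fun p q => loweringMatrix N q p ^ 2 * ‖c q‖ ^ 2),
    Finset.mul_sum, Finset.mul_sum, ← Finset.sum_add_distrib]
  refine Finset.sum_le_sum fun q _ => ?_
  rw [← Finset.sum_mul, ← Finset.sum_mul]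
  have b1 := mul_le_mul_of_nonneg_right (sum_loweringMatrix_sq_left_le N q) (sq_nonneg ‖c q‖)
  have b2 := mul_le_mul_of_nonneg_right (sum_loweringMatrix_sq_right_le N q) (sq_nonneg ‖c q‖)
  linarith

end Jacobi

/-! ### Diagonalising the field operators of finitely many modes at once. -/

section JointDiagonalisation

variable {ι : Type*} [Fintype ι] [DecidableEq ι] {n : Type*} [Fintype n] [DecidableEq n]

theorem sum_prod_mul_prod_eq (U : n → n → ℝ) (th : ι → n → ℝ) (v w : ι → n) :
    ∑ M : ι → n, (∏ i, th i (M i)) * ((∏ i, U (v i) (M i)) * ∏ i, U (w i) (M i))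
      = ∏ i, ∑ s, th i s * (U (v i) s * U (w i) s) := by
  rw [Finset.prod_univ_sum, Fintype.piFinset_univ]
  simp_rw [Finset.prod_mul_distrib]

theorem norm_sq_sum_real_mul (r : n → ℝ) (d : n → ℂ) :
    (‖∑ v, (r v : ℂ) * d v‖ ^ 2 : ℝ)
      = (∑ v, ∑ w, ((r v * r w : ℝ) : ℂ) * (star (d v) * d w)).re := by
  have : ((‖∑ v, (r v : ℂ) * d v‖ ^ 2 : ℝ) : ℂ)
      = ∑ v, ∑ w, ((r v * r w : ℝ) : ℂ) * (star (d v) * d w) := by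
    push_cast
    rw [← Complex.conj_mul', map_sum, Finset.sum_mul_sum]
    refine Finset.sum_congr rfl fun v _ => Finset.sum_congr rfl fun w _ => ?_
    simp; ring
  rw [← this, Complex.ofReal_re]

/-- Products of one-mode eigenvectors form the joint eigenbasis, and for a product weight the sum
over the basis factorises into one-mode sums. -/
theorem sum_weight_mul_norm_sq (U : n → n → ℝ) (th : ι → n → ℝ) (d : (ι → n) → ℂ) :
    ∑ M : ι → n, (∏ i, th i (M i)) * ‖∑ v : ι → n, ((∏ i, U (v i) (M i) : ℝ) : ℂ) * d v‖ ^ 2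
      = (∑ v, ∑ w, ((∏ i, ∑ s, th i s * (U (v i) s * U (w i) s) : ℝ) : ℂ)
          * (star (d v) * d w)).re := by
  simp_rw [norm_sq_sum_real_mul, ← sum_prod_mul_prod_eq, ← Complex.re_ofReal_mul, ← Complex.re_sum]
  congr 1
  simp_rw [Finset.mul_sum]
  rw [Finset.sum_comm]
  refine Finset.sum_congr rfl fun v _ => ?_
  rw [Finset.sum_comm]
  refine Finset.sum_congr rfl fun w _ => ?_
  rw [Complex.ofReal_sum, Finset.sum_mul]
  refine Finset.sum_congr rfl fun M _ => ?_
  push_cast; ring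

theorem sum_norm_sq_of_orthogonal {U : n → n → ℝ}
    (hU : ∀ p q, ∑ s, U p s * U q s = if p = q then 1 else 0) (d : (ι → n) → ℂ) :
    ∑ M : ι → n, ‖∑ v : ι → n, ((∏ i, U (v i) (M i) : ℝ) : ℂ) * d v‖ ^ 2
      = ∑ v, ‖d v‖ ^ 2 := by
  have h := sum_weight_mul_norm_sq U (fun _ _ => 1) d
  simp only [Finset.prod_const_one, one_mul, hU] at h
  rw [h, Complex.re_sum]
  refine Finset.sum_congr rfl fun v _ => ?_
  rw [Finset.sum_eq_single v]
  · simp [Complex.conj_mul', ← Complex.ofReal_pow]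
  · intro w _ hw
    obtain ⟨i, hi⟩ := Function.ne_iff.1 hw
    rw [Finset.prod_eq_zero (Finset.mem_univ i) (by simp [Ne.symm hi])]
    simp
  · simp

/-- A weight that depends on mode `j` only leaves orthogonality in every other mode, so just the
configurations that differ from `v` at `j` contribute. -/
theorem sum_weight_norm_sq_of_orthogonal {U : n → n → ℝ}
    (hU : ∀ p q, ∑ s, U p s * U q s = if p = q then 1 else 0) (z : n → ℝ) (j : ι)
    (d : (ι → n) → ℂ) :
    ∑ M : ι → n, z (M j) * ‖∑ v : ι → n, ((∏ i, U (v i) (M i) : ℝ) : ℂ) * d v‖ ^ 2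
      = (∑ v, ∑ q, ((∑ s, z s * (U (v j) s * U q s) : ℝ) : ℂ)
          * (star (d v) * d (Function.update v j q))).re := by
  have h := sum_weight_mul_norm_sq U (fun i s => if i = j then z s else 1) d
  have h1 : ∀ M : ι → n, ∏ i, (if i = j then z (M i) else 1) = z (M j) := by
    intro M; rw [Finset.prod_ite_eq' Finset.univ j]; simp
  simp only [h1] at h
  rw [h]
  congr 1
  refine Finset.sum_congr rfl fun v _ => ?_
  symm
  refine Finset.sum_of_injOn (fun q => Function.update v j q) ?_ (by simp) ?_ ?_
  · intro a _ b _ hab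
    simpa using congrFun hab j
  · intro w _ hw
    have : ∃ i, i ≠ j ∧ v i ≠ w i := by
      by_contra hcon
      push Not at hcon
      apply hw
      refine ⟨w j, by simp, ?_⟩
      ext i
      by_cases hij : i = j
      · subst hij; simp
      · simp [hij, hcon i hij]
    obtain ⟨i, hij, hne⟩ := this
    rw [Finset.prod_eq_zero (Finset.mem_univ i) (by simp [hij, hU, hne])]
    simp
  · intro q _
    congr 2
    rw [Finset.prod_eq_single j]
    · simp
    · intro i _ hij
      simp [hij, hU]
    · simp

theorem sum_pi_eq_sum_update (j : ι) (F : (ι → n) → ℂ) :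
    ∑ v : ι → n, F v = ∑ r : {i // i ≠ j} → n, ∑ p : n, F ((Equiv.funSplitAt j n).symm (p, r)) := by
  rw [← Equiv.sum_comp (Equiv.funSplitAt j n).symm, Fintype.sum_prod_type_right]

theorem update_funSplitAt_symm (j : ι) (p q : n) (r : {i // i ≠ j} → n) :
    Function.update ((Equiv.funSplitAt j n).symm (p, r)) j q
      = (Equiv.funSplitAt j n).symm (q, r) := by
  ext i
  by_cases h : i = j
  · subst h; simp [Equiv.funSplitAt, Equiv.piSplitAt]
  · simp [Equiv.funSplitAt, Equiv.piSplitAt, h]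

/-- The truncated field operators of finitely many modes are jointly diagonalisable. -/
theorem exists_joint_diagonalisation (ι : Type*) [Fintype ι] [DecidableEq ι] (N : ℕ) :
    ∃ (W : (ι → Fin (N + 1)) → (ι → Fin (N + 1)) → ℝ) (z : (ι → Fin (N + 1)) → ι → ℝ),
      ∀ d : (ι → Fin (N + 1)) → ℂ,
        (∑ M, ‖∑ v, (W v M : ℂ) * d v‖ ^ 2 = ∑ v, ‖d v‖ ^ 2) ∧
        (∀ j, ∑ M, z M j * ‖∑ v, (W v M : ℂ) * d v‖ ^ 2
          = 2 * (∑ v, ∑ q, (loweringMatrix N (v j) q : ℂ)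
            * (star (d v) * d (Function.update v j q))).re) ∧
        (∀ j, ∑ M, z M j ^ 2 * ‖∑ v, (W v M : ℂ) * d v‖ ^ 2
          ≤ ∑ v, (4 * (v j : ℝ) + 2) * ‖d v‖ ^ 2) := by
  obtain ⟨U, z, hU, hz, hz2⟩ := (fieldMatrix_isHermitian N).exists_spectral_sum
  refine ⟨fun v M => ∏ i, U (v i) (M i), fun M j => z (M j), fun d => ⟨?_, fun j => ?_, fun j => ?_⟩⟩
  · exact sum_norm_sq_of_orthogonal hU d
  · rw [sum_weight_norm_sq_of_orthogonal hU z j d]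
    simp_rw [hz]
    set f := (Equiv.funSplitAt j (Fin (N + 1))).symm
    have hf : ∀ p r, f (p, r) j = p := fun p r => by simp [f, Equiv.funSplitAt, Equiv.piSplitAt]
    rw [sum_pi_eq_sum_update j, sum_pi_eq_sum_update j]
    simp only [update_funSplitAt_symm]
    change (∑ r, ∑ p, ∑ q, (fieldMatrix N (f (p, r) j) q : ℂ) * (star (d (f (p, r))) * d (f (q, r)))).re
      = 2 * (∑ r, ∑ p, ∑ q, (loweringMatrix N (f (p, r) j) q : ℂ)
        * (star (d (f (p, r))) * d (f (q, r)))).re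
    rw [Complex.re_sum, Complex.re_sum, Finset.mul_sum]
    refine Finset.sum_congr rfl fun r _ => ?_
    simp only [hf]
    -- The field matrix is the lowering matrix plus its transpose, so its quadratic form is twice
    -- the real part of that of the lowering matrix. The occupation numbers `r` of the other modes
    -- are frozen.
    have e : ∑ p, ∑ q, (fieldMatrix N p q : ℂ) * (star (d (f (p, r))) * d (f (q, r)))
        = (∑ p, ∑ q, (loweringMatrix N p q : ℂ) * (star (d (f (p, r))) * d (f (q, r))))
          + star (∑ p, ∑ q, (loweringMatrix N p q : ℂ) * (star (d (f (p, r))) * d (f (q, r)))) := by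
      simp only [star_sum]
      rw [Finset.sum_comm (f := fun p q => star ((loweringMatrix N p q : ℂ)
        * (star (d (f (p, r))) * d (f (q, r))))), ← Finset.sum_add_distrib]
      refine Finset.sum_congr rfl fun p _ => ?_
      rw [← Finset.sum_add_distrib]
      refine Finset.sum_congr rfl fun q _ => ?_
      simp [fieldMatrix]; ring
    rw [e, Complex.add_re]
    simp; ring
  · have h := sum_weight_norm_sq_of_orthogonal hU (fun s => z s ^ 2) j d
    rw [h]
    simp_rw [hz2]
    set f := (Equiv.funSplitAt j (Fin (N + 1))).symm
    have hf : ∀ p r, f (p, r) j = p := fun p r => by simp [f, Equiv.funSplitAt, Equiv.piSplitAt]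
    have hR : ∑ v : ι → Fin (N + 1), (4 * (v j : ℝ) + 2) * ‖d v‖ ^ 2
        = ∑ r, ∑ p, (4 * ((f (p, r) j : ℕ) : ℝ) + 2) * ‖d (f (p, r))‖ ^ 2 := by
      rw [← Equiv.sum_comp (Equiv.funSplitAt j (Fin (N + 1))).symm, Fintype.sum_prod_type_right]
    rw [hR, sum_pi_eq_sum_update j]
    simp only [update_funSplitAt_symm]
    change (∑ r, ∑ p, ∑ q, ((∑ t, fieldMatrix N (f (p, r) j) t * fieldMatrix N t q : ℝ) : ℂ)
      * (star (d (f (p, r))) * d (f (q, r)))).re ≤ _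
    rw [Complex.re_sum]
    refine Finset.sum_le_sum fun r _ => ?_
    simp only [hf]
    refine le_trans (le_of_eq ?_) (sum_norm_fieldMatrix_sq_le N fun p => d (f (p, r)))
    simp_rw [norm_sq_sum_real_mul, ← Complex.re_sum]
    congr 1
    have e : ∀ p q, ((∑ t, fieldMatrix N p t * fieldMatrix N t q : ℝ) : ℂ)
        * (star (d (f (p, r))) * d (f (q, r)))
        = ∑ t, ((fieldMatrix N t p * fieldMatrix N t q : ℝ) : ℂ)
          * (star (d (f (p, r))) * d (f (q, r))) := by
      intro p q
      rw [Complex.ofReal_sum, Finset.sum_mul]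
      refine Finset.sum_congr rfl fun t _ => ?_
      rw [show fieldMatrix N p t = fieldMatrix N t p from add_comm _ _]
    refine (Finset.sum_congr rfl fun p _ => Finset.sum_congr rfl fun q _ => e p q).trans ?_
    rw [Finset.sum_comm_cycle]

end JointDiagonalisation

/-! ### Linear images and finite sums of primitives. -/

section PrimitiveLinear

variable {F G : Type*} [NormedAddCommGroup F] [NormedSpace ℝ F] [CompleteSpace F]
  [NormedAddCommGroup G] [NormedSpace ℝ G] [CompleteSpace G]

theorem IsPrimitive.clm_comp {u du : ℝ → F} (h : IsPrimitive u du)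
    (hdu : LocallyIntegrable du volume) (T : F →L[ℝ] G) :
    IsPrimitive (fun x => T (u x)) (fun x => T (du x)) := by
  obtain ⟨c, hc⟩ := h
  refine ⟨T c, ?_⟩
  filter_upwards [hc] with x hx
  rw [hx, map_add, T.intervalIntegral_comp_comm (hdu.intervalIntegrable' _ _)]

theorem IsPrimitive.sum {ι : Type*} (s : Finset ι) {u du : ι → ℝ → F}
    (h : ∀ i, IsPrimitive (u i) (du i)) (hdu : ∀ i, LocallyIntegrable (du i) volume) :
    IsPrimitive (fun x => ∑ i ∈ s, u i x) (fun x => ∑ i ∈ s, du i x) := by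
  choose c hc using h
  refine ⟨∑ i ∈ s, c i, ?_⟩
  filter_upwards [(Filter.eventually_all_finset s).2 fun i _ => hc i] with x hx
  rw [intervalIntegral.integral_finsetSum fun i _ => (hdu i).intervalIntegrable' _ _,
    ← Finset.sum_add_distrib]
  exact Finset.sum_congr rfl hx

end PrimitiveLinear

/-! ### From classical fields to quantised modes in occupation numbers. -/

section Disintegration

variable {V : ℝ → ℝ}

theorem MeasureTheory.MemLp.integrable_norm_sq {α F : Type*} [MeasurableSpace α] {μ : Measure α}
    [NormedAddCommGroup F] {u : α → F} (hu : MemLp u 2 μ) : Integrable (fun x => ‖u x‖ ^ 2) μ :=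
  hu.integrable_norm_pow (by norm_num)

theorem Complex.norm_sq_eq_re_sq_add_im_sq (z : ℂ) : ‖z‖ ^ 2 = z.re ^ 2 + z.im ^ 2 := by
  rw [Complex.sq_norm, Complex.normSq_apply]; ring

/-- With the field `z` fixed every term is quadratic in `u`, so the bounds for the real and
imaginary parts add up. For the quartic functional itself this would fail. -/
theorem classicalField_lower_bound_complex {B : ℝ} (hVm : Continuous V)
    (hV0 : ∀ x, 0 ≤ V x) (hVB : ∀ x, V x ≤ B) {k : ℝ} (hk : 1 / 2 ≤ k) (hk1 : k ≤ 1) {a : ℝ}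
    (ha : 0 < a) {u du : ℝ → ℂ} (h : IsPrimitive u du) (hu : MemLp u 2 volume)
    (hdu : MemLp du 2 volume) {ι : Type*} (A : Finset ι) (Ω : ι → Set ℝ)
    (hΩ : ∀ i ∈ A, MeasurableSet (Ω i)) (hdis : (A : Set ι).PairwiseDisjoint Ω) {l : ℝ} (hl : 0 < l)
    (hΩl : ∀ i ∈ A, volume (Ω i) ≤ ENNReal.ofReal l) (z : ι → ℝ) :
    a ^ 2 * (pekarEnergy V - pekarStability V B * (1 - k)) * (∫ x, ‖u x‖ ^ 2)
      ≤ k * (∫ x, ‖du x‖ ^ 2) - (a ^ 2 * ∫ x, V (a * x) * ‖u x‖ ^ 2)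
        + (∑ i ∈ A, (k / 4 * z i ^ 2 * (∫ x, ‖u x‖ ^ 2)
          - Real.sqrt (a / l) * (z i * ∫ x in Ω i, ‖u x‖ ^ 2))) := by
  have hdul := hdu.locallyIntegrable (by norm_num)
  have h1 := classicalField_lower_bound hVm hV0 hVB hk hk1 ha (h.clm_comp hdul Complex.reCLM)
    hu.re hdu.re A Ω hΩ hdis hl hΩl z
  have h2 := classicalField_lower_bound hVm hV0 hVB hk hk1 ha (h.clm_comp hdul Complex.imCLM)
    hu.im hdu.im A Ω hΩ hdis hl hΩl z
  simp only [Complex.reCLM_apply, Complex.imCLM_apply] at h1 h2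
  have ir : Integrable fun x => (u x).re ^ 2 := hu.re.integrable_sq
  have ii : Integrable fun x => (u x).im ^ 2 := hu.im.integrable_sq
  have idr : Integrable fun x => (du x).re ^ 2 := hdu.re.integrable_sq
  have idi : Integrable fun x => (du x).im ^ 2 := hdu.im.integrable_sq
  have hVa : Continuous fun x => V (a * x) := hVm.comp (by fun_prop)
  have e1 : ∫ x, ‖u x‖ ^ 2 = (∫ x, (u x).re ^ 2) + ∫ x, (u x).im ^ 2 := by
    simp_rw [Complex.norm_sq_eq_re_sq_add_im_sq]; exact integral_add ir ii
  have e2 : ∫ x, ‖du x‖ ^ 2 = (∫ x, (du x).re ^ 2) + ∫ x, (du x).im ^ 2 := by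
    simp_rw [Complex.norm_sq_eq_re_sq_add_im_sq]; exact integral_add idr idi
  have e3 : ∫ x, V (a * x) * ‖u x‖ ^ 2
      = (∫ x, V (a * x) * (u x).re ^ 2) + ∫ x, V (a * x) * (u x).im ^ 2 := by
    simp_rw [Complex.norm_sq_eq_re_sq_add_im_sq, mul_add]
    exact integral_add (integrable_potential_mul hVa.aestronglyMeasurable (fun x => hV0 _)
      (fun x => hVB _) ir) (integrable_potential_mul hVa.aestronglyMeasurable (fun x => hV0 _)
      (fun x => hVB _) ii)
  have e4 : ∀ i, ∫ x in Ω i, ‖u x‖ ^ 2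
      = (∫ x in Ω i, (u x).re ^ 2) + ∫ x in Ω i, (u x).im ^ 2 := fun i => by
    simp_rw [Complex.norm_sq_eq_re_sq_add_im_sq]; exact integral_add ir.restrict ii.restrict
  have h3 := add_le_add h1 h2
  rw [add_add_add_comm, ← Finset.sum_add_distrib] at h3
  simp only [e1, e2, e3, e4]
  calc _ = _ := by ring
    _ ≤ _ := h3
    _ = _ := by
      congr 1
      · ring
      · exact Finset.sum_congr rfl fun i _ => by ring

/-- Lower bound for the energy of an electron that interacts with finitely many phonon modes, each
coupled to the electron in its own cell; `d v` is the component with occupation numbers `v`. -/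
theorem occupation_lower_bound {B : ℝ} (hVm : Continuous V)
    (hV0 : ∀ x, 0 ≤ V x) (hVB : ∀ x, V x ≤ B) {k : ℝ} (hk : 1 / 2 ≤ k) (hk1 : k ≤ 1) {a : ℝ}
    (ha : 0 < a) {ι : Type*} [Fintype ι] [DecidableEq ι] {N : ℕ}
    {d dd : (ι → Fin (N + 1)) → ℝ → ℂ} (h : ∀ v, IsPrimitive (d v) (dd v))
    (hd : ∀ v, MemLp (d v) 2 volume) (hdd : ∀ v, MemLp (dd v) 2 volume)
    (A : Finset ι) (Ω : ι → Set ℝ)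
    (hΩ : ∀ i ∈ A, MeasurableSet (Ω i)) (hdis : (A : Set ι).PairwiseDisjoint Ω) {l : ℝ} (hl : 0 < l)
    (hΩl : ∀ i ∈ A, volume (Ω i) ≤ ENNReal.ofReal l) :
    (a ^ 2 * (pekarEnergy V - pekarStability V B * (1 - k)) - k / 2 * A.card)
        * (∑ v, ∫ x, ‖d v x‖ ^ 2)
      ≤ k * (∑ v, ∫ x, ‖dd v x‖ ^ 2) + k * (∑ v, (∑ i, (v i : ℝ)) * ∫ x, ‖d v x‖ ^ 2)
        - a ^ 2 * (∑ v, ∫ x, V (a * x) * ‖d v x‖ ^ 2)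
        - Real.sqrt (a / l) * (2 * (∑ i ∈ A, ∑ v, ∑ q, (loweringMatrix N (v i) q : ℂ)
            * ∫ x in Ω i, star (d v x) * d (Function.update v i q) x).re) := by
  obtain ⟨W, z, hW⟩ := exists_joint_diagonalisation ι N
  -- Electron wave functions conditioned on the joint eigenvector `M`; there the field in mode `i`
  -- is the number `z M i`. The matrix does not depend on `x`, so it commutes with the derivative
  -- and the potential.
  set w : (ι → Fin (N + 1)) → ℝ → ℂ := fun M x => ∑ v, (W v M : ℂ) * d v x with hw
  set dw : (ι → Fin (N + 1)) → ℝ → ℂ := fun M x => ∑ v, (W v M : ℂ) * dd v x with hdw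
  have hwm : ∀ M, MemLp (w M) 2 volume := fun M =>
    memLp_finsetSum _ fun v _ => (hd v).const_mul _
  have hdwm : ∀ M, MemLp (dw M) 2 volume := fun M =>
    memLp_finsetSum _ fun v _ => (hdd v).const_mul _
  have hwp : ∀ M, IsPrimitive (w M) (dw M) := fun M =>
    IsPrimitive.sum _ (fun v => (h v).clm_comp ((hdd v).locallyIntegrable (by norm_num))
      ((W v M : ℂ) • ContinuousLinearMap.id ℝ ℂ))
      fun v => ((hdd v).const_mul (W v M : ℂ)).locallyIntegrable (by norm_num)
  have hVa : Continuous fun x => V (a * x) := hVm.comp (by fun_prop)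
  have iV : ∀ {u : ℝ → ℂ}, MemLp u 2 volume → Integrable fun x => V (a * x) * ‖u x‖ ^ 2 :=
    fun hu => integrable_potential_mul hVa.aestronglyMeasurable (fun x => hV0 _)
      (fun x => hVB _) hu.integrable_norm_sq
  have e1 : ∑ M, ∫ x, ‖w M x‖ ^ 2 = ∑ v, ∫ x, ‖d v x‖ ^ 2 := by
    rw [← integral_finsetSum _ fun M _ => (hwm M).integrable_norm_sq,
      ← integral_finsetSum _ fun v _ => (hd v).integrable_norm_sq]
    exact integral_congr_ae (ae_of_all _ fun x => (hW fun v => d v x).1)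
  have e2 : ∑ M, ∫ x, ‖dw M x‖ ^ 2 = ∑ v, ∫ x, ‖dd v x‖ ^ 2 := by
    rw [← integral_finsetSum _ fun M _ => (hdwm M).integrable_norm_sq,
      ← integral_finsetSum _ fun v _ => (hdd v).integrable_norm_sq]
    exact integral_congr_ae (ae_of_all _ fun x => (hW fun v => dd v x).1)
  have e3 : ∑ M, ∫ x, V (a * x) * ‖w M x‖ ^ 2 = ∑ v, ∫ x, V (a * x) * ‖d v x‖ ^ 2 := by
    rw [← integral_finsetSum _ fun M _ => iV (hwm M),
      ← integral_finsetSum _ fun v _ => iV (hd v)]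
    refine integral_congr_ae (ae_of_all _ fun x => ?_)
    simp only [← Finset.mul_sum]
    rw [(hW fun v => d v x).1]
  have e4 : ∀ i, ∑ M, z M i * ∫ x in Ω i, ‖w M x‖ ^ 2
      = 2 * (∑ v, ∑ q, (loweringMatrix N (v i) q : ℂ)
          * ∫ x in Ω i, star (d v x) * d (Function.update v i q) x).re := by
    intro i
    have ip : ∀ v v', IntegrableOn (fun x => star (d v x) * d v' x) (Ω i) := fun v v' =>
      ((hd v).star.integrable_mul (hd v')).integrableOn
    simp_rw [← integral_const_mul]
    rw [← integral_finsetSum _ fun M _ => ((hwm M).integrable_norm_sq.const_mul _).integrableOn]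
    have e5 : ∑ v, ∑ q, ∫ x in Ω i, (loweringMatrix N (v i) q : ℂ)
          * (star (d v x) * d (Function.update v i q) x)
        = ∫ x in Ω i, ∑ v, ∑ q, (loweringMatrix N (v i) q : ℂ)
          * (star (d v x) * d (Function.update v i q) x) := by
      rw [integral_finsetSum _ fun v _ => integrable_finsetSum _ fun q _ => (ip _ _).const_mul _]
      refine Finset.sum_congr rfl fun v _ => ?_
      rw [integral_finsetSum _ fun q _ => (ip _ _).const_mul _]
    have i6 : IntegrableOn (fun x => ∑ v, ∑ q, (loweringMatrix N (v i) q : ℂ)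
          * (star (d v x) * d (Function.update v i q) x)) (Ω i) :=
      integrable_finsetSum _ fun v _ => integrable_finsetSum _ fun q _ => (ip _ _).const_mul _
    rw [e5]
    have e7 := integral_re (𝕜 := ℂ) i6
    simp only [RCLike.re_eq_complex_re] at e7
    rw [← e7, ← integral_const_mul]
    exact integral_congr_ae (ae_of_all _ fun x => (hW fun v => d v x).2.1 i)
  have e8 : ∀ i, ∑ M, z M i ^ 2 * ∫ x, ‖w M x‖ ^ 2 ≤ ∑ v, (4 * (v i : ℝ) + 2) * ∫ x, ‖d v x‖ ^ 2 := by
    intro i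
    simp_rw [← integral_const_mul]
    rw [← integral_finsetSum _ fun M _ => (hwm M).integrable_norm_sq.const_mul _,
      ← integral_finsetSum _ fun v _ => (hd v).integrable_norm_sq.const_mul _]
    exact integral_mono (integrable_finsetSum _ fun M _ => (hwm M).integrable_norm_sq.const_mul _)
      (integrable_finsetSum _ fun v _ => (hd v).integrable_norm_sq.const_mul _)
      fun x => (hW fun v => d v x).2.2 i
  have key := Finset.sum_le_sum fun M (_ : M ∈ Finset.univ) =>
    classicalField_lower_bound_complex hVm hV0 hVB hk hk1 ha (hwp M) (hwm M) (hdwm M)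
      A Ω hΩ hdis hl hΩl (z M)
  rw [← Finset.mul_sum, Finset.sum_add_distrib, Finset.sum_sub_distrib, ← Finset.mul_sum,
    ← Finset.mul_sum, e1, e2, e3, Finset.sum_comm] at key
  have hA : ∑ i ∈ A, ∑ M, (k / 4 * z M i ^ 2 * (∫ x, ‖w M x‖ ^ 2)
          - Real.sqrt (a / l) * (z M i * ∫ x in Ω i, ‖w M x‖ ^ 2))
      ≤ ∑ i ∈ A, (k * (∑ v, (v i : ℝ) * ∫ x, ‖d v x‖ ^ 2) + k / 2 * (∑ v, ∫ x, ‖d v x‖ ^ 2)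
        - Real.sqrt (a / l) * (2 * (∑ v, ∑ q, (loweringMatrix N (v i) q : ℂ)
          * ∫ x in Ω i, star (d v x) * d (Function.update v i q) x).re)) := by
    refine Finset.sum_le_sum fun i _ => ?_
    rw [Finset.sum_sub_distrib, ← Finset.mul_sum, e4]
    -- `(k/4)(4n + 2) = kn + k/2`: the classical field energy is paid for by the phonon number and
    -- `k/2` per mode.
    have h9 := mul_le_mul_of_nonneg_left (e8 i) (by linarith : 0 ≤ k / 4)
    simp only [add_mul, Finset.sum_add_distrib, mul_assoc, ← Finset.mul_sum] at h9 ⊢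
    linarith
  rw [Finset.sum_sub_distrib, Finset.sum_add_distrib, ← Finset.mul_sum, ← Finset.mul_sum,
    ← Finset.mul_sum, ← Finset.mul_sum, ← Complex.re_sum, Finset.sum_const, nsmul_eq_mul] at hA
  -- Modes outside `A` do not interact, and their phonon number is nonnegative.
  have hN : ∑ i ∈ A, ∑ v, (v i : ℝ) * ∫ x, ‖d v x‖ ^ 2
      ≤ ∑ v, (∑ i, (v i : ℝ)) * ∫ x, ‖d v x‖ ^ 2 := by
    rw [Finset.sum_comm]
    refine Finset.sum_le_sum fun v _ => ?_
    rw [← Finset.sum_mul]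
    exact mul_le_mul_of_nonneg_right (Finset.sum_le_univ_sum_of_nonneg fun i => by positivity)
      (integral_nonneg fun x => sq_nonneg _)
  have hN' := mul_le_mul_of_nonneg_left hN (by linarith : 0 ≤ k)
  linarith

end Disintegration

/-- Continuous primitives that agree almost everywhere agree everywhere, and may then be
differentiated. This carries the permutation symmetry of the coefficients over to their derivatives.
-/
theorem IsPrimitive.unique {F : Type*} [NormedAddCommGroup F] [NormedSpace ℝ F] [CompleteSpace F]
    {u du u' du' : ℝ → F} (h : IsPrimitive u du) (h' : IsPrimitive u' du')
    (hu : u =ᵐ[volume] u') (hdu : LocallyIntegrable du volume)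
    (hdu' : LocallyIntegrable du' volume) : du =ᵐ[volume] du' := by
  obtain ⟨c, hc⟩ := h
  obtain ⟨c', hc'⟩ := h'
  have cont : ∀ {g : ℝ → F} (c : F), LocallyIntegrable g volume →
      Continuous fun x => c + ∫ t in (0:ℝ)..x, g t := fun c hg =>
    continuous_const.add (intervalIntegral.continuous_primitive (fun a b => hg.intervalIntegrable' a b) 0)
  have he : (fun x => c + ∫ t in (0:ℝ)..x, du t) = fun x => c' + ∫ t in (0:ℝ)..x, du' t := by
    refine ((cont c hdu).ae_eq_iff_eq volume (cont c' hdu')).1 ?_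
    filter_upwards [hc, hc', hu] with x h1 h2 h3
    rw [← h1, ← h2, h3]
  filter_upwards [_root_.LocallyIntegrable.ae_hasDerivAt_integral hdu,
    _root_.LocallyIntegrable.ae_hasDerivAt_integral hdu'] with x h1 h2
  have h3 := (h1 0).const_add c
  rw [he] at h3
  exact h3.unique ((h2 0).const_add c')

/-! ### Words of modes, occupation numbers and multinomial weights. -/

section Words

variable {ι : Type*} [Fintype ι] [DecidableEq ι]

/-- The occupation numbers of a word of modes. -/
def occupation {n : ℕ} (w : Fin n → ι) (i : ι) : ℕ := (Finset.univ.filter fun j => w j = i).card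

theorem sum_occupation {n : ℕ} (w : Fin n → ι) : ∑ i, occupation w i = n := by
  have := Finset.card_eq_sum_card_fiberwise (s := (Finset.univ : Finset (Fin n)))
    (t := (Finset.univ : Finset ι)) (f := w) (by simp)
  simpa [occupation] using this.symm

theorem occupation_cons {n : ℕ} (i : ι) (w : Fin n → ι) :
    occupation (Fin.cons i w : Fin (n + 1) → ι) = occupation w + Pi.single i 1 := by
  ext j
  simp only [occupation, Fin.card_filter_univ_succ, Fin.cons_zero, Fin.cons_succ, Pi.add_apply]
  by_cases h : i = j
  · subst h; simp
  · simp [h, Ne.symm h]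

/-- Match the fibres over each mode, which have equal size, and glue the bijections. -/
theorem exists_perm_of_occupation_eq {n : ℕ} {w w' : Fin n → ι}
    (h : occupation w = occupation w') : ∃ σ : Equiv.Perm (Fin n), w' ∘ σ = w := by
  have hc : ∀ i, Fintype.card {j // w j = i} = Fintype.card {j // w' j = i} := fun i => by
    rw [Fintype.card_subtype, Fintype.card_subtype]; exact congrFun h i
  refine ⟨(Equiv.sigmaFiberEquiv w).symm.trans ((Equiv.sigmaCongrRight fun i =>
    Fintype.equivOfCardEq (hc i)).trans (Equiv.sigmaFiberEquiv w')), ?_⟩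
  ext j
  simp only [Function.comp_apply, Equiv.trans_apply]
  exact ((Fintype.equivOfCardEq (hc (w j))) ⟨j, rfl⟩).2

theorem exists_word (v : ι → ℕ) : ∃ w : Fin (∑ i, v i) → ι, occupation w = v := by
  have e : Fin (∑ i, v i) ≃ Σ i, Fin (v i) := Fintype.equivOfCardEq (by simp)
  refine ⟨fun j => (e j).1, ?_⟩
  ext i
  have h1 : occupation (fun j => (e j).1) i = Fintype.card {j // (e j).1 = i} := by
    rw [Fintype.card_subtype]; rfl
  rw [h1, Fintype.card_congr (e.subtypeEquiv (q := fun p => p.1 = i) fun j => Iff.rfl),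
    Fintype.card_congr (Equiv.sigmaSubtype i)]
  simp

/-- Expand `(∑ Xᵢ)ⁿ` once as a sum over words and once by the multinomial theorem, and apply the
linear functional that sends the monomial with exponent `v` to `F v`. -/
theorem sum_words_eq_sum_occupation (n : ℕ) (F : (ι → ℕ) → ℂ) :
    ∑ w : Fin n → ι, F (occupation w)
      = ∑ v ∈ Finset.univ.piAntidiag n, (Nat.multinomial Finset.univ v : ℂ) * F v := by
  set T : MvPolynomial ι ℂ →ₗ[ℂ] ℂ := (MvPolynomial.basisMonomials ι ℂ).constr ℂ fun s => F s
  have hT : ∀ s : ι →₀ ℕ, T (MvPolynomial.monomial s 1) = F s := fun s => by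
    have := (MvPolynomial.basisMonomials ι ℂ).constr_basis ℂ (fun s => F s) s
    rwa [MvPolynomial.coe_basisMonomials] at this
  have hmon : ∀ v : ι → ℕ, ∏ i, (MvPolynomial.X i : MvPolynomial ι ℂ) ^ v i
      = MvPolynomial.monomial (Finsupp.equivFunOnFinite.symm v) 1 := by
    intro v
    rw [MvPolynomial.monomial_eq, Finsupp.prod_fintype _ _ (by simp)]
    simp
  have h1 : (∑ i, (MvPolynomial.X i : MvPolynomial ι ℂ)) ^ n
      = ∑ w : Fin n → ι, ∏ i, (MvPolynomial.X i : MvPolynomial ι ℂ) ^ occupation w i := by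
    rw [Fintype.sum_pow]
    refine Finset.sum_congr rfl fun w _ => ?_
    rw [← Finset.prod_fiberwise (s := Finset.univ) (g := w)]
    refine Finset.prod_congr rfl fun i _ => ?_
    rw [occupation, ← Finset.prod_const]
    exact Finset.prod_congr rfl fun j hj => by rw [(Finset.mem_filter.1 hj).2]
  have h2 := Finset.sum_pow_eq_sum_piAntidiag Finset.univ
    (fun i => (MvPolynomial.X i : MvPolynomial ι ℂ)) n
  rw [h1] at h2
  have h3 := congrArg T h2
  simp only [map_sum, hmon, hT] at h3
  refine Eq.trans ?_ (h3.trans ?_)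
  · exact Finset.sum_congr rfl fun w _ => by simp
  · refine Finset.sum_congr rfl fun v _ => ?_
    rw [← nsmul_eq_mul, map_nsmul, hT, nsmul_eq_mul]
    simp

theorem sum_sum_words_eq (N : ℕ) (F : (ι → ℕ) → ℂ) :
    ∑ n ∈ Finset.range (N + 1), ∑ w : Fin n → ι, F (occupation w)
      = ∑ v : ι → Fin (N + 1), if ∑ i, (v i : ℕ) ≤ N then
          (Nat.multinomial Finset.univ (fun i => (v i : ℕ)) : ℂ) * F (fun i => v i) else 0 := by
  simp_rw [sum_words_eq_sum_occupation]
  rw [← Finset.sum_filter, Finset.sum_sigma']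
  symm
  refine Finset.sum_bij (fun v _ => ⟨∑ i, (v i : ℕ), fun i => (v i : ℕ)⟩) ?_ ?_ ?_ ?_
  · intro v hv
    simp only [Finset.mem_filter, Finset.mem_univ, true_and] at hv
    simp [Finset.mem_piAntidiag, Nat.lt_succ_of_le hv]
  · intro v _ v' _ h
    ext i
    have := congrFun (eq_of_heq (Sigma.mk.inj h).2) i
    exact this
  · rintro ⟨n, v⟩ h
    simp only [Finset.mem_sigma, Finset.mem_range, Finset.mem_piAntidiag, Finset.mem_univ,
      implies_true, and_true] at h
    obtain ⟨h1, h2⟩ := h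
    have hle : ∀ i, v i < N + 1 := fun i =>
      (Finset.single_le_sum (f := v) (fun _ _ => Nat.zero_le _) (Finset.mem_univ i)).trans_lt
        (h2 ▸ h1)
    refine ⟨fun i => ⟨v i, hle i⟩, ?_, ?_⟩
    · have : ∑ x, v x = n := h2
      simp only [Finset.mem_filter, Finset.mem_univ, true_and]; omega
    · simp [h2]
  · intro v _; rfl

/-- This ratio of multinomials reconciles the factor `√(n + 1)` of annihilation on words with the
factor `√(vᵢ + 1)` on occupation numbers. -/
theorem multinomial_add_single (v : ι → ℕ) (i : ι) :
    (Nat.multinomial Finset.univ (v + Pi.single i 1)) * (v i + 1)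
      = Nat.multinomial Finset.univ v * ((∑ j, v j) + 1) := by
  have h1 := Nat.multinomial_spec Finset.univ v
  have h2 := Nat.multinomial_spec Finset.univ (v + Pi.single i 1)
  have h3 : ∑ j, (v + Pi.single i 1 : ι → ℕ) j = (∑ j, v j) + 1 := by
    simp [Finset.sum_add_distrib]
  have h4 : ∏ j, ((v + Pi.single i 1 : ι → ℕ) j).factorial = (v i + 1) * ∏ j, (v j).factorial := by
    rw [← Finset.mul_prod_erase _ _ (Finset.mem_univ i),
      ← Finset.mul_prod_erase _ (fun j => (v j).factorial) (Finset.mem_univ i), ← mul_assoc]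
    congr 1
    · simp [Nat.factorial_succ]
    · refine Finset.prod_congr rfl fun j hj => ?_
      simp [Finset.ne_of_mem_erase hj]
  rw [h3, Nat.factorial_succ, ← h1, h4] at h2
  have hpos : 0 < ∏ j, (v j).factorial := Finset.prod_pos fun j _ => Nat.factorial_pos _
  have : (∏ j, (v j).factorial) * (Nat.multinomial Finset.univ (v + Pi.single i 1) * (v i + 1))
      = (∏ j, (v j).factorial) * (Nat.multinomial Finset.univ v * ((∑ j, v j) + 1)) := by
    linarith
  exact Nat.eq_of_mul_eq_mul_left hpos this

theorem sum_sum_words_eq_real (N : ℕ) (F : (ι → ℕ) → ℝ) :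
    ∑ n ∈ Finset.range (N + 1), ∑ w : Fin n → ι, F (occupation w)
      = ∑ v : ι → Fin (N + 1), if ∑ i, (v i : ℕ) ≤ N then
          (Nat.multinomial Finset.univ (fun i => (v i : ℕ)) : ℝ) * F (fun i => v i) else 0 := by
  have h := sum_sum_words_eq N fun v => (F v : ℂ)
  have h2 : ∀ v : ι → Fin (N + 1), (if ∑ i, (v i : ℕ) ≤ N then
          (Nat.multinomial Finset.univ (fun i => (v i : ℕ)) : ℂ) * (F (fun i => v i) : ℂ) else 0)
      = ((if ∑ i, (v i : ℕ) ≤ N then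
          (Nat.multinomial Finset.univ (fun i => (v i : ℕ)) : ℝ) * F (fun i => v i) else 0 : ℝ) : ℂ) := by
    intro v; split_ifs <;> simp
  simp_rw [h2] at h
  exact_mod_cast h

variable {V : ℝ → ℝ}

/-- Lower bound for the energy of an electron that interacts with finitely many phonon modes, each
coupled to the electron in its own cell; `c n w` is the coefficient of the `n`-phonon component at
the word `w` of modes. -/
theorem word_lower_bound {B : ℝ} (hVm : Continuous V)
    (hV0 : ∀ x, 0 ≤ V x) (hVB : ∀ x, V x ≤ B) {k : ℝ} (hk : 1 / 2 ≤ k) (hk1 : k ≤ 1) {a : ℝ}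
    (ha : 0 < a) {c dc : (n : ℕ) → (Fin n → ι) → ℝ → ℂ}
    (h : ∀ n w, IsPrimitive (c n w) (dc n w))
    (hc : ∀ n w, MemLp (c n w) 2 volume) (hdc : ∀ n w, MemLp (dc n w) 2 volume)
    (hsym : ∀ n w (σ : Equiv.Perm (Fin n)), c n (w ∘ σ) =ᵐ[volume] c n w) (N : ℕ)
    (A : Finset ι) (Ω : ι → Set ℝ)
    (hΩ : ∀ i ∈ A, MeasurableSet (Ω i)) (hdis : (A : Set ι).PairwiseDisjoint Ω) {l : ℝ} (hl : 0 < l)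
    (hΩl : ∀ i ∈ A, volume (Ω i) ≤ ENNReal.ofReal l) :
    (a ^ 2 * (pekarEnergy V - pekarStability V B * (1 - k)) - k / 2 * A.card)
        * (∑ n ∈ Finset.range (N + 1), ∑ w, ∫ x, ‖c n w x‖ ^ 2)
      ≤ k * (∑ n ∈ Finset.range (N + 1), ∑ w, ∫ x, ‖dc n w x‖ ^ 2)
        + k * (∑ n ∈ Finset.range (N + 1), ∑ w, (n : ℝ) * ∫ x, ‖c n w x‖ ^ 2)
        - a ^ 2 * (∑ n ∈ Finset.range (N + 1), ∑ w, ∫ x, V (a * x) * ‖c n w x‖ ^ 2)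
        - Real.sqrt (a / l) * (2 * (∑ i ∈ A, ∑ n ∈ Finset.range N, ∑ w, (Real.sqrt (n + 1) : ℂ)
            * ∫ x in Ω i, star (c n w x) * c (n + 1) (Fin.cons i w) x).re) := by
  -- By symmetry a coefficient depends on the occupation numbers only, so one representative word
  -- for each suffices.
  choose word hword using exists_word (ι := ι)
  set e : (ι → ℕ) → ℝ → ℂ := fun v => c _ (word v) with he
  set de : (ι → ℕ) → ℝ → ℂ := fun v => dc _ (word v) with hde
  have hocc : ∀ n m (w : Fin n → ι) (w' : Fin m → ι), occupation w = occupation w' →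
      c n w =ᵐ[volume] c m w' := by
    intro n m w w' hww
    have : n = m := by rw [← sum_occupation w, ← sum_occupation w', hww]
    subst this
    obtain ⟨σ, rfl⟩ := exists_perm_of_occupation_eq hww
    exact hsym n w' σ
  have hce : ∀ n (w : Fin n → ι), c n w =ᵐ[volume] e (occupation w) := fun n w =>
    hocc _ _ _ _ (hword _).symm
  have hdce : ∀ n (w : Fin n → ι), dc n w =ᵐ[volume] de (occupation w) := fun n w =>
    (h n w).unique (h _ _) (hce n w) ((hdc n w).locallyIntegrable (by norm_num))
      ((hdc _ _).locallyIntegrable (by norm_num))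
  set r : (ι → ℕ) → ℝ := fun v => Real.sqrt (Nat.multinomial Finset.univ v) with hr
  have hr2 : ∀ v, r v ^ 2 = Nat.multinomial Finset.univ v := fun v =>
    Real.sq_sqrt (Nat.cast_nonneg _)
  -- The square root of the multinomial turns the coefficient at one word into the normalised
  -- amplitude of the occupation state. Setting it to zero above total number `N` matches the cutoff
  -- on the Fock side.
  set s : (ι → Fin (N + 1)) → ℝ := fun v =>
    if ∑ i, (v i : ℕ) ≤ N then r (fun i => v i) else 0 with hs
  have hs2 : ∀ v, s v ^ 2 = if ∑ i, (v i : ℕ) ≤ N then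
      (Nat.multinomial Finset.univ (fun i => (v i : ℕ)) : ℝ) else 0 := by
    intro v; simp only [hs]; split_ifs
    · exact hr2 _
    · simp
  set d : (ι → Fin (N + 1)) → ℝ → ℂ := fun v x => (s v : ℂ) * e (fun i => v i) x with hd
  set dd : (ι → Fin (N + 1)) → ℝ → ℂ := fun v x => (s v : ℂ) * de (fun i => v i) x with hdd
  have key := occupation_lower_bound hVm hV0 hVB hk hk1 ha (d := d) (dd := dd)
    (fun v => (h _ _).clm_comp ((hdc _ _).locallyIntegrable (by norm_num))
      ((s v : ℂ) • ContinuousLinearMap.id ℝ ℂ))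
    (fun v => (hc _ _).const_mul _) (fun v => (hdc _ _).const_mul _) A Ω hΩ hdis hl hΩl
  have hnorm : ∀ (v : ι → Fin (N + 1)) (z : ℂ), ‖(s v : ℂ) * z‖ ^ 2 = s v ^ 2 * ‖z‖ ^ 2 := by
    intro v z; rw [norm_mul, mul_pow, Complex.norm_real, Real.norm_eq_abs, sq_abs]
  have quad : ∀ (F : (ι → ℕ) → ℝ), ∑ v : ι → Fin (N + 1), s v ^ 2 * F (fun i => v i)
      = ∑ n ∈ Finset.range (N + 1), ∑ w : Fin n → ι, F (occupation w) := by
    intro F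
    rw [sum_sum_words_eq_real]
    refine Finset.sum_congr rfl fun v _ => ?_
    rw [hs2]; split_ifs <;> simp
  have e1 : ∑ v, ∫ x, ‖d v x‖ ^ 2 = ∑ n ∈ Finset.range (N + 1), ∑ w, ∫ x, ‖c n w x‖ ^ 2 := by
    simp only [hd, hnorm, integral_const_mul]
    rw [quad fun v => ∫ x, ‖e v x‖ ^ 2]
    refine Finset.sum_congr rfl fun n _ => Finset.sum_congr rfl fun w _ => ?_
    exact integral_congr_ae ((hce n w).mono fun x hx => by simp only [hx])
  have e2 : ∑ v, ∫ x, ‖dd v x‖ ^ 2 = ∑ n ∈ Finset.range (N + 1), ∑ w, ∫ x, ‖dc n w x‖ ^ 2 := by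
    simp only [hdd, hnorm, integral_const_mul]
    rw [quad fun v => ∫ x, ‖de v x‖ ^ 2]
    refine Finset.sum_congr rfl fun n _ => Finset.sum_congr rfl fun w _ => ?_
    exact integral_congr_ae ((hdce n w).mono fun x hx => by simp only [hx])
  have e3 : ∑ v : ι → Fin (N + 1), (∑ i, (v i : ℝ)) * ∫ x, ‖d v x‖ ^ 2
      = ∑ n ∈ Finset.range (N + 1), ∑ w, (n : ℝ) * ∫ x, ‖c n w x‖ ^ 2 := by
    simp only [hd, hnorm, integral_const_mul]
    have := quad fun v => (∑ i, (v i : ℝ)) * ∫ x, ‖e v x‖ ^ 2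
    simp_rw [mul_left_comm] at this ⊢
    rw [this]
    refine Finset.sum_congr rfl fun n _ => Finset.sum_congr rfl fun w _ => ?_
    rw [← Nat.cast_sum, sum_occupation]
    congr 1
    exact integral_congr_ae ((hce n w).mono fun x hx => by simp only [hx])
  have e4 : ∑ v, ∫ x, V (a * x) * ‖d v x‖ ^ 2
      = ∑ n ∈ Finset.range (N + 1), ∑ w, ∫ x, V (a * x) * ‖c n w x‖ ^ 2 := by
    simp only [hd, hnorm, mul_left_comm (V _), integral_const_mul]
    rw [quad fun v => ∫ x, V (a * x) * ‖e v x‖ ^ 2]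
    refine Finset.sum_congr rfl fun n _ => Finset.sum_congr rfl fun w _ => ?_
    exact integral_congr_ae ((hce n w).mono fun x hx => by simp only [hx])
  have e5 : ∀ i, ∑ v, ∑ q, (loweringMatrix N (v i) q : ℂ)
            * ∫ x in Ω i, star (d v x) * d (Function.update v i q) x
      = ∑ n ∈ Finset.range N, ∑ w, (Real.sqrt (n + 1) : ℂ)
            * ∫ x in Ω i, star (c n w x) * c (n + 1) (Fin.cons i w) x := by
    intro i
    set I : (ι → ℕ) → ℂ := fun v => ∫ x in Ω i, star (e v x) * e (v + Pi.single i 1) x with hI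
    -- The range is extended to `N + 1` by a zero term: annihilation pairs `n` with `n + 1`, so the
    -- truncation at `N` leaves only `n < N`.
    have hR : ∑ n ∈ Finset.range N, ∑ w, (Real.sqrt (n + 1) : ℂ)
            * ∫ x in Ω i, star (c n w x) * c (n + 1) (Fin.cons i w) x
        = ∑ n ∈ Finset.range (N + 1), ∑ w : Fin n → ι,
          (fun v : ι → ℕ => if ∑ j, v j < N then (Real.sqrt ((∑ j, v j : ℕ) + 1) : ℂ) * I v else 0)
            (occupation w) := by
      rw [Finset.sum_range_succ]
      simp only [sum_occupation, lt_irrefl, if_false, Finset.sum_const_zero, add_zero]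
      refine Finset.sum_congr rfl fun n hn => Finset.sum_congr rfl fun w _ => ?_
      rw [if_pos (Finset.mem_range.1 hn)]
      congr 1
      refine integral_congr_ae (ae_restrict_of_ae ?_)
      filter_upwards [hce n w, hce (n + 1) (Fin.cons i w)] with x h1 h2
      rw [h1, h2, occupation_cons]
    rw [hR, sum_sum_words_eq N (fun v : ι → ℕ => if ∑ j, v j < N then
      (Real.sqrt ((∑ j, v j : ℕ) + 1) : ℂ) * I v else 0)]
    refine Finset.sum_congr rfl fun v _ => ?_
    by_cases hlt : ∑ j, (v j : ℕ) < N
    · rw [if_pos hlt.le, if_pos hlt]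
      have hvi : (v i : ℕ) + 1 < N + 1 := by
        have : (v i : ℕ) ≤ ∑ j, (v j : ℕ) :=
          Finset.single_le_sum (f := fun j => (v j : ℕ)) (fun _ _ => Nat.zero_le _)
            (Finset.mem_univ i)
        omega
      have hup : (fun j => ((Function.update v i ⟨(v i : ℕ) + 1, hvi⟩ j : Fin (N + 1)) : ℕ))
          = (fun j => (v j : ℕ)) + Pi.single i 1 := by
        ext j
        by_cases hj : j = i
        · subst hj; simp
        · simp [hj]
      rw [Finset.sum_eq_single ⟨(v i : ℕ) + 1, hvi⟩]
      · have hsv : s v = r (fun j => v j) := by simp only [hs]; rw [if_pos hlt.le]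
        have hsu : s (Function.update v i ⟨(v i : ℕ) + 1, hvi⟩)
            = r ((fun j => (v j : ℕ)) + Pi.single i 1) := by
          simp only [hs, hup]
          rw [if_pos]
          simp only [Pi.add_apply, Finset.sum_add_distrib]
          simp; omega
        simp only [hd, hsv, hsu, hup]
        have hint : ∀ x, star ((r (fun j => v j) : ℂ) * e (fun j => v j) x)
            * ((r ((fun j => (v j : ℕ)) + Pi.single i 1) : ℂ)
              * e ((fun j => (v j : ℕ)) + Pi.single i 1) x)
            = ((r (fun j => v j) * r ((fun j => (v j : ℕ)) + Pi.single i 1) : ℝ) : ℂ)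
              * (star (e (fun j => v j) x) * e ((fun j => (v j : ℕ)) + Pi.single i 1) x) := by
          intro x; simp; ring
        simp_rw [hint]
        rw [integral_const_mul, ← mul_assoc, ← mul_assoc]
        congr 1
        have hm := multinomial_add_single (fun j => (v j : ℕ)) i
        -- The square root of the multinomial ratio turns `√(vᵢ + 1)` times both normalisations into
        -- the multinomial weight times `√(n + 1)`.
        have hreal : loweringMatrix N (v i) ⟨(v i : ℕ) + 1, hvi⟩
            * (r (fun j => v j) * r ((fun j => (v j : ℕ)) + Pi.single i 1))
            = (Nat.multinomial Finset.univ (fun j => (v j : ℕ)) : ℝ)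
              * Real.sqrt ((∑ j, (v j : ℕ) : ℕ) + 1) := by
          have hm' : (Nat.multinomial Finset.univ ((fun j => (v j : ℕ)) + Pi.single i 1) : ℝ)
              * ((v i : ℝ) + 1) = Nat.multinomial Finset.univ (fun j => (v j : ℕ))
                * (((∑ j, (v j : ℕ) : ℕ) : ℝ) + 1) := by exact_mod_cast hm
          simp only [loweringMatrix, if_true, hr]
          rw [mul_comm (Real.sqrt _) (Real.sqrt _ * Real.sqrt _), mul_assoc,
            ← Real.sqrt_mul (Nat.cast_nonneg _), hm', Real.sqrt_mul (Nat.cast_nonneg _),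
            ← mul_assoc, Real.mul_self_sqrt (Nat.cast_nonneg _)]
        exact_mod_cast hreal
      · intro q _ hq
        have : (q : ℕ) ≠ v i + 1 := fun h => hq (Fin.ext h)
        simp [loweringMatrix, this]
      · simp
    -- At total number at least `N`, raising one occupation number exceeds the cutoff and the
    -- amplitude `s` vanishes.
    · have hz : (if ∑ j, (v j : ℕ) ≤ N then (Nat.multinomial Finset.univ (fun j => (v j : ℕ)) : ℂ)
          * (if ∑ j, (v j : ℕ) < N then (Real.sqrt ((∑ j, (v j : ℕ) : ℕ) + 1) : ℂ)
            * I (fun j => v j) else 0) else 0) = 0 := by simp [hlt]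
      rw [hz]
      refine Finset.sum_eq_zero fun q _ => ?_
      by_cases hq : (q : ℕ) = v i + 1
      · have hsu : s (Function.update v i q) = 0 := by
          have hup : (fun j => ((Function.update v i q j : Fin (N + 1)) : ℕ))
              = (fun j => (v j : ℕ)) + Pi.single i 1 := by
            ext j
            by_cases hj : j = i
            · subst hj; simp [hq]
            · simp [hj]
          simp only [hs, hup]
          rw [if_neg]
          simp only [Pi.add_apply, Finset.sum_add_distrib]
          simp; omega
        simp [hd, hsu]
      · simp [loweringMatrix, hq]
  rw [e1, e2, e3, e4] at key
  simp only [e5] at key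
  exact key

end Words

/-! ### Cauchy–Schwarz for square integrable functions. -/

section CauchySchwarz

variable {α : Type*} [MeasurableSpace α] {μ : Measure α}

theorem integral_norm_mul_norm_le {E F : Type*} [NormedAddCommGroup E] [NormedAddCommGroup F]
    {a : α → E} {b : α → F} (ha : MemLp a 2 μ) (hb : MemLp b 2 μ) :
    ∫ x, ‖a x‖ * ‖b x‖ ∂μ ≤ Real.sqrt (∫ x, ‖a x‖ ^ 2 ∂μ) * Real.sqrt (∫ x, ‖b x‖ ^ 2 ∂μ) := by
  have h := integral_mul_le_Lp_mul_Lq_of_nonneg (μ := μ) Real.HolderConjugate.two_two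
    (f := fun x => ‖a x‖) (g := fun x => ‖b x‖)
    (ae_of_all _ fun _ => norm_nonneg _) (ae_of_all _ fun _ => norm_nonneg _)
    (by simpa using ha.norm) (by simpa using hb.norm)
  simpa only [Real.rpow_two, ← Real.sqrt_eq_rpow] using h

theorem norm_integral_mul_sq_le {a b : α → ℂ} (ha : MemLp a 2 μ) (hb : MemLp b 2 μ) :
    ‖∫ x, a x * b x ∂μ‖ ^ 2 ≤ (∫ x, ‖a x‖ ^ 2 ∂μ) * ∫ x, ‖b x‖ ^ 2 ∂μ := by
  have h1 : ‖∫ x, a x * b x ∂μ‖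
      ≤ Real.sqrt (∫ x, ‖a x‖ ^ 2 ∂μ) * Real.sqrt (∫ x, ‖b x‖ ^ 2 ∂μ) := by
    refine (norm_integral_le_integral_norm _).trans ?_
    simp_rw [norm_mul]
    exact integral_norm_mul_norm_le ha hb
  have h2 := pow_le_pow_left₀ (norm_nonneg _) h1 2
  rwa [mul_pow, Real.sq_sqrt (integral_nonneg fun _ => sq_nonneg _),
    Real.sq_sqrt (integral_nonneg fun _ => sq_nonneg _)] at h2

end CauchySchwarz

/-! ### Partial inner products in the phonon variables. -/

section Contract

variable {X Y : Type*} [MeasurableSpace X] [MeasurableSpace Y] {μ : Measure X} {ν : Measure Y}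
  [SFinite μ] [SFinite ν]

theorem memLp_two_iff_integrable_norm_sq {α E : Type*} [MeasurableSpace α] {μ : Measure α}
    [NormedAddCommGroup E] {a : α → E} (h : AEStronglyMeasurable a μ) :
    MemLp a 2 μ ↔ Integrable (fun x => ‖a x‖ ^ 2) μ := by
  rw [← memLp_norm_iff h, memLp_two_iff_integrable_sq h.norm]

theorem MeasureTheory.MemLp.ae_slice_right {E : Type*} [NormedAddCommGroup E] {f : X × Y → E}
    (hf : MemLp f 2 (μ.prod ν)) : ∀ᵐ x ∂μ, MemLp (fun y => f (x, y)) 2 ν := by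
  filter_upwards [hf.1.prodMk_left, hf.integrable_norm_sq.prod_right_ae] with x h1 h2
  exact (memLp_two_iff_integrable_norm_sq h1).2 h2

theorem MeasureTheory.MemLp.ae_slice_left {E : Type*} [NormedAddCommGroup E] {f : X × Y → E}
    (hf : MemLp f 2 (μ.prod ν)) : ∀ᵐ y ∂ν, MemLp (fun x => f (x, y)) 2 μ :=
  (hf.comp_measurePreserving Measure.measurePreserving_swap).ae_slice_right

/-- The partial inner product with `F` in the second variable. -/
noncomputable def contract (ν : Measure Y) (F : Y → ℂ) (f : X × Y → ℂ) (x : X) : ℂ :=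
  ∫ y, star (F y) * f (x, y) ∂ν

theorem MeasureTheory.MemLp.contract {F : Y → ℂ} (hF : MemLp F 2 ν) {f : X × Y → ℂ}
    (hf : MemLp f 2 (μ.prod ν)) : MemLp (contract ν F f) 2 μ := by
  have hm : AEStronglyMeasurable (_root_.contract ν F f) μ :=
    (AEStronglyMeasurable.mul (hF.1.star.comp_snd) hf.1).integral_prod_right'
  rw [memLp_two_iff_integrable_norm_sq hm]
  refine (hf.integrable_norm_sq.integral_prod_left.const_mul (∫ y, ‖F y‖ ^ 2 ∂ν)).mono'
    (hm.norm.pow 2) ?_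
  filter_upwards [hf.ae_slice_right] with x hx
  rw [Real.norm_of_nonneg (sq_nonneg _)]
  have := norm_integral_mul_sq_le hF.star hx
  simp only [Pi.star_apply, norm_star] at this
  exact this

theorem integrable_star_mul_slice {F : Y → ℂ} (hF : MemLp F 2 ν) {f : ℝ × Y → ℂ}
    (hf : MemLp f 2 (volume.prod ν)) {I : Set ℝ} (hI : volume I ≠ ⊤) :
    Integrable (fun q : ℝ × Y => star (F q.2) * f q) ((volume.restrict I).prod ν) := by
  have : IsFiniteMeasure (volume.restrict I) := ⟨by simpa using hI.lt_top⟩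
  have h1 : MemLp (fun q : ℝ × Y => F q.2) 2 ((volume.restrict I).prod ν) := by
    rw [memLp_two_iff_integrable_norm_sq hF.1.comp_snd]
    exact hF.integrable_norm_sq.comp_snd _
  have h2 : MemLp f 2 ((volume.restrict I).prod ν) := by
    refine hf.mono_measure ?_
    rw [← Measure.restrict_univ (μ := ν), Measure.prod_restrict]
    rw [Measure.restrict_univ]
    exact Measure.restrict_le_self
  exact h1.star.integrable_mul h2

/-- The shift identity is linear in the slice, so integrating it against `F` and exchanging the
integrals in `t` and `y` preserves it. -/
theorem contract_shift {F : Y → ℂ} (hF : MemLp F 2 ν) {f g : ℝ × Y → ℂ}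
    (hf : MemLp f 2 (volume.prod ν)) (hg : MemLp g 2 (volume.prod ν))
    (h : ∀ s : ℝ, ∀ᵐ p ∂(volume.prod ν), f (p.1 + s, p.2) - f p
      = ∫ t in (0:ℝ)..s, g (p.1 + t, p.2)) (s : ℝ) :
    ∀ᵐ x, contract ν F f (x + s) - contract ν F f x = ∫ t in (0:ℝ)..s, contract ν F g (x + t) := by
  have h1 := hf.ae_slice_right
  have h2 := (measurePreserving_add_right volume s).quasiMeasurePreserving.ae h1
  filter_upwards [h1, h2, Measure.ae_ae_of_ae_prod (h s)] with x hx1 hx2 hx3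
  have e1 : ∫ t in (0:ℝ)..s, contract ν F g (x + t) = ∫ t in x..(x + s), contract ν F g t := by
    rw [intervalIntegral.integral_comp_add_left (f := contract ν F g)]; simp
  rw [e1]
  simp only [contract]
  have i1 : Integrable (fun y => star (F y) * f (x + s, y)) ν := hF.star.integrable_mul hx2
  have i2 : Integrable (fun y => star (F y) * f (x, y)) ν := hF.star.integrable_mul hx1
  rw [← integral_sub i1 i2]
  have e2 : ∫ y, (star (F y) * f (x + s, y) - star (F y) * f (x, y)) ∂ν
      = ∫ y, (if x ≤ x + s then (1:ℝ) else -1) •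
        (∫ t in Set.uIoc x (x + s), star (F y) * g (t, y)) ∂ν := by
    refine integral_congr_ae ?_
    filter_upwards [hx3] with y hy
    rw [← mul_sub, hy, ← intervalIntegral.intervalIntegral_eq_integral_uIoc,
      intervalIntegral.integral_const_mul,
      intervalIntegral.integral_comp_add_left (f := fun t => g (t, y))]
    simp
  rw [intervalIntegral.intervalIntegral_eq_integral_uIoc, integral_integral_swap
    (f := fun t y => star (F y) * g (t, y)), ← integral_smul]
  · exact e2
  · exact integrable_star_mul_slice hF hg (by simp [Set.uIoc])

theorem isPrimitive_contract {F : Y → ℂ} (hF : MemLp F 2 ν) {f g : ℝ × Y → ℂ}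
    (hf : MemLp f 2 (volume.prod ν)) (hg : MemLp g 2 (volume.prod ν))
    (h : ∀ s : ℝ, ∀ᵐ p ∂(volume.prod ν), f (p.1 + s, p.2) - f p
      = ∫ t in (0:ℝ)..s, g (p.1 + t, p.2)) :
    IsPrimitive (contract ν F f) (contract ν F g) :=
  isPrimitive_of_shift (hF.contract hf).1 ((hF.contract hg).locallyIntegrable (by norm_num))
    (contract_shift hF hf hg h)

end Contract

/-! ### Parseval systems and their products over several phonons. -/

section Parseval

/-- A sequence of square integrable functions on the line that satisfies Parseval's identity. -/
structure IsParsevalSystem (f : ℕ → ℝ → ℂ) : Prop where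
  memLp : ∀ i, MemLp (f i) 2 volume
  hasSum : ∀ g : ℝ → ℂ, MemLp g 2 volume →
    HasSum (fun i => ‖∫ k, star (f i k) * g k‖ ^ 2) (∫ k, ‖g k‖ ^ 2)

/-- Distinct members have distance `√2`, so balls of radius `1/2` around them are disjoint open
sets. -/
theorem Orthonormal.countable_of_separable {E : Type*} [NormedAddCommGroup E]
    [InnerProductSpace ℂ E] [TopologicalSpace.SeparableSpace E] {s : Set E}
    (hs : Orthonormal ℂ ((↑) : s → E)) : s.Countable := by
  refine Set.PairwiseDisjoint.countable_of_isOpen (s := fun x : E => Metric.ball x (1 / 2))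
    (fun x hx y hy hxy => ?_) (fun x _ => Metric.isOpen_ball)
    fun x _ => ⟨x, Metric.mem_ball_self (by norm_num)⟩
  refine Metric.ball_disjoint_ball ?_
  have h1 : inner ℂ x y = 0 := hs.2 (i := ⟨x, hx⟩) (j := ⟨y, hy⟩) (by simpa using hxy)
  have h2 : ‖x - y‖ ^ 2 = 2 := by
    rw [@norm_sub_sq ℂ, h1, hs.1 ⟨x, hx⟩, hs.1 ⟨y, hy⟩]; norm_num
  rw [dist_eq_norm]
  nlinarith [norm_nonneg (x - y)]

/-- Complete the given functions to a Hilbert basis of `L²`, countable by separability, and number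
it by `ℕ`. Only Parseval's identity is kept, so the system need not be orthonormal. -/
theorem exists_parsevalSystem_extension {M : ℕ} (g : Fin M → ℝ → ℂ)
    (hg : ∀ i, MemLp (g i) 2 volume)
    (hog : ∀ i j, ∫ k, star (g i k) * g j k = if i = j then 1 else 0) :
    ∃ (f : ℕ → ℝ → ℂ) (a : Fin M → ℕ), IsParsevalSystem f ∧ Function.Injective a ∧
      ∀ j, f (a j) =ᵐ[volume] g j := by
  set G : Fin M → Lp ℂ 2 (volume : Measure ℝ) := fun i => (hg i).toLp (g i) with hG
  have hinner : ∀ u v : ℝ → ℂ, ∀ (hu : MemLp u 2 volume) (hv : MemLp v 2 volume),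
      inner ℂ (hu.toLp u) (hv.toLp v) = ∫ k, star (u k) * v k := by
    intro u v hu hv
    rw [L2.inner_def]
    refine integral_congr_ae ?_
    filter_upwards [hu.coeFn_toLp, hv.coeFn_toLp] with k h1 h2
    rw [h1, h2]
    simp [mul_comm]
  have hGo : Orthonormal ℂ G := by
    rw [orthonormal_iff_ite]
    intro i j
    rw [hinner, hog]
  obtain ⟨w, b, hw, hb⟩ := (hGo.toSubtypeRange).exists_hilbertBasis_extension
  have hwo : Orthonormal ℂ ((↑) : w → Lp ℂ 2 (volume : Measure ℝ)) := hb ▸ b.orthonormal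
  have : Fact ((2 : ENNReal) ≠ ⊤) := ⟨by norm_num⟩
  have : SecondCountableTopology (Lp ℂ 2 (volume : Measure ℝ)) := Lp.SecondCountableTopology
  have hwc : w.Countable := hwo.countable_of_separable
  have : Countable w := hwc.to_subtype
  obtain ⟨e, he⟩ := exists_injective_nat w
  -- Numbers not used by the enumeration receive the zero function, which does not affect Parseval's
  -- identity.
  set c : ℕ → Lp ℂ 2 (volume : Measure ℝ) := Function.extend e (fun x => (x : Lp ℂ 2 volume)) 0
    with hc
  refine ⟨fun i => c i, fun j => e ⟨G j, hw ⟨j, rfl⟩⟩, ⟨fun i => Lp.memLp _, ?_⟩, ?_, ?_⟩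
  · intro u hu
    have h1 := b.hasSum_inner_mul_inner (hu.toLp u) (hu.toLp u)
    have h2 : HasSum (fun i : w => ‖inner ℂ ((i : Lp ℂ 2 volume)) (hu.toLp u)‖ ^ 2)
        (∫ k, ‖u k‖ ^ 2) := by
      have h3 := (Complex.hasSum_re h1)
      rw [hinner] at h3
      convert h3 using 1
      · ext i
        rw [hb, ← inner_conj_symm (hu.toLp u) (i : Lp ℂ 2 volume), Complex.conj_mul',
          ← Complex.ofReal_pow, Complex.ofReal_re]
      · have i1 : Integrable fun k => star (u k) * u k := hu.star.integrable_mul hu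
        have e7 := integral_re (𝕜 := ℂ) i1
        simp only [RCLike.re_eq_complex_re] at e7
        rw [← e7]
        refine integral_congr_ae (ae_of_all _ fun k => ?_)
        simp only [RCLike.star_def]
        rw [Complex.conj_mul', ← Complex.ofReal_pow, Complex.ofReal_re]
    have h4 : ∀ i, ∫ k, star ((c i : ℝ → ℂ) k) * u k = inner ℂ (c i) (hu.toLp u) := by
      intro i
      rw [← hinner _ _ (Lp.memLp (c i)) hu, Lp.toLp_coeFn]
    simp only [h4]
    rw [← he.hasSum_iff]
    · convert h2 using 2 with i
      simp [hc, he.extend_apply]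
    · intro i hi
      have : c i = 0 := by
        rw [hc, Function.extend_apply' _ _ _ (by simpa using hi)]; rfl
      simp [this]
  · intro i j hij
    have h1 := he hij
    have h2 : G i = G j := congrArg Subtype.val h1
    exact hGo.linearIndependent.injective h2
  · intro j
    simp only [hc, he.extend_apply]
    exact (hg j).coeFn_toLp

/-- The product of the modes of a word. -/
noncomputable def wordFunction (f : ℕ → ℝ → ℂ) {n : ℕ} (w : Fin n → ℕ) (k : Fin n → ℝ) : ℂ :=
  ∏ j, f (w j) (k j)

theorem MeasureTheory.MemLp.wordFunction {f : ℕ → ℝ → ℂ} (hf : ∀ i, MemLp (f i) 2 volume) {n : ℕ}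
    (w : Fin n → ℕ) : MemLp (wordFunction f w) 2 volume := by
  have hm : AEStronglyMeasurable (_root_.wordFunction f w) volume := by
    have : _root_.wordFunction f w = ∏ j, fun k : Fin n → ℝ => f (w j) (k j) := by
      ext k; simp [_root_.wordFunction]
    rw [this]
    refine Finset.aestronglyMeasurable_prod _ fun j _ => ?_
    exact (hf (w j)).1.comp_quasiMeasurePreserving (Measure.quasiMeasurePreserving_eval _ j)
  rw [memLp_two_iff_integrable_norm_sq hm]
  have h := Integrable.fintype_prod (μ := fun _ : Fin n => (volume : Measure ℝ))
    (f := fun j k => ‖f (w j) k‖ ^ 2) fun j => (hf (w j)).integrable_norm_sq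
  refine h.congr (ae_of_all _ fun k => ?_)
  simp [_root_.wordFunction, norm_prod, Finset.prod_pow]

theorem cons_eq_piFinSuccAbove_symm (n : ℕ) :
    (fun q : ℝ × (Fin n → ℝ) => (Fin.cons q.1 q.2 : Fin (n + 1) → ℝ))
      = (MeasurableEquiv.piFinSuccAbove (fun _ : Fin (n + 1) => ℝ) 0).symm := by
  ext q j
  simp [MeasurableEquiv.piFinSuccAbove_symm_apply, Fin.insertNthEquiv]

theorem measurePreserving_cons (n : ℕ) :
    MeasurePreserving (fun q : ℝ × (Fin n → ℝ) => (Fin.cons q.1 q.2 : Fin (n + 1) → ℝ))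
      volume volume := by
  have h := (volume_preserving_piFinSuccAbove (fun _ : Fin (n + 1) => ℝ) 0).symm
  rwa [cons_eq_piFinSuccAbove_symm]

theorem measurableEmbedding_cons (n : ℕ) :
    MeasurableEmbedding (fun q : ℝ × (Fin n → ℝ) => (Fin.cons q.1 q.2 : Fin (n + 1) → ℝ)) := by
  have h := (MeasurableEquiv.piFinSuccAbove (fun _ : Fin (n + 1) => ℝ) 0).symm.measurableEmbedding
  rwa [cons_eq_piFinSuccAbove_symm]

theorem integral_wordFunction_cons {f : ℕ → ℝ → ℂ} (hf : ∀ i, MemLp (f i) 2 volume) {n : ℕ}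
    (i : ℕ) (w : Fin n → ℕ) {u : (Fin (n + 1) → ℝ) → ℂ} (hu : MemLp u 2 volume) :
    ∫ k, star (wordFunction f (Fin.cons i w : Fin (n + 1) → ℕ) k) * u k
      = ∫ k', star (wordFunction f w k') * ∫ k₀, star (f i k₀) * u (Fin.cons k₀ k') := by
  rw [← (measurePreserving_cons n).integral_comp (measurableEmbedding_cons n)]
  have hi : Integrable (fun q : ℝ × (Fin n → ℝ) =>
      star (wordFunction f (Fin.cons i w : Fin (n + 1) → ℕ) (Fin.cons q.1 q.2)) * u (Fin.cons q.1 q.2))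
      (volume.prod volume) :=
    (measurePreserving_cons n).integrable_comp_of_integrable
      ((MemLp.wordFunction hf (Fin.cons i w : Fin (n + 1) → ℕ)).star.integrable_mul hu)
  rw [Measure.volume_eq_prod, integral_prod_symm _ hi]
  refine integral_congr_ae (ae_of_all _ fun k' => ?_)
  simp only
  rw [← integral_const_mul]
  refine integral_congr_ae (ae_of_all _ fun k₀ => ?_)
  simp only [wordFunction, Fin.prod_univ_succ, Fin.cons_zero, Fin.cons_succ, star_mul']
  ring

theorem IsParsevalSystem.tsum_enorm_sq {f : ℕ → ℝ → ℂ} (hf : IsParsevalSystem f) {g : ℝ → ℂ}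
    (hg : MemLp g 2 volume) :
    ∑' i, ‖∫ k, star (f i k) * g k‖ₑ ^ 2 = ∫⁻ k, ‖g k‖ₑ ^ 2 := by
  have h := hf.hasSum g hg
  have e : ∀ z : ℂ, ‖z‖ₑ ^ 2 = ENNReal.ofReal (‖z‖ ^ 2) := fun z => by
    rw [← ofReal_norm, ENNReal.ofReal_pow (norm_nonneg _)]
  simp_rw [e]
  rw [← ENNReal.ofReal_tsum_of_nonneg (fun _ => sq_nonneg _) h.summable, h.tsum_eq,
    ofReal_integral_eq_lintegral_ofReal hg.integrable_norm_sq (ae_of_all _ fun _ => sq_nonneg _)]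

/-- Induction on the number of phonons: Parseval in the first momentum, then the induction
hypothesis for the contracted functions. Extended nonnegative values let sums and integrals be
exchanged without integrability conditions. -/
theorem IsParsevalSystem.tsum_word_enorm_sq {f : ℕ → ℝ → ℂ} (hf : IsParsevalSystem f) (n : ℕ)
    {u : (Fin n → ℝ) → ℂ} (hu : MemLp u 2 volume) :
    ∑' w : Fin n → ℕ, ‖∫ k, star (wordFunction f w k) * u k‖ₑ ^ 2 = ∫⁻ k, ‖u k‖ₑ ^ 2 := by
  induction n with
  | zero =>
    rw [tsum_eq_single default (fun w hw => absurd (Subsingleton.elim w default) hw)]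
    have hv : (volume : Measure (Fin 0 → ℝ)) = Measure.dirac default := by
      rw [volume_pi, Measure.pi_of_empty (x := default)]
    simp [wordFunction, hv]
  | succ n ih =>
    have hmp := measurePreserving_cons n
    have hu' : MemLp (fun q : ℝ × (Fin n → ℝ) => u (Fin.cons q.1 q.2)) 2 (volume.prod volume) :=
      hu.comp_measurePreserving hmp
    have hu2 : MemLp (fun q : (Fin n → ℝ) × ℝ => u (Fin.cons q.2 q.1)) 2 (volume.prod volume) :=
      hu'.comp_measurePreserving Measure.measurePreserving_swap
    have hB : ∀ i, MemLp (fun k' : Fin n → ℝ => ∫ k₀, star (f i k₀) * u (Fin.cons k₀ k')) 2 volume :=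
      fun i => (hf.memLp i).contract hu2
    rw [← (Fin.consEquiv fun _ : Fin (n + 1) => ℕ).tsum_eq, ENNReal.tsum_prod']
    have h1 : ∀ i (w : Fin n → ℕ),
        ‖∫ k, star (wordFunction f ((Fin.consEquiv fun _ : Fin (n + 1) => ℕ) (i, w)) k) * u k‖ₑ ^ 2
          = ‖∫ k', star (wordFunction f w k') * ∫ k₀, star (f i k₀) * u (Fin.cons k₀ k')‖ₑ ^ 2 := by
      intro i w
      rw [← integral_wordFunction_cons hf.memLp i w hu]
      rfl
    simp_rw [h1, ih (hB _)]
    rw [← lintegral_tsum fun i => (hB i).1.enorm.pow_const 2]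
    have h2 : ∫⁻ k' : Fin n → ℝ, ∑' i, ‖∫ k₀, star (f i k₀) * u (Fin.cons k₀ k')‖ₑ ^ 2
        = ∫⁻ k' : Fin n → ℝ, ∫⁻ k₀, ‖u (Fin.cons k₀ k')‖ₑ ^ 2 := by
      refine lintegral_congr_ae ?_
      filter_upwards [hu2.ae_slice_right] with k' hk'
      exact hf.tsum_enorm_sq hk'
    rw [h2, ← hmp.lintegral_comp_emb (measurableEmbedding_cons n) (fun k => ‖u k‖ₑ ^ 2),
      Measure.volume_eq_prod, lintegral_prod_symm _ (hu'.1.enorm.pow_const 2)]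

/-- Parseval's identity for the coefficients of a function of the electron position and `n` phonon
momenta, with a weight in the electron position. -/
theorem IsParsevalSystem.hasSum_weight {f : ℕ → ℝ → ℂ} (hf : IsParsevalSystem f) (n : ℕ)
    {u : PolaronConfig n → ℂ} (hu : MemLp u 2 volume) {G : ℝ → ℝ} (hG : Measurable G)
    (hG0 : ∀ x, 0 ≤ G x) {b : ℝ} (hGb : ∀ x, G x ≤ b) :
    HasSum (fun w : Fin n → ℕ => ∫ x, G x * ‖contract volume (wordFunction f w) u x‖ ^ 2)
      (∫ p : PolaronConfig n, G p.1 * ‖u p‖ ^ 2) := by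
  have hu' : MemLp u 2 (volume.prod volume) := hu
  have hc : ∀ w : Fin n → ℕ, MemLp (contract volume (wordFunction f w) u) 2 volume := fun w =>
    (MemLp.wordFunction hf.memLp w).contract hu'
  have e : ∀ z : ℂ, ENNReal.ofReal (‖z‖ ^ 2) = ‖z‖ₑ ^ 2 := fun z => by
    rw [← ofReal_norm, ENNReal.ofReal_pow (norm_nonneg _)]
  have i1 : ∀ w : Fin n → ℕ,
      Integrable fun x => G x * ‖contract volume (wordFunction f w) u x‖ ^ 2 := fun w =>
    integrable_potential_mul hG.aestronglyMeasurable hG0 hGb (hc w).integrable_norm_sq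
  have i2 : Integrable fun p : PolaronConfig n => G p.1 * ‖u p‖ ^ 2 :=
    hu.integrable_norm_sq.bdd_mul (c := b) (hG.comp measurable_fst).aestronglyMeasurable
      (ae_of_all _ fun p => by rw [Real.norm_of_nonneg (hG0 _)]; exact hGb _)
  have key : ∑' w : Fin n → ℕ, ENNReal.ofReal
        (∫ x, G x * ‖contract volume (wordFunction f w) u x‖ ^ 2)
      = ENNReal.ofReal (∫ p : PolaronConfig n, G p.1 * ‖u p‖ ^ 2) := by
    rw [ofReal_integral_eq_lintegral_ofReal i2
      (ae_of_all _ fun p => mul_nonneg (hG0 _) (sq_nonneg _))]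
    have h1 : ∀ w : Fin n → ℕ, ENNReal.ofReal
        (∫ x, G x * ‖contract volume (wordFunction f w) u x‖ ^ 2)
        = ∫⁻ x, ENNReal.ofReal (G x) * ‖contract volume (wordFunction f w) u x‖ₑ ^ 2 := by
      intro w
      rw [ofReal_integral_eq_lintegral_ofReal (i1 w)
        (ae_of_all _ fun p => mul_nonneg (hG0 _) (sq_nonneg _))]
      simp_rw [ENNReal.ofReal_mul (hG0 _), e]
    simp_rw [h1]
    rw [← lintegral_tsum (f := fun (w : Fin n → ℕ) x =>
      ENNReal.ofReal (G x) * ‖contract volume (wordFunction f w) u x‖ₑ ^ 2)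
      fun w => hG.ennreal_ofReal.aemeasurable.mul ((hc w).1.enorm.pow_const 2)]
    simp_rw [ENNReal.tsum_mul_left, ENNReal.ofReal_mul (hG0 _), e]
    rw [Measure.volume_eq_prod, lintegral_prod (fun p : ℝ × (Fin n → ℝ) =>
      ENNReal.ofReal (G p.1) * ‖u p‖ₑ ^ 2) ((hG.comp measurable_fst).ennreal_ofReal.aemeasurable.mul
      (hu'.1.enorm.pow_const 2))]
    refine lintegral_congr_ae ?_
    filter_upwards [hu'.ae_slice_right, hu'.1.prodMk_left] with x hx hx2
    rw [lintegral_const_mul'' _ (hx2.enorm.pow_const 2)]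
    congr 1
    exact hf.tsum_word_enorm_sq n hx
  have hnn : ∀ w : Fin n → ℕ, 0 ≤ ∫ x, G x * ‖contract volume (wordFunction f w) u x‖ ^ 2 :=
    fun w => integral_nonneg fun x => mul_nonneg (hG0 _) (sq_nonneg _)
  have hs : Summable fun w : Fin n → ℕ => ∫ x, G x * ‖contract volume (wordFunction f w) u x‖ ^ 2 := by
    have := ENNReal.summable_toReal (key.trans_ne ENNReal.ofReal_ne_top)
    simpa only [ENNReal.toReal_ofReal (hnn _)] using this
  rw [← ENNReal.ofReal_tsum_of_nonneg hnn hs] at key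
  have h3 := (ENNReal.ofReal_eq_ofReal_iff (tsum_nonneg hnn)
    (integral_nonneg fun p => mul_nonneg (hG0 _) (sq_nonneg _))).1 key
  exact h3 ▸ hs.hasSum

end Parseval

/-! ### From the Fock space components to the bound for finitely many cell modes. -/

/-- Boxes of words in the letters below `m` are cofinal among the finite sets of words. -/
theorem HasSum.tendsto_sum_words {n : ℕ} {g : (Fin n → ℕ) → ℝ} {s : ℝ} (h : HasSum g s) :
    Tendsto (fun m => ∑ w : Fin n → Fin m, g (fun i => w i)) atTop (𝓝 s) := by
  have h1 : Tendsto (fun m => Fintype.piFinset fun _ : Fin n => Finset.range m) atTop atTop := by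
    refine tendsto_atTop_finset_of_monotone (fun m m' hm => ?_) fun w => ?_
    · exact Fintype.piFinset_subset _ _ fun _ => Finset.range_mono hm
    · refine ⟨(Finset.univ.sup w) + 1, ?_⟩
      simp only [Fintype.mem_piFinset, Finset.mem_range]
      exact fun i => Nat.lt_succ_of_le (Finset.le_sup (Finset.mem_univ i))
  refine (h.comp h1).congr fun m => ?_
  simp only [Function.comp]
  symm
  refine Finset.sum_bij (fun w _ i => (w i : ℕ)) ?_ ?_ ?_ ?_
  · intro w _; simp
  · intro w _ w' _ hw
    ext i; exact congrFun hw i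
  · intro w hw
    simp only [Fintype.mem_piFinset, Finset.mem_range] at hw
    exact ⟨fun i => ⟨w i, hw i⟩, Finset.mem_univ _, rfl⟩
  · intro w _; rfl

/-- Adding a phonon to a configuration. -/
def configCons {n : ℕ} (q : PolaronConfig n × ℝ) : PolaronConfig (n + 1) :=
  (q.1.1, Fin.cons q.2 q.1.2)

theorem measurePreserving_configCons (n : ℕ) :
    MeasurePreserving (configCons (n := n)) volume volume := by
  have h1 : MeasurePreserving (fun q : (Fin n → ℝ) × ℝ => (Fin.cons q.2 q.1 : Fin (n + 1) → ℝ))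
      (volume.prod volume) volume :=
    (measurePreserving_cons n).comp Measure.measurePreserving_swap
  have h2 := (MeasurePreserving.id (volume : Measure ℝ)).prod h1
  exact h2.comp (measurePreserving_prodAssoc (volume : Measure ℝ) (volume : Measure (Fin n → ℝ))
    (volume : Measure ℝ))

theorem MeasureTheory.MemLp.comp_configCons {n : ℕ} {u : PolaronConfig (n + 1) → ℂ}
    (hu : MemLp u 2 volume) :
    MemLp (fun q : PolaronConfig n × ℝ => u (q.1.1, Fin.cons q.2 q.1.2)) 2 (volume.prod volume) :=
  hu.comp_measurePreserving (measurePreserving_configCons n)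

/-- The annihilation of a phonon in the mode `F`, without the combinatorial factor. -/
noncomputable def annihilate {n : ℕ} (F : ℝ → ℂ) (u : PolaronConfig (n + 1) → ℂ) :
    PolaronConfig n → ℂ :=
  contract volume F fun q : PolaronConfig n × ℝ => u (q.1.1, Fin.cons q.2 q.1.2)

theorem MeasureTheory.MemLp.annihilate {n : ℕ} {F : ℝ → ℂ} (hF : MemLp F 2 volume)
    {u : PolaronConfig (n + 1) → ℂ} (hu : MemLp u 2 volume) :
    MemLp (annihilate F u) 2 volume :=
  hF.contract hu.comp_configCons

section

variable {f : ℕ → ℝ → ℂ}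

theorem contract_wordFunction_cons (hf : ∀ i, MemLp (f i) 2 volume) {n : ℕ} (i : ℕ)
    (w : Fin n → ℕ) {u : PolaronConfig (n + 1) → ℂ} (hu : MemLp u 2 volume) :
    contract volume (wordFunction f (Fin.cons i w : Fin (n + 1) → ℕ)) u
      =ᵐ[volume] contract volume (wordFunction f w) (annihilate (f i) u) := by
  have hu' : MemLp u 2 (volume.prod volume) := hu
  filter_upwards [hu'.ae_slice_right] with x hx
  exact integral_wordFunction_cons hf i w hx

theorem contract_wordFunction_perm {n : ℕ} (w : Fin n → ℕ) (σ : Equiv.Perm (Fin n))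
    {u : PolaronConfig n → ℂ}
    (hs : ∀ᵐ p : PolaronConfig n, u (p.1, p.2 ∘ σ) = u p) :
    contract volume (wordFunction f (w ∘ σ)) u =ᵐ[volume] contract volume (wordFunction f w) u := by
  have hs' : ∀ᵐ p ∂((volume : Measure ℝ).prod (volume : Measure (Fin n → ℝ))),
    u (p.1, p.2 ∘ σ) = u p := hs
  filter_upwards [Measure.ae_ae_of_ae_prod hs'] with x hx
  have hmp := volume_measurePreserving_piCongrLeft (fun _ : Fin n => ℝ) σ.symm
  have hfun : ∀ k : Fin n → ℝ, MeasurableEquiv.piCongrLeft (fun _ : Fin n => ℝ) σ.symm k = k ∘ σ := by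
    intro k
    ext j
    have := MeasurableEquiv.piCongrLeft_apply_apply (β := fun _ : Fin n => ℝ) σ.symm k (σ j)
    simpa using this
  simp only [contract]
  rw [← hmp.integral_comp (MeasurableEquiv.measurableEmbedding _)]
  refine integral_congr_ae ?_
  filter_upwards [hx] with k hk
  rw [hfun, hk]
  congr 2
  simp only [wordFunction, Function.comp]
  exact Equiv.prod_comp σ fun j => f (w j) (k j)

theorem contract_add {X Y : Type*} [MeasurableSpace X] [MeasurableSpace Y] {μ : Measure X}
    {ν : Measure Y} [SFinite μ] [SFinite ν] {F : Y → ℂ} (hF : MemLp F 2 ν) {u v : X × Y → ℂ}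
    (hu : MemLp u 2 (μ.prod ν)) (hv : MemLp v 2 (μ.prod ν)) :
    contract ν F (u + v) =ᵐ[μ] fun x => contract ν F u x + contract ν F v x := by
  filter_upwards [hu.ae_slice_right, hv.ae_slice_right] with x h1 h2
  simp only [contract, Pi.add_apply, mul_add]
  have i1 : Integrable (fun y => star (F y) * u (x, y)) ν := hF.star.integrable_mul h1
  have i2 : Integrable (fun y => star (F y) * v (x, y)) ν := hF.star.integrable_mul h2
  exact integral_add i1 i2

theorem Complex.re_star_mul (a b : ℂ) :
    (star a * b).re = (‖a + b‖ ^ 2 - ‖a‖ ^ 2 - ‖b‖ ^ 2) / 2 := by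
  rw [Complex.norm_sq_eq_re_sq_add_im_sq, Complex.norm_sq_eq_re_sq_add_im_sq,
    Complex.norm_sq_eq_re_sq_add_im_sq]
  simp
  ring

/-- Polarisation, `2 Re(āb) = |a+b|² - |a|² - |b|²`, reduces this to weighted Parseval with the
indicator of `Ω` as weight. -/
theorem IsParsevalSystem.hasSum_weight_re (hf : IsParsevalSystem f) (n : ℕ)
    {u v : PolaronConfig n → ℂ} (hu : MemLp u 2 volume) (hv : MemLp v 2 volume) {Ω : Set ℝ}
    (hΩ : MeasurableSet Ω) :
    HasSum (fun w : Fin n → ℕ => (∫ x in Ω, star (contract volume (wordFunction f w) u x) *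
        contract volume (wordFunction f w) v x).re)
      (∫ p : PolaronConfig n, Ω.indicator (fun _ => (1 : ℂ)) p.1 * (star (u p) * v p)).re := by
  set G : ℝ → ℝ := Ω.indicator fun _ => 1 with hG
  have hGm : Measurable G := measurable_const.indicator hΩ
  have hG0 : ∀ x, 0 ≤ G x := fun x => Set.indicator_nonneg (fun _ _ => zero_le_one) x
  have hG1 : ∀ x, G x ≤ 1 := fun x => Set.indicator_le_self' (fun _ _ => zero_le_one) x
  have hc : ∀ {u : PolaronConfig n → ℂ} (_ : MemLp u 2 volume) (w : Fin n → ℕ),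
      MemLp (contract volume (wordFunction f w) u) 2 volume := fun h w =>
    (MemLp.wordFunction hf.memLp w).contract h
  have key : ∀ {X : Type} [MeasurableSpace X] {μ : Measure X} {a b c : X → ℂ} {g : X → ℝ}
      (_ : AEStronglyMeasurable g μ) (_ : ∀ x, 0 ≤ g x) (_ : ∀ x, g x ≤ 1)
      (_ : MemLp a 2 μ) (_ : MemLp b 2 μ) (_ : c =ᵐ[μ] fun x => a x + b x),
      (∫ x, (g x : ℂ) * (star (a x) * b x) ∂μ).re
        = (∫ x, g x * ‖c x‖ ^ 2 ∂μ - ∫ x, g x * ‖a x‖ ^ 2 ∂μ - ∫ x, g x * ‖b x‖ ^ 2 ∂μ) / 2 := by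
    intro X _ μ a b c g hgm hg0 hg1 ha hb hab
    have bd : ∀ᵐ x ∂μ, ‖g x‖ ≤ 1 := ae_of_all _ fun x => by
      rw [Real.norm_of_nonneg (hg0 x)]; exact hg1 x
    have ia : Integrable (fun x => g x * ‖a x‖ ^ 2) μ := ha.integrable_norm_sq.bdd_mul (c := 1) hgm bd
    have ib : Integrable (fun x => g x * ‖b x‖ ^ 2) μ := hb.integrable_norm_sq.bdd_mul (c := 1) hgm bd
    have iab : Integrable (fun x => g x * ‖a x + b x‖ ^ 2) μ :=
      (ha.add hb).integrable_norm_sq.bdd_mul (c := 1) hgm bd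
    have i0 : Integrable (fun x => star (a x) * b x) μ := ha.star.integrable_mul hb
    have i1 : Integrable (fun x => (g x : ℂ) * (star (a x) * b x)) μ :=
      i0.bdd_mul (c := 1) (Complex.continuous_ofReal.comp_aestronglyMeasurable hgm)
        (by simpa using bd)
    have e7 := integral_re (𝕜 := ℂ) i1
    simp only [RCLike.re_eq_complex_re] at e7
    have e8 : ∫ x, g x * ‖c x‖ ^ 2 ∂μ = ∫ x, g x * ‖a x + b x‖ ^ 2 ∂μ :=
      integral_congr_ae (hab.mono fun x hx => by simp only [hx])
    have i2 : Integrable (fun x => g x * ‖a x + b x‖ ^ 2 - g x * ‖a x‖ ^ 2) μ := iab.sub ia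
    rw [← e7, e8, ← integral_sub iab ia, ← integral_sub i2 ib, ← integral_div]
    refine integral_congr_ae (ae_of_all _ fun x => ?_)
    simp only [Complex.re_ofReal_mul]
    rw [Complex.re_star_mul]
    ring
  have h1 := ((hf.hasSum_weight n (hu.add hv) hGm hG0 hG1).sub
    (hf.hasSum_weight n hu hGm hG0 hG1)).sub (hf.hasSum_weight n hv hGm hG0 hG1)
  have h2 := h1.div_const 2
  have hind : ∀ x, Ω.indicator (fun _ => (1 : ℂ)) x = (G x : ℂ) := by
    intro x
    by_cases hx : x ∈ Ω <;> simp [hG, hx]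
  have e1 : ∀ w : Fin n → ℕ, (∫ x in Ω, star (contract volume (wordFunction f w) u x) *
        contract volume (wordFunction f w) v x).re
      = ((∫ x, G x * ‖contract volume (wordFunction f w) (u + v) x‖ ^ 2)
        - (∫ x, G x * ‖contract volume (wordFunction f w) u x‖ ^ 2)
        - ∫ x, G x * ‖contract volume (wordFunction f w) v x‖ ^ 2) / 2 := by
    intro w
    rw [← key hGm.aestronglyMeasurable hG0 hG1 (hc hu w) (hc hv w)
      (contract_add (MemLp.wordFunction hf.memLp w) hu hv), ← integral_indicator hΩ]
    congr 2
    ext x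
    rw [← hind]
    by_cases hx : x ∈ Ω <;> simp [hx]
  have e2 : (∫ p : PolaronConfig n, Ω.indicator (fun _ => (1 : ℂ)) p.1 * (star (u p) * v p)).re
      = ((∫ p : PolaronConfig n, G p.1 * ‖(u + v) p‖ ^ 2)
        - (∫ p : PolaronConfig n, G p.1 * ‖u p‖ ^ 2) - ∫ p : PolaronConfig n, G p.1 * ‖v p‖ ^ 2) / 2 := by
    simp_rw [hind]
    exact key (hGm.comp measurable_fst).aestronglyMeasurable (fun p => hG0 p.1) (fun p => hG1 p.1)
      hu hv (ae_of_all _ fun x => rfl)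
  simp_rw [e1]
  rw [e2]
  exact h2

/-- The Pekar lower bound for a coupling to finitely many orthonormal phonon modes that are
attached to disjoint cells of the electron position. -/
theorem mode_lower_bound {V : ℝ → ℝ} {B : ℝ} (hVm : Continuous V)
    (hV0 : ∀ x, 0 ≤ V x) (hVB : ∀ x, V x ≤ B) {k : ℝ} (hk : 1 / 2 ≤ k) (hk1 : k ≤ 1) {a : ℝ}
    (ha : 0 < a) {ψ dψ : (n : ℕ) → PolaronConfig n → ℂ}
    (hψ : ∀ n, MemLp (ψ n) 2 volume) (hdψ : ∀ n, MemLp (dψ n) 2 volume)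
    (hsym : ∀ (n : ℕ) (σ : Equiv.Perm (Fin n)), ∀ᵐ p : PolaronConfig n, ψ n (p.1, p.2 ∘ σ) = ψ n p)
    (h : ∀ n, ∀ s : ℝ, ∀ᵐ p : PolaronConfig n, ψ n (p.1 + s, p.2) - ψ n p
      = ∫ t in (0:ℝ)..s, dψ n (p.1 + t, p.2)) (N : ℕ) {M : ℕ} (g : Fin M → ℝ → ℂ)
    (hg : ∀ i, MemLp (g i) 2 volume)
    (hog : ∀ i j, ∫ k, star (g i k) * g j k = if i = j then 1 else 0)
    (Ω : Fin M → Set ℝ) (hΩ : ∀ i, MeasurableSet (Ω i)) (hdis : Pairwise (Function.onFun Disjoint Ω))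
    {l : ℝ} (hl : 0 < l) (hΩl : ∀ i, volume (Ω i) ≤ ENNReal.ofReal l) :
    (a ^ 2 * (pekarEnergy V - pekarStability V B * (1 - k)) - k / 2 * M)
        * (∑ n ∈ Finset.range (N + 1), ∫ p, ‖ψ n p‖ ^ 2)
      ≤ k * (∑ n ∈ Finset.range (N + 1), ∫ p, ‖dψ n p‖ ^ 2)
        + k * (∑ n ∈ Finset.range (N + 1), (n : ℝ) * ∫ p, ‖ψ n p‖ ^ 2)
        - a ^ 2 * (∑ n ∈ Finset.range (N + 1), ∫ p, V (a * p.1) * ‖ψ n p‖ ^ 2)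
        - Real.sqrt (a / l) * (2 * ∑ j, ∑ n ∈ Finset.range N, Real.sqrt (n + 1) *
          (∫ p : PolaronConfig n, (Ω j).indicator (fun _ => (1 : ℂ)) p.1 *
            (star (ψ n p) * annihilate (g j) (ψ (n + 1)) p)).re) := by
  obtain ⟨f, b, hf, hb, hfb⟩ := exists_parsevalSystem_extension g hg hog
  set c : (n : ℕ) → (Fin n → ℕ) → ℝ → ℂ := fun n w => contract volume (wordFunction f w) (ψ n)
    with hcdef
  set dc : (n : ℕ) → (Fin n → ℕ) → ℝ → ℂ := fun n w => contract volume (wordFunction f w) (dψ n)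
    with hdcdef
  have hc : ∀ n w, MemLp (c n w) 2 volume := fun n w =>
    (MemLp.wordFunction hf.memLp w).contract (hψ n)
  have hdc : ∀ n w, MemLp (dc n w) 2 volume := fun n w =>
    (MemLp.wordFunction hf.memLp w).contract (hdψ n)
  have hprim : ∀ n w, IsPrimitive (c n w) (dc n w) := fun n w =>
    isPrimitive_contract (MemLp.wordFunction hf.memLp w) (hψ n) (hdψ n) (h n)
  have hcsym : ∀ n w (σ : Equiv.Perm (Fin n)), c n (w ∘ σ) =ᵐ[volume] c n w := fun n w σ =>
    contract_wordFunction_perm w σ (hsym n σ)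
  have hV1 : Measurable fun x => V (a * x) := (hVm.comp (continuous_const.mul continuous_id)).measurable
  have hone : ∀ {u : (n : ℕ) → PolaronConfig n → ℂ}, (∀ n, MemLp (u n) 2 volume) → ∀ n,
      HasSum (fun w : Fin n → ℕ => ∫ x, ‖contract volume (wordFunction f w) (u n) x‖ ^ 2)
        (∫ p, ‖u n p‖ ^ 2) := fun hu n => by
    simpa using hf.hasSum_weight n (hu n) (G := fun _ => 1) measurable_const
      (fun _ => zero_le_one) fun _ => le_rfl
  have t1 : Tendsto (fun m => ∑ n ∈ Finset.range (N + 1), ∑ w : Fin n → Fin m,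
      ∫ x, ‖c n (fun i => w i) x‖ ^ 2) atTop (𝓝 (∑ n ∈ Finset.range (N + 1), ∫ p, ‖ψ n p‖ ^ 2)) :=
    tendsto_finsetSum _ fun n _ => (hone hψ n).tendsto_sum_words
  have t2 : Tendsto (fun m => ∑ n ∈ Finset.range (N + 1), ∑ w : Fin n → Fin m,
      ∫ x, ‖dc n (fun i => w i) x‖ ^ 2) atTop (𝓝 (∑ n ∈ Finset.range (N + 1), ∫ p, ‖dψ n p‖ ^ 2)) :=
    tendsto_finsetSum _ fun n _ => (hone hdψ n).tendsto_sum_words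
  have t3 : Tendsto (fun m => ∑ n ∈ Finset.range (N + 1), ∑ w : Fin n → Fin m,
      (n : ℝ) * ∫ x, ‖c n (fun i => w i) x‖ ^ 2) atTop
      (𝓝 (∑ n ∈ Finset.range (N + 1), (n : ℝ) * ∫ p, ‖ψ n p‖ ^ 2)) :=
    tendsto_finsetSum _ fun n _ => ((hone hψ n).mul_left (n : ℝ)).tendsto_sum_words
  have t4 : Tendsto (fun m => ∑ n ∈ Finset.range (N + 1), ∑ w : Fin n → Fin m,
      ∫ x, V (a * x) * ‖c n (fun i => w i) x‖ ^ 2) atTop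
      (𝓝 (∑ n ∈ Finset.range (N + 1), ∫ p, V (a * p.1) * ‖ψ n p‖ ^ 2)) :=
    tendsto_finsetSum _ fun n _ => (hf.hasSum_weight n (hψ n) hV1 (fun _ => hV0 _)
      fun _ => hVB _).tendsto_sum_words
  have hcross : ∀ (j : Fin M) (n : ℕ), HasSum (fun w : Fin n → ℕ =>
      (∫ x in Ω j, star (c n w x) * c (n + 1) (Fin.cons (b j) w : Fin (n + 1) → ℕ) x).re)
      (∫ p : PolaronConfig n, (Ω j).indicator (fun _ => (1 : ℂ)) p.1 *
            (star (ψ n p) * annihilate (g j) (ψ (n + 1)) p)).re := by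
    intro j n
    have hann : annihilate (n := n) (f (b j)) (ψ (n + 1)) = annihilate (g j) (ψ (n + 1)) := by
      ext p
      refine integral_congr_ae ?_
      filter_upwards [hfb j] with k hk
      rw [hk]
    rw [← hann]
    have := hf.hasSum_weight_re n (hψ n) ((hf.memLp (b j)).annihilate (hψ (n + 1))) (hΩ j)
    convert this using 1
    ext w
    congr 1
    refine setIntegral_congr_ae (hΩ j) ?_
    filter_upwards [contract_wordFunction_cons hf.memLp (b j) w (hψ (n + 1))] with x hx _
    simp only [hcdef]
    rw [hx]
  have t5 : Tendsto (fun m => ∑ j, ∑ n ∈ Finset.range N, ∑ w : Fin n → Fin m, Real.sqrt (n + 1) *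
      (∫ x in Ω j, star (c n (fun i => w i) x) *
        c (n + 1) (Fin.cons (b j) (fun i => (w i : ℕ)) : Fin (n + 1) → ℕ) x).re) atTop
      (𝓝 (∑ j, ∑ n ∈ Finset.range N, Real.sqrt (n + 1) *
          (∫ p : PolaronConfig n, (Ω j).indicator (fun _ => (1 : ℂ)) p.1 *
            (star (ψ n p) * annihilate (g j) (ψ (n + 1)) p)).re)) :=
    tendsto_finsetSum _ fun j _ => tendsto_finsetSum _ fun n _ =>
      ((hcross j n).mul_left (Real.sqrt (n + 1))).tendsto_sum_words
  -- The inequality is proved for the first `m` modes of the system, and Parseval recovers every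
  -- term as `m` grows.
  refine le_of_tendsto_of_tendsto (t1.const_mul _)
    (((t2.const_mul k).add (t3.const_mul k)).sub (t4.const_mul (a ^ 2)) |>.sub
      ((t5.const_mul 2).const_mul (Real.sqrt (a / l)))) ?_
  filter_upwards [eventually_gt_atTop (Finset.univ.sup b)] with m hm
  have hbm : ∀ j, b j < m := fun j => (Finset.le_sup (Finset.mem_univ j)).trans_lt hm
  set b' : Fin M → Fin m := fun j => ⟨b j, hbm j⟩ with hb'
  have hb'i : Function.Injective b' := fun i j hij => hb (congrArg Fin.val hij)
  -- Only the modes in the image of `b'` interact; `m` exceeds all their numbers. The other modes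
  -- are given the empty cell.
  have key := word_lower_bound (ι := Fin m) hVm hV0 hVB hk hk1 ha
    (c := fun n w => c n fun i => w i) (dc := fun n w => dc n fun i => w i)
    (fun n w => hprim n _) (fun n w => hc n _) (fun n w => hdc n _)
    (fun n w σ => hcsym n (fun i => w i) σ) N (Finset.univ.image b')
    (Function.extend b' Ω fun _ => ∅) ?_ ?_ hl ?_
  · rw [Finset.card_image_of_injective _ hb'i, Finset.card_univ, Fintype.card_fin,
      Finset.sum_image fun i _ j _ hij => hb'i hij] at key
    refine key.trans (le_of_eq ?_)
    congr 3
    rw [Complex.re_sum]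
    refine Finset.sum_congr rfl fun j _ => ?_
    rw [Complex.re_sum]
    refine Finset.sum_congr rfl fun n _ => ?_
    rw [Complex.re_sum]
    refine Finset.sum_congr rfl fun w _ => ?_
    rw [Complex.re_ofReal_mul, hb'i.extend_apply]
    congr 4
    ext x
    congr 2
    ext i
    refine Fin.cases ?_ (fun i => ?_) i <;> simp [hb']
  · simp only [Finset.mem_image, Finset.mem_univ, true_and]
    rintro _ ⟨j, rfl⟩
    rw [hb'i.extend_apply]; exact hΩ j
  · simp only [Finset.coe_image, Finset.coe_univ, Set.image_univ]
    rintro _ ⟨i, rfl⟩ _ ⟨j, rfl⟩ hij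
    simp only [Function.onFun, hb'i.extend_apply]
    exact hdis fun h => hij (congrArg b' h)
  · simp only [Finset.mem_image, Finset.mem_univ, true_and]
    rintro _ ⟨j, rfl⟩
    rw [hb'i.extend_apply]; exact hΩl j

end

/-! ### Plancherel for the transform with kernel `e^{-ikx}`. -/

section Plancherel

open FourierTransform

/-- Tested against smooth compactly supported functions, both transforms reduce to the integral of
`u` against the transform of the test function. -/
theorem fourier_toLp_ae_eq {u : ℝ → ℂ} (h1 : Integrable u) (h2 : MemLp u 2 volume) :
    ((𝓕 (h2.toLp u) : Lp ℂ 2 (volume : Measure ℝ)) : ℝ → ℂ) =ᵐ[volume] 𝓕 u := by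
  refine ae_eq_of_integral_contDiff_smul_eq ((Lp.memLp _).locallyIntegrable (by norm_num))
    (VectorFourier.fourierIntegral_continuous Real.continuous_fourierChar
      (by fun_prop) h1).locallyIntegrable fun g hg hgc => ?_
  have hg₁ : HasCompactSupport (Complex.ofRealCLM ∘ g) := hgc.comp_left rfl
  have hg₂ : ContDiff ℝ ∞ (Complex.ofRealCLM ∘ g) := by fun_prop
  set φ := hg₁.toSchwartzMap hg₂ with hφ
  have e1 : ∫ x, g x • ((𝓕 (h2.toLp u) : Lp ℂ 2 (volume : Measure ℝ)) : ℝ → ℂ) x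
      = Lp.toTemperedDistribution (𝓕 (h2.toLp u)) φ := by
    rw [Lp.toTemperedDistribution_apply]
    refine integral_congr_ae (ae_of_all _ fun x => ?_)
    simp [hφ]
  rw [e1, ← Lp.fourier_toTemperedDistribution_eq, TemperedDistribution.fourier_apply,
    Lp.toTemperedDistribution_apply]
  have e2 : ∫ x, (𝓕 φ) x • (h2.toLp u : ℝ → ℂ) x = ∫ x, 𝓕 (φ : ℝ → ℂ) x • u x := by
    refine integral_congr_ae ?_
    filter_upwards [h2.coeFn_toLp] with x hx
    rw [hx, SchwartzMap.fourier_coe]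
  rw [e2]
  have e3 := VectorFourier.integral_fourierIntegral_smul_eq_flip (L := innerₗ ℝ)
    Real.continuous_fourierChar (by fun_prop) (φ.integrable (μ := volume)) h1
  refine e3.trans ?_
  refine integral_congr_ae (ae_of_all _ fun x => ?_)
  simp only [flip_innerₗ]
  simp [hφ]
  exact Or.inl rfl

/-- The Fourier transform in the normalisation `∫ e^{-ikx} u(x) dx`. -/
noncomputable def angularFourier (u : ℝ → ℂ) (k : ℝ) : ℂ :=
  ∫ x : ℝ, Complex.exp (-(Complex.I * k * x)) * u x

theorem angularFourier_eq (u : ℝ → ℂ) (k : ℝ) :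
    angularFourier u k = 𝓕 u ((2 * Real.pi)⁻¹ * k) := by
  rw [Real.fourier_real_eq_integral_exp_smul]
  refine integral_congr_ae (ae_of_all _ fun x => ?_)
  simp only [smul_eq_mul]
  congr 2
  push_cast
  have : (Real.pi : ℂ) ≠ 0 := by exact_mod_cast Real.pi_ne_zero
  field_simp

theorem continuous_angularFourier {u : ℝ → ℂ} (h1 : Integrable u) :
    Continuous (angularFourier u) := by
  have : angularFourier u = fun k => 𝓕 u ((2 * Real.pi)⁻¹ * k) := funext (angularFourier_eq u)
  rw [this]
  exact (VectorFourier.fourierIntegral_continuous Real.continuous_fourierChar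
      (L := innerₗ ℝ) (by fun_prop) h1).comp (continuous_const.mul continuous_id)

theorem memLp_angularFourier {u : ℝ → ℂ} (h1 : Integrable u) (h2 : MemLp u 2 volume) :
    MemLp (angularFourier u) 2 volume := by
  rw [memLp_two_iff_integrable_norm_sq (continuous_angularFourier h1).aestronglyMeasurable]
  have h3 : MemLp (𝓕 u) 2 volume := (memLp_congr_ae (fourier_toLp_ae_eq h1 h2)).1 (Lp.memLp _)
  have h4 := h3.integrable_norm_sq.comp_mul_left' (R := (2 * Real.pi)⁻¹) (by positivity)
  simpa only [angularFourier_eq] using h4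

theorem integral_star_angularFourier_mul {u v : ℝ → ℂ} (hu1 : Integrable u)
    (hu2 : MemLp u 2 volume) (hv1 : Integrable v) (hv2 : MemLp v 2 volume) :
    ∫ k, star (angularFourier u k) * angularFourier v k
      = (2 * Real.pi : ℝ) * ∫ x, star (u x) * v x := by
  have h := Lp.inner_fourier_eq (hu2.toLp u) (hv2.toLp v)
  rw [L2.inner_def, L2.inner_def] at h
  have e1 : ∫ x, star (𝓕 u x) * 𝓕 v x = ∫ x, star (u x) * v x := by
    have e2 : ∫ x, star (𝓕 u x) * 𝓕 v x = ∫ x, inner ℂ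
        ((𝓕 (hu2.toLp u) : Lp ℂ 2 (volume : Measure ℝ)) x)
        ((𝓕 (hv2.toLp v) : Lp ℂ 2 (volume : Measure ℝ)) x) := by
      refine integral_congr_ae ?_
      filter_upwards [fourier_toLp_ae_eq hu1 hu2, fourier_toLp_ae_eq hv1 hv2] with x h1 h2
      rw [h1, h2]
      simp [mul_comm]
    rw [e2, h]
    refine integral_congr_ae ?_
    filter_upwards [hu2.coeFn_toLp, hv2.coeFn_toLp] with x h1 h2
    rw [h1, h2]
    simp [mul_comm]
  simp only [angularFourier_eq]
  rw [Measure.integral_comp_mul_left (fun k => star (𝓕 u k) * 𝓕 v k) (2 * Real.pi)⁻¹, e1, inv_inv,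
    abs_of_pos (by positivity), Complex.real_smul]

theorem integral_norm_angularFourier_sq {u : ℝ → ℂ} (hu1 : Integrable u)
    (hu2 : MemLp u 2 volume) :
    ∫ k, ‖angularFourier u k‖ ^ 2 = 2 * Real.pi * ∫ x, ‖u x‖ ^ 2 := by
  have h := integral_star_angularFourier_mul hu1 hu2 hu1 hu2
  have e : ∀ z : ℂ, star z * z = ((‖z‖ ^ 2 : ℝ) : ℂ) := fun z => by
    rw [RCLike.star_def, Complex.conj_mul']; push_cast; rfl
  simp_rw [e, integral_complex_ofReal] at h
  exact_mod_cast h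

end Plancherel

/-- A form factor `h x k` whose square integral in the momentum `k` is bounded by `D` uniformly in
the electron position `x`. -/
structure IsKernel (h : ℝ → ℝ → ℂ) (D : ℝ) : Prop where
  measurable : Measurable fun q : ℝ × ℝ => h q.1 q.2
  memLp : ∀ x, MemLp (h x) 2 volume
  bound : ∀ x, ∫ k, ‖h x k‖ ^ 2 ≤ D

/-- The matrix element of the annihilation of a phonon with form factor `h`, without the
combinatorial factor. -/
noncomputable def coupling {n : ℕ} (h : ℝ → ℝ → ℂ) (u : PolaronConfig n → ℂ)
    (v : PolaronConfig (n + 1) → ℂ) : ℂ :=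
  ∫ p : PolaronConfig n, star (u p) * ∫ k, h p.1 k * v (p.1, Fin.cons k p.2)

/-! ### Matrix elements of the coupling to a bounded form factor. -/

section Kernel

variable {h h' : ℝ → ℝ → ℂ} {D D' : ℝ} {n : ℕ} {u : PolaronConfig n → ℂ}
  {v : PolaronConfig (n + 1) → ℂ}

theorem IsKernel.nonneg (hh : IsKernel h D) : 0 ≤ D :=
  (integral_nonneg fun _ => sq_nonneg _).trans (hh.bound 0)

theorem IsKernel.memLp_mul (hh : IsKernel h D) (hu : MemLp u 2 volume) :
    MemLp (fun q : PolaronConfig n × ℝ => h q.1.1 q.2 * star (u q.1)) 2 (volume.prod volume) ∧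
      ∫ q : PolaronConfig n × ℝ, ‖h q.1.1 q.2 * star (u q.1)‖ ^ 2 ∂(volume.prod volume)
        ≤ D * ∫ p, ‖u p‖ ^ 2 := by
  have hm : AEStronglyMeasurable (fun q : PolaronConfig n × ℝ => h q.1.1 q.2 * star (u q.1))
      (volume.prod volume) :=
    (hh.measurable.comp (measurable_fst.fst.prodMk measurable_snd)).aestronglyMeasurable.mul
      hu.1.star.comp_fst
  have hs : ∀ p : PolaronConfig n, ∫ k, ‖h p.1 k * star (u p)‖ ^ 2
      = (∫ k, ‖h p.1 k‖ ^ 2) * ‖u p‖ ^ 2 := by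
    intro p
    rw [← integral_mul_const]
    simp only [norm_mul, norm_star, mul_pow]
  have hle : ∀ p : PolaronConfig n, (∫ k, ‖h p.1 k‖ ^ 2) * ‖u p‖ ^ 2 ≤ D * ‖u p‖ ^ 2 := fun p =>
    mul_le_mul_of_nonneg_right (hh.bound _) (sq_nonneg _)
  have hi : Integrable (fun q : PolaronConfig n × ℝ => ‖h q.1.1 q.2 * star (u q.1)‖ ^ 2)
      (volume.prod volume) := by
    rw [integrable_prod_iff (f := fun q : PolaronConfig n × ℝ => ‖h q.1.1 q.2 * star (u q.1)‖ ^ 2)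
      (hm.norm.pow 2)]
    constructor
    · refine ae_of_all _ fun p => ?_
      simp only [norm_mul, norm_star, mul_pow]
      exact (hh.memLp p.1).integrable_norm_sq.mul_const _
    · refine (hu.integrable_norm_sq.const_mul D).mono' (hm.norm.pow 2).norm.integral_prod_right' ?_
      refine ae_of_all _ fun p => ?_
      simp only [norm_pow, norm_norm]
      rw [Real.norm_of_nonneg (integral_nonneg fun _ => sq_nonneg _), hs]
      exact hle p
  refine ⟨(memLp_two_iff_integrable_norm_sq hm).2 hi, ?_⟩
  rw [integral_prod _ hi, ← integral_const_mul]
  refine integral_mono hi.integral_prod_left (hu.integrable_norm_sq.const_mul D) fun p => ?_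
  exact (hs p).trans_le (hle p)

theorem IsKernel.integrable (hh : IsKernel h D) (hu : MemLp u 2 volume) (hv : MemLp v 2 volume) :
    Integrable (fun q : PolaronConfig n × ℝ =>
      h q.1.1 q.2 * star (u q.1) * v (q.1.1, Fin.cons q.2 q.1.2)) (volume.prod volume) :=
  (hh.memLp_mul hu).1.integrable_mul hv.comp_configCons

theorem IsKernel.coupling_eq (hh : IsKernel h D) (hu : MemLp u 2 volume) (hv : MemLp v 2 volume) :
    coupling h u v = ∫ q : PolaronConfig n × ℝ,
      h q.1.1 q.2 * star (u q.1) * v (q.1.1, Fin.cons q.2 q.1.2) ∂(volume.prod volume) := by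
  rw [integral_prod _ (hh.integrable hu hv)]
  refine integral_congr_ae (ae_of_all _ fun p => ?_)
  simp only
  rw [← integral_const_mul]
  refine integral_congr_ae (ae_of_all _ fun k => ?_)
  simp only
  ring

theorem IsKernel.norm_coupling_le (hh : IsKernel h D) (hu : MemLp u 2 volume)
    (hv : MemLp v 2 volume) :
    ‖coupling h u v‖ ≤ Real.sqrt D * (Real.sqrt (∫ p, ‖u p‖ ^ 2) * Real.sqrt (∫ p, ‖v p‖ ^ 2)) := by
  have h1 := norm_integral_mul_sq_le (hh.memLp_mul hu).1 hv.comp_configCons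
  have h2 : ∫ q : PolaronConfig n × ℝ, ‖v (q.1.1, Fin.cons q.2 q.1.2)‖ ^ 2 ∂(volume.prod volume)
      = ∫ p, ‖v p‖ ^ 2 := by
    have hmp := measurePreserving_configCons n
    rw [← hmp.map_eq, integral_map hmp.measurable.aemeasurable
      (by rw [hmp.map_eq]; exact hv.1.norm.pow 2)]
    rfl
  rw [← hh.coupling_eq hu hv, h2] at h1
  rw [← Real.sqrt_mul (integral_nonneg fun _ => sq_nonneg _), ← Real.sqrt_mul hh.nonneg, ← mul_assoc]
  refine Real.le_sqrt_of_sq_le (h1.trans ?_)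
  exact mul_le_mul_of_nonneg_right (hh.memLp_mul hu).2 (integral_nonneg fun _ => sq_nonneg _)

theorem IsKernel.coupling_sub (hh : IsKernel h D) (hh' : IsKernel h' D') (hu : MemLp u 2 volume)
    (hv : MemLp v 2 volume) {h'' : ℝ → ℝ → ℂ} {D'' : ℝ} (hh'' : IsKernel h'' D'')
    (hsub : ∀ x k, h'' x k = h x k - h' x k) :
    coupling h'' u v = coupling h u v - coupling h' u v := by
  rw [hh.coupling_eq hu hv, hh'.coupling_eq hu hv, hh''.coupling_eq hu hv,
    ← integral_sub (hh.integrable hu hv) (hh'.integrable hu hv)]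
  refine integral_congr_ae (ae_of_all _ fun q => ?_)
  simp only [hsub]
  ring

theorem IsWeakElectronDeriv.shift {f g : PolaronConfig n → ℂ} (hw : IsWeakElectronDeriv f g)
    (hf : MemLp f 2 volume) (hg : MemLp g 2 volume) (s : ℝ) :
    ∀ᵐ p : PolaronConfig n, f (p.1 + s, p.2) - f p = ∫ t in (0:ℝ)..s, g (p.1 + t, p.2) := by
  have : (volume : Measure (PolaronConfig n)).IsAddHaarMeasure :=
    Measure.prod.instIsAddHaarMeasure (volume : Measure ℝ) (volume : Measure (Fin n → ℝ))
  have h := shift_of_weakDeriv (E := PolaronConfig n) hf hg (1, 0) hw s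
  filter_upwards [h] with p hp
  have e : ∀ t : ℝ, p + t • ((1, 0) : PolaronConfig n) = (p.1 + t, p.2) := by
    intro t; ext <;> simp
  simpa only [e] using hp

theorem IsWeakElectronDeriv.ae_isPrimitive {f g : PolaronConfig n → ℂ}
    (hw : IsWeakElectronDeriv f g) (hf : MemLp f 2 volume) (hg : MemLp g 2 volume) :
    ∀ᵐ y : Fin n → ℝ, IsPrimitive (fun x => f (x, y)) (fun x => g (x, y)) := by
  have hg' : MemLp g 2 (volume.prod volume) := hg
  refine ae_isPrimitive_of_shift hf.1 hg.1 ?_ (hw.shift hf hg)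
  filter_upwards [hg'.ae_slice_left] with y hy
  exact hy.locallyIntegrable (by norm_num)

theorem integral_config_swap {F : PolaronConfig n × ℝ → ℂ}
    (hF : Integrable F (volume.prod volume)) :
    (∀ᵐ r ∂((volume : Measure (Fin n → ℝ)).prod (volume : Measure ℝ)),
      Integrable fun x => F ((x, r.1), r.2)) ∧
    ∫ q, F q ∂(volume.prod volume) = ∫ r : (Fin n → ℝ) × ℝ, (∫ x, F ((x, r.1), r.2))
      ∂(volume.prod volume) := by
  have hmp := (measurePreserving_prodAssoc (volume : Measure ℝ) (volume : Measure (Fin n → ℝ))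
    (volume : Measure ℝ)).symm
  have hi := hmp.integrable_comp_of_integrable hF
  refine ⟨hi.prod_left_ae, ?_⟩
  exact (hmp.integral_comp MeasurableEquiv.prodAssoc.symm.measurableEmbedding F).symm.trans
    (integral_prod_symm _ hi)

/-- Integration by parts in the electron position. -/
theorem coupling_eq_of_isPrimitive {g : ℝ → ℝ → ℂ} {du : PolaronConfig n → ℂ}
    {dv : PolaronConfig (n + 1) → ℂ}
    (hh : IsKernel h D) (hg : IsKernel g D')
    (hgh : ∀ k, IsPrimitive (fun x => g x k) (fun x => h x k))
    (hhl : ∀ k, LocallyIntegrable (fun x => h x k) volume)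
    (hu : MemLp u 2 volume) (hdu : MemLp du 2 volume) (hwu : IsWeakElectronDeriv u du)
    (hv : MemLp v 2 volume) (hdv : MemLp dv 2 volume) (hwv : IsWeakElectronDeriv v dv) :
    coupling h u v = -(coupling g du v + coupling g u dv) := by
  rw [hh.coupling_eq hu hv, hg.coupling_eq hdu hv, hg.coupling_eq hu hdv, eq_neg_iff_add_eq_zero,
    ← integral_add (hg.integrable hdu hv) (hg.integrable hu hdv)]
  have i1 := hh.integrable hu hv
  have i2 : Integrable (fun q : PolaronConfig n × ℝ =>
      g q.1.1 q.2 * star (du q.1) * v (q.1.1, Fin.cons q.2 q.1.2)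
      + g q.1.1 q.2 * star (u q.1) * dv (q.1.1, Fin.cons q.2 q.1.2)) (volume.prod volume) :=
    (hg.integrable hdu hv).add (hg.integrable hu hdv)
  have i3 := i1.add i2
  rw [← integral_add i1 i2]
  -- Integrate in the electron position first: for almost every choice of momenta the integrand is
  -- the derivative of `g · ū · v`, an integrable primitive.
  refine (integral_config_swap i3).2.trans (integral_eq_zero_of_ae ?_)
  have hv' : MemLp v 2 (volume.prod volume) := hv
  have hu' : MemLp u 2 (volume.prod volume) := hu
  have hdu' : MemLp du 2 (volume.prod volume) := hdu
  have hdv' : MemLp dv 2 (volume.prod volume) := hdv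
  have hq : Measure.QuasiMeasurePreserving (fun r : (Fin n → ℝ) × ℝ => (Fin.cons r.2 r.1 : Fin (n+1) → ℝ))
      (volume.prod volume) volume :=
    ((measurePreserving_cons n).comp Measure.measurePreserving_swap).quasiMeasurePreserving
  filter_upwards [(integral_config_swap i3).1,
    (integral_config_swap (hg.integrable hu hv)).1,
    Measure.quasiMeasurePreserving_fst.ae (hwu.ae_isPrimitive hu hdu),
    Measure.quasiMeasurePreserving_fst.ae hdu'.ae_slice_left,
    hq.ae (hwv.ae_isPrimitive hv hdv), hq.ae hdv'.ae_slice_left,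
    Measure.quasiMeasurePreserving_fst.ae hu'.ae_slice_left, hq.ae hv'.ae_slice_left]
    with r h1 h2 h3 h4 h5 h6 h7 h8
  have h4' : LocallyIntegrable (fun x => du (x, r.1)) volume := h4.locallyIntegrable (by norm_num)
  have h4s : LocallyIntegrable (fun x => star (du (x, r.1))) volume :=
    h4.star.locallyIntegrable (by norm_num)
  have h6' : LocallyIntegrable (fun x => dv (x, Fin.cons r.2 r.1)) volume :=
    h6.locallyIntegrable (by norm_num)
  have h3s : IsPrimitive (fun x => star (u (x, r.1))) (fun x => star (du (x, r.1))) :=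
    h3.clm_comp h4' (Complex.conjCLE : ℂ →L[ℝ] ℂ)
  have m1 := h3s.mul h5 h4s h6'
  have l1 : LocallyIntegrable (fun x => star (du (x, r.1)) * v (x, Fin.cons r.2 r.1)
      + star (u (x, r.1)) * dv (x, Fin.cons r.2 r.1)) volume :=
    ((h4.star.integrable_mul h8).add (h7.star.integrable_mul h6)).locallyIntegrable
  have m2 := (hgh r.2).mul m1 (hhl r.2) l1
  have m3 := m2.congr (u' := fun x => g x r.2 * star (u (x, r.1)) * v (x, Fin.cons r.2 r.1))
    (du' := fun x => h x r.2 * star (u (x, r.1)) * v (x, Fin.cons r.2 r.1)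
      + (g x r.2 * star (du (x, r.1)) * v (x, Fin.cons r.2 r.1)
      + g x r.2 * star (u (x, r.1)) * dv (x, Fin.cons r.2 r.1)))
    (ae_of_all _ fun x => by ring) (ae_of_all _ fun x => by ring)
  exact m3.integral_eq_zero h2 h1

end Kernel

/-! ### Cauchy–Schwarz for sequences. -/

section Sequences

theorem summable_mul_of_sq {a b : ℕ → ℝ} (ha0 : ∀ n, 0 ≤ a n) (hb0 : ∀ n, 0 ≤ b n)
    (ha : Summable fun n => a n ^ 2) (hb : Summable fun n => b n ^ 2) :
    (Summable fun n => a n * b n) ∧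
      ∑' n, a n * b n ≤ Real.sqrt (∑' n, a n ^ 2) * Real.sqrt (∑' n, b n ^ 2) := by
  have h := Real.summable_and_inner_le_Lp_mul_Lq_tsum_of_nonneg Real.HolderConjugate.two_two
    ha0 hb0 (by simpa using ha) (by simpa using hb)
  simpa only [Real.rpow_two, ← Real.sqrt_eq_rpow] using h

end Sequences

/-! ### Bounds on the interaction by norm, phonon number and kinetic energy. -/

namespace PolaronState

variable (Ψ : PolaronState)

/-- The expectation of the annihilation of a phonon with form factor `h`. -/
noncomputable def interaction (h : ℝ → ℝ → ℂ) : ℂ :=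
  ∑' n : ℕ, (Real.sqrt (n + 1) : ℂ) * coupling h (Ψ.ψ n) (Ψ.ψ (n + 1))

theorem summable_number_succ : Summable fun n : ℕ => ((n : ℝ) + 1) * ∫ p, ‖Ψ.ψ (n + 1) p‖ ^ 2 := by
  simpa using (summable_nat_add_iff 1).2 Ψ.summable_number

theorem tsum_number_succ : ∑' n : ℕ, ((n : ℝ) + 1) * ∫ p, ‖Ψ.ψ (n + 1) p‖ ^ 2 = Ψ.number := by
  rw [number, Ψ.summable_number.tsum_eq_zero_add]
  simp

theorem integral_norm_sq_nonneg {α E : Type*} [MeasurableSpace α] {μ : Measure α}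
    [NormedAddCommGroup E] (u : α → E) : 0 ≤ ∫ p, ‖u p‖ ^ 2 ∂μ :=
  integral_nonneg fun _ => sq_nonneg _

theorem kinetic_nonneg : 0 ≤ Ψ.kinetic := tsum_nonneg fun _ => integral_norm_sq_nonneg _

theorem number_nonneg : 0 ≤ Ψ.number :=
  tsum_nonneg fun n => mul_nonneg n.cast_nonneg (integral_norm_sq_nonneg _)

/-- Summation over the phonon number of matrix elements that lower the number by one. -/
theorem summable_lowering {a b : ℕ → ℝ} (ha0 : ∀ n, 0 ≤ a n) (hb0 : ∀ n, 0 ≤ b n)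
    (ha : Summable a) (hb : Summable fun n : ℕ => ((n : ℝ) + 1) * b n) :
    (Summable fun n : ℕ => Real.sqrt (n + 1) * (Real.sqrt (a n) * Real.sqrt (b n))) ∧
      ∑' n : ℕ, Real.sqrt (n + 1) * (Real.sqrt (a n) * Real.sqrt (b n))
        ≤ Real.sqrt (∑' n, a n) * Real.sqrt (∑' n : ℕ, ((n : ℝ) + 1) * b n) := by
  have hn : ∀ n : ℕ, (0 : ℝ) ≤ (n : ℝ) + 1 := fun n => by positivity
  have e1 : ∀ n, Real.sqrt (a n) ^ 2 = a n := fun n => Real.sq_sqrt (ha0 n)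
  have e2 : ∀ n : ℕ, (Real.sqrt (n + 1) * Real.sqrt (b n)) ^ 2 = ((n : ℝ) + 1) * b n := fun n => by
    rw [mul_pow, Real.sq_sqrt (hn n), Real.sq_sqrt (hb0 n)]
  have h := summable_mul_of_sq (a := fun n => Real.sqrt (a n))
    (b := fun n : ℕ => Real.sqrt (n + 1) * Real.sqrt (b n))
    (fun _ => Real.sqrt_nonneg _) (fun _ => by positivity) (by simpa only [e1] using ha)
    (by simpa only [e2] using hb)
  simp only [e1, e2] at h
  have e3 : ∀ n : ℕ, Real.sqrt (a n) * (Real.sqrt (n + 1) * Real.sqrt (b n))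
      = Real.sqrt (n + 1) * (Real.sqrt (a n) * Real.sqrt (b n)) := fun n => by ring
  simpa only [e3] using h

variable {h g : ℝ → ℝ → ℂ} {D D' : ℝ}

theorem norm_interaction_le (hh : IsKernel h D) :
    (Summable fun n : ℕ => (Real.sqrt (n + 1) : ℂ) * coupling h (Ψ.ψ n) (Ψ.ψ (n + 1))) ∧
      ‖Ψ.interaction h‖ ≤ Real.sqrt D * (Real.sqrt Ψ.normSq * Real.sqrt Ψ.number) := by
  have hs := summable_lowering (fun n => integral_norm_sq_nonneg (Ψ.ψ n))
    (fun n => integral_norm_sq_nonneg (Ψ.ψ (n + 1))) Ψ.summable_normSq Ψ.summable_number_succ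
  rw [tsum_number_succ] at hs
  have hle : ∀ n : ℕ, ‖(Real.sqrt (n + 1) : ℂ) * coupling h (Ψ.ψ n) (Ψ.ψ (n + 1))‖
      ≤ Real.sqrt D * (Real.sqrt (n + 1) * (Real.sqrt (∫ p, ‖Ψ.ψ n p‖ ^ 2) *
        Real.sqrt (∫ p, ‖Ψ.ψ (n + 1) p‖ ^ 2))) := by
    intro n
    rw [norm_mul, Complex.norm_real, Real.norm_of_nonneg (Real.sqrt_nonneg _)]
    calc _ ≤ Real.sqrt (n + 1) * _ := mul_le_mul_of_nonneg_left
          (hh.norm_coupling_le (Ψ.memLp_ψ n) (Ψ.memLp_ψ (n + 1))) (Real.sqrt_nonneg _)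
      _ = _ := by ring
  have hs2 := hs.1.mul_left (Real.sqrt D)
  refine ⟨Summable.of_norm_bounded hs2 hle, (tsum_of_norm_bounded hs2.hasSum hle).trans ?_⟩
  rw [tsum_mul_left]
  exact mul_le_mul_of_nonneg_left hs.2 (Real.sqrt_nonneg _)

theorem interaction_sub {h' h'' : ℝ → ℝ → ℂ} {D'' : ℝ} (hh : IsKernel h D) (hh' : IsKernel h' D')
    (hh'' : IsKernel h'' D'') (hsub : ∀ x k, h'' x k = h x k - h' x k) :
    Ψ.interaction h'' = Ψ.interaction h - Ψ.interaction h' := by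
  rw [interaction, interaction, interaction, ← (Ψ.norm_interaction_le hh).1.tsum_sub
    (Ψ.norm_interaction_le hh').1]
  refine tsum_congr fun n => ?_
  rw [hh.coupling_sub hh' (Ψ.memLp_ψ n) (Ψ.memLp_ψ (n + 1)) hh'' hsub, mul_sub]

/-- A form factor that is the derivative of a bounded kernel is controlled by the kinetic energy. -/
theorem norm_interaction_le_of_isPrimitive (hh : IsKernel h D) (hg : IsKernel g D')
    (hgh : ∀ k, IsPrimitive (fun x => g x k) (fun x => h x k))
    (hhl : ∀ k, LocallyIntegrable (fun x => h x k) volume) :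
    ‖Ψ.interaction h‖ ≤ Real.sqrt D' * (Real.sqrt Ψ.kinetic * Real.sqrt Ψ.number
      + Real.sqrt (Ψ.number + Ψ.normSq) * Real.sqrt Ψ.kinetic) := by
  have hs := summable_lowering (fun n => integral_norm_sq_nonneg (Ψ.dψ n))
    (fun n => integral_norm_sq_nonneg (Ψ.ψ (n + 1))) Ψ.summable_kinetic Ψ.summable_number_succ
  rw [tsum_number_succ] at hs
  have hkin := (summable_nat_add_iff 1).2 Ψ.summable_kinetic
  have hnum : Summable fun n : ℕ => ((n : ℝ) + 1) * ∫ p, ‖Ψ.ψ n p‖ ^ 2 := by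
    simpa only [add_mul, one_mul] using Ψ.summable_number.add Ψ.summable_normSq
  have hnum2 : ∑' n : ℕ, ((n : ℝ) + 1) * ∫ p, ‖Ψ.ψ n p‖ ^ 2 = Ψ.number + Ψ.normSq := by
    rw [number, normSq, ← Ψ.summable_number.tsum_add Ψ.summable_normSq]
    simp only [add_mul, one_mul]
  -- When the derivative falls on the component with `n + 1` phonons, the factor `n + 1` weights the
  -- one with `n`, hence `number + normSq`.
  have hs' := summable_lowering (fun n => integral_norm_sq_nonneg (Ψ.dψ (n + 1)))
    (fun n => integral_norm_sq_nonneg (Ψ.ψ n)) hkin hnum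
  rw [hnum2] at hs'
  have hk1 : ∑' n, ∫ p, ‖Ψ.dψ (n + 1) p‖ ^ 2 ≤ Ψ.kinetic := by
    rw [kinetic, Ψ.summable_kinetic.tsum_eq_zero_add]
    exact le_add_of_nonneg_left (integral_norm_sq_nonneg _)
  have hle : ∀ n : ℕ, ‖(Real.sqrt (n + 1) : ℂ) * coupling h (Ψ.ψ n) (Ψ.ψ (n + 1))‖
      ≤ Real.sqrt D' * (Real.sqrt (n + 1) * (Real.sqrt (∫ p, ‖Ψ.dψ n p‖ ^ 2) *
        Real.sqrt (∫ p, ‖Ψ.ψ (n + 1) p‖ ^ 2)) + Real.sqrt (n + 1) *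
        (Real.sqrt (∫ p, ‖Ψ.dψ (n + 1) p‖ ^ 2) * Real.sqrt (∫ p, ‖Ψ.ψ n p‖ ^ 2))) := by
    intro n
    rw [norm_mul, Complex.norm_real, Real.norm_of_nonneg (Real.sqrt_nonneg _),
      coupling_eq_of_isPrimitive hh hg hgh hhl (Ψ.memLp_ψ n) (Ψ.memLp_dψ n) (Ψ.weakDeriv n)
        (Ψ.memLp_ψ (n + 1)) (Ψ.memLp_dψ (n + 1)) (Ψ.weakDeriv (n + 1)), norm_neg]
    have h1 := hg.norm_coupling_le (Ψ.memLp_dψ n) (Ψ.memLp_ψ (n + 1))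
    have h2 := hg.norm_coupling_le (Ψ.memLp_ψ n) (Ψ.memLp_dψ (n + 1))
    calc _ ≤ Real.sqrt (n + 1) * _ := mul_le_mul_of_nonneg_left
          ((norm_add_le _ _).trans (add_le_add h1 h2)) (Real.sqrt_nonneg _)
      _ = _ := by ring
  have hs2 := (hs.1.add hs'.1).mul_left (Real.sqrt D')
  refine (tsum_of_norm_bounded hs2.hasSum hle).trans ?_
  rw [tsum_mul_left, hs.1.tsum_add hs'.1]
  refine mul_le_mul_of_nonneg_left (add_le_add hs.2 (hs'.2.trans ?_)) (Real.sqrt_nonneg _)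
  rw [mul_comm]
  exact mul_le_mul_of_nonneg_left (Real.sqrt_le_sqrt hk1) (Real.sqrt_nonneg _)

end PolaronState

/-! ### Plane waves averaged over a grid of cells, and the primitive of the error. -/

section Cells

/-- The form factor `e^{ikx}` of the polaron. -/
noncomputable def planeWave (x k : ℝ) : ℂ := Complex.exp (Complex.I * k * x)

/-- The restriction of a form factor to the momenta `|k| ≤ K`. -/
noncomputable def momentumCutoff (K : ℝ) (h : ℝ → ℝ → ℂ) (x k : ℝ) : ℂ :=
  (Set.Icc (-K) K).indicator (h x) k

/-- The cell with number `j` of the grid of width `l`. -/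
def gridCell (l : ℝ) (j : ℤ) : Set ℝ := Set.Ico (j * l) ((j + 1) * l)

/-- The plane waves averaged over the cell with number `j`. -/
noncomputable def cellAverage (l : ℝ) (j : ℤ) (k : ℝ) : ℂ :=
  (l⁻¹ : ℝ) * ∫ t in (j * l)..((j + 1) * l), planeWave t k

/-- The form factor obtained by averaging the plane waves over the cells of a grid. -/
noncomputable def cellKernel (l x k : ℝ) : ℂ := cellAverage l ⌊x / l⌋ k

/-- The primitive of the difference of the plane waves and their averages. -/
noncomputable def cellPrimitive (l x k : ℝ) : ℂ :=
  ∫ t in (0:ℝ)..x, (planeWave t k - cellKernel l t k)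

/-- The normalised phonon mode of a cell. -/
noncomputable def cellMode (l : ℝ) (j : ℤ) (k : ℝ) : ℂ :=
  (Real.sqrt (l / (2 * Real.pi)) : ℂ) * star (cellAverage l j k)

theorem norm_planeWave (x k : ℝ) : ‖planeWave x k‖ = 1 := by
  rw [planeWave, Complex.norm_exp]
  simp

theorem continuous_planeWave : Continuous fun q : ℝ × ℝ => planeWave q.1 q.2 := by
  unfold planeWave; fun_prop

theorem continuous_planeWave_left (k : ℝ) : Continuous fun x => planeWave x k := by
  unfold planeWave; fun_prop

theorem indicator_Ico_integrable (a b : ℝ) :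
    Integrable ((Set.Ico a b).indicator fun _ => (1 : ℂ)) :=
  (integrable_indicator_iff measurableSet_Ico).2 (by simp)

theorem indicator_Ico_memLp (a b : ℝ) :
    MemLp ((Set.Ico a b).indicator fun _ => (1 : ℂ)) 2 volume :=
  memLp_indicator_const 2 measurableSet_Ico 1 (Or.inr (by simp))

theorem star_angularFourier_indicator {a b : ℝ} (hab : a ≤ b) (k : ℝ) :
    star (angularFourier ((Set.Ico a b).indicator fun _ => 1) k)
      = ∫ t in a..b, planeWave t k := by
  rw [angularFourier, RCLike.star_def, ← integral_conj, intervalIntegral.integral_of_le hab,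
    ← integral_Ico_eq_integral_Ioc, ← integral_indicator measurableSet_Ico]
  refine integral_congr_ae (ae_of_all _ fun x => ?_)
  by_cases hx : x ∈ Set.Ico a b
  · simp [hx, planeWave, ← Complex.exp_conj]
  · simp [hx]

variable {l : ℝ}

theorem cell_le (hl : 0 < l) (j : ℤ) : (j : ℝ) * l ≤ (j + 1) * l :=
  mul_le_mul_of_nonneg_right (by linarith) hl.le

theorem mem_gridCell_iff (hl : 0 < l) {x : ℝ} {j : ℤ} : x ∈ gridCell l j ↔ ⌊x / l⌋ = j := by
  rw [Int.floor_eq_iff, gridCell, Set.mem_Ico, le_div_iff₀ hl, div_lt_iff₀ hl]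

theorem cellAverage_eq (hl : 0 < l) (j : ℤ) (k : ℝ) :
    cellAverage l j k = (l⁻¹ : ℝ) * star (angularFourier ((gridCell l j).indicator fun _ => 1) k) := by
  rw [gridCell, star_angularFourier_indicator (cell_le hl j)]
  rfl

theorem continuous_cellAverage (hl : 0 < l) (j : ℤ) : Continuous (cellAverage l j) := by
  have : cellAverage l j = fun k =>
    ((l⁻¹ : ℝ) : ℂ) * star (angularFourier ((gridCell l j).indicator fun _ => 1) k) :=
    funext (cellAverage_eq hl j)
  rw [this]
  exact continuous_const.mul (continuous_angularFourier (indicator_Ico_integrable _ _)).star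

theorem memLp_cellAverage (hl : 0 < l) (j : ℤ) : MemLp (cellAverage l j) 2 volume := by
  have : cellAverage l j = fun k =>
    ((l⁻¹ : ℝ) : ℂ) * star (angularFourier ((gridCell l j).indicator fun _ => 1) k) :=
    funext (cellAverage_eq hl j)
  rw [this]
  exact (memLp_angularFourier (indicator_Ico_integrable _ _)
    (indicator_Ico_memLp _ _)).star.const_mul _

/-- Up to conjugation, a cell average is the transform of `l⁻¹` times the indicator of the cell.
Disjoint cells give orthogonality, and the squared norm is `l⁻² · 2π · l`. -/
theorem integral_star_cellAverage_mul (hl : 0 < l) (i j : ℤ) :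
    ∫ k, cellAverage l i k * star (cellAverage l j k)
      = if i = j then ((2 * Real.pi / l : ℝ) : ℂ) else 0 := by
  have h := integral_star_angularFourier_mul (indicator_Ico_integrable (i * l) ((i + 1) * l))
    (indicator_Ico_memLp (i * l) ((i + 1) * l)) (indicator_Ico_integrable (j * l) ((j + 1) * l))
    (indicator_Ico_memLp (j * l) ((j + 1) * l))
  have e1 : ∀ k, cellAverage l i k * star (cellAverage l j k) = ((l⁻¹ * l⁻¹ : ℝ) : ℂ) *
      (star (angularFourier ((gridCell l i).indicator fun _ => 1) k) *
        angularFourier ((gridCell l j).indicator fun _ => 1) k) := by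
    intro k
    rw [cellAverage_eq hl, cellAverage_eq hl]
    simp only [star_mul', RCLike.star_def, Complex.conj_ofReal, Complex.conj_conj]
    push_cast
    ring
  simp_rw [e1]
  rw [integral_const_mul]
  simp only [gridCell]
  rw [h]
  have e2 : ∫ x, star ((Set.Ico (i * l) ((i + 1) * l)).indicator (fun _ => (1 : ℂ)) x) *
      (Set.Ico (j * l) ((j + 1) * l)).indicator (fun _ => (1 : ℂ)) x = if i = j then (l : ℂ) else 0 := by
    split_ifs with hij
    · subst hij
      have : ∀ x, star ((Set.Ico (i * l) ((i + 1) * l)).indicator (fun _ => (1 : ℂ)) x) *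
          (Set.Ico (i * l) ((i + 1) * l)).indicator (fun _ => (1 : ℂ)) x
          = (Set.Ico (i * l) ((i + 1) * l)).indicator (fun _ => (1 : ℂ)) x := by
        intro x
        by_cases hx : x ∈ Set.Ico (i * l) ((i + 1) * l) <;> simp [hx]
      simp_rw [this]
      rw [integral_indicator measurableSet_Ico]
      simp [Measure.real, add_mul, hl.le]
    · refine integral_eq_zero_of_ae (ae_of_all _ fun x => ?_)
      by_cases hx : x ∈ Set.Ico (i * l) ((i + 1) * l)
      · have hx' : x ∉ Set.Ico (j * l) ((j + 1) * l) := fun hx' =>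
          hij (((mem_gridCell_iff hl).1 hx).symm.trans ((mem_gridCell_iff hl).1 hx'))
        simp [hx']
      · simp [hx]
  rw [e2]
  have hl' : (l : ℂ) ≠ 0 := by exact_mod_cast hl.ne'
  split_ifs
  · push_cast
    field_simp
  · simp

theorem memLp_cellMode (hl : 0 < l) (j : ℤ) : MemLp (cellMode l j) 2 volume :=
  (memLp_cellAverage hl j).star.const_mul _

theorem integral_star_cellMode_mul (hl : 0 < l) (i j : ℤ) :
    ∫ k, star (cellMode l i k) * cellMode l j k = if i = j then 1 else 0 := by
  have e : ∀ k, star (cellMode l i k) * cellMode l j k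
      = ((l / (2 * Real.pi) : ℝ) : ℂ) * (cellAverage l i k * star (cellAverage l j k)) := by
    intro k
    have h := Real.mul_self_sqrt (show 0 ≤ l / (2 * Real.pi) by positivity)
    simp only [cellMode, star_mul', RCLike.star_def, Complex.conj_ofReal, Complex.conj_conj]
    generalize Real.sqrt (l / (2 * Real.pi)) = s at h ⊢
    rw [← h]
    push_cast
    ring
  simp_rw [e]
  rw [integral_const_mul, integral_star_cellAverage_mul hl]
  split_ifs
  · rw [← Complex.ofReal_mul]
    have : l / (2 * Real.pi) * (2 * Real.pi / l) = 1 := by field_simp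
    rw [this, Complex.ofReal_one]
  · simp

theorem star_cellMode (hl : 0 < l) (j : ℤ) (k : ℝ) :
    cellAverage l j k = (Real.sqrt (2 * Real.pi / l) : ℂ) * star (cellMode l j k) := by
  simp only [cellMode, star_mul', RCLike.star_def, Complex.conj_ofReal, Complex.conj_conj]
  rw [← mul_assoc, ← Complex.ofReal_mul, ← Real.sqrt_mul (by positivity)]
  have : 2 * Real.pi / l * (l / (2 * Real.pi)) = 1 := by field_simp
  rw [this]
  simp

theorem measurable_cellKernel (hl : 0 < l) : Measurable fun q : ℝ × ℝ => cellKernel l q.1 q.2 := by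
  have h1 : Measurable fun r : ℤ × ℝ => cellAverage l r.1 r.2 := by
    apply measurable_from_prod_countable_right
    intro j
    exact (continuous_cellAverage hl j).measurable
  have h2 : Measurable fun q : ℝ × ℝ => (⌊q.1 / l⌋, q.2) :=
    (Int.measurable_floor.comp (measurable_fst.div_const l)).prodMk measurable_snd
  have h3 := h1.comp h2
  exact h3

/-- Moving to another cell multiplies the average by a phase. Hence momentum tails of `cellKernel`
are uniform in the electron position. -/
theorem norm_cellAverage (j : ℤ) (k : ℝ) :
    ‖cellAverage l j k‖ = ‖cellAverage l 0 k‖ := by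
  have h1 : ∀ j : ℤ, ∫ t in (j * l)..((j + 1) * l), planeWave t k
      = Complex.exp (Complex.I * k * (j * l : ℝ)) * ∫ t in (0:ℝ)..l, planeWave t k := by
    intro j
    have h2 := intervalIntegral.integral_comp_add_left (fun t => planeWave t k) (a := 0)
      (b := l) (j * l)
    rw [show (j + 1) * l = j * l + l by ring, ← intervalIntegral.integral_const_mul]
    rw [add_zero] at h2
    rw [← h2]
    refine intervalIntegral.integral_congr fun t _ => ?_
    simp only [planeWave]
    rw [← Complex.exp_add]
    congr 1
    push_cast
    ring
  have h3 : ∀ y : ℝ, ‖Complex.exp (Complex.I * k * y)‖ = 1 := fun y => norm_planeWave y k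
  rw [cellAverage, cellAverage, h1, h1, norm_mul, norm_mul, norm_mul, norm_mul, h3, h3]

theorem isKernel_cellKernel (hl : 0 < l) : IsKernel (cellKernel l) (2 * Real.pi / l) where
  measurable := measurable_cellKernel hl
  memLp x := memLp_cellAverage hl _
  bound x := by
    have h := integral_star_cellAverage_mul hl ⌊x / l⌋ ⌊x / l⌋
    have e : ∀ z : ℂ, z * star z = ((‖z‖ ^ 2 : ℝ) : ℂ) := fun z => by
      rw [RCLike.star_def, Complex.mul_conj']; push_cast; rfl
    simp_rw [e] at h
    rw [if_pos trivial, integral_complex_ofReal] at h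
    exact le_of_eq (by exact_mod_cast h)

theorem locallyIntegrable_cellKernel (hl : 0 < l) (k : ℝ) :
    LocallyIntegrable (fun x => cellKernel l x k) volume := by
  refine (locallyIntegrable_const ‖cellAverage l 0 k‖).mono
    ((measurable_cellKernel hl).comp (measurable_id.prodMk measurable_const)).aestronglyMeasurable
    (ae_of_all _ fun x => ?_)
  rw [norm_norm, cellKernel, norm_cellAverage]

theorem locallyIntegrable_planeWave_sub (hl : 0 < l) (k : ℝ) :
    LocallyIntegrable (fun x => planeWave x k - cellKernel l x k) volume :=
  (continuous_planeWave_left k).locallyIntegrable.sub (locallyIntegrable_cellKernel hl k)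

theorem integral_planeWave_sub_cellKernel (hl : 0 < l) (k : ℝ) {j : ℤ} {x : ℝ}
    (hx : x ∈ Set.Icc (j * l) ((j + 1) * l)) :
    ∫ t in (j * l)..x, (planeWave t k - cellKernel l t k)
      = (∫ t in (j * l)..x, planeWave t k) - ((x - j * l : ℝ) : ℂ) * cellAverage l j k := by
  rw [intervalIntegral.integral_sub ((continuous_planeWave_left k).intervalIntegrable _ _)
    ((locallyIntegrable_cellKernel hl k).intervalIntegrable' _ _)]
  congr 1
  have : ∫ t in (j * l)..x, cellKernel l t k = ∫ t in (j * l)..x, cellAverage l j k := by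
    rw [intervalIntegral.integral_of_le hx.1, intervalIntegral.integral_of_le hx.1,
      ← integral_Ico_eq_integral_Ioc, ← integral_Ico_eq_integral_Ioc]
    refine setIntegral_congr_fun measurableSet_Ico fun t ht => ?_
    simp only [cellKernel]
    rw [(mem_gridCell_iff hl).1 (show t ∈ gridCell l j from ⟨ht.1, ht.2.trans_le hx.2⟩)]
  rw [this]
  simp

/-- The error has mean zero on every cell, so the primitive does not accumulate from one cell to the
next. -/
theorem cellPrimitive_grid (hl : 0 < l) (k : ℝ) (j : ℤ) : cellPrimitive l (j * l) k = 0 := by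
  have hi := (locallyIntegrable_planeWave_sub hl k).intervalIntegrable'
  have hcell : ∀ j : ℤ, ∫ t in (j * l)..((j + 1) * l), (planeWave t k - cellKernel l t k) = 0 := by
    intro j
    rw [integral_planeWave_sub_cellKernel hl k (Set.right_mem_Icc.2 (cell_le hl j)), cellAverage]
    have hl' : (l : ℂ) ≠ 0 := by exact_mod_cast hl.ne'
    push_cast
    field_simp
    ring
  have hstep : ∀ j : ℤ, cellPrimitive l ((j + 1) * l) k = cellPrimitive l (j * l) k := by
    intro j
    rw [cellPrimitive, cellPrimitive,
      ← intervalIntegral.integral_add_adjacent_intervals (hi 0 (j * l)) (hi _ _), hcell, add_zero]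
  induction j using Int.induction_on with
  | zero => simp [cellPrimitive]
  | succ i ih =>
    have := hstep i
    push_cast at this ih ⊢
    rw [this, ih]
  | pred i ih =>
    have := hstep (-i - 1)
    push_cast at this ih ⊢
    rw [← this, ← ih]
    congr 1
    ring

/-- The function on the line with Fourier transform `cellPrimitive`. -/
noncomputable def cellProfile (l x : ℝ) (t : ℝ) : ℂ :=
  (Set.Ico (⌊x / l⌋ * l) x).indicator (fun _ => 1) t
    - ((x / l - ⌊x / l⌋ : ℝ) : ℂ) * (gridCell l ⌊x / l⌋).indicator (fun _ => 1) t

theorem integrable_cellProfile (l x : ℝ) : Integrable (cellProfile l x) :=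
  (indicator_Ico_integrable _ _).sub ((indicator_Ico_integrable _ _).const_mul _)

theorem memLp_cellProfile (l x : ℝ) : MemLp (cellProfile l x) 2 volume :=
  (indicator_Ico_memLp _ _).sub ((indicator_Ico_memLp _ _).const_mul _)

theorem norm_cellProfile_le (hl : 0 < l) (x t : ℝ) :
    ‖cellProfile l x t‖ ≤ (gridCell l ⌊x / l⌋).indicator (fun _ => 1) t := by
  have h0 := Int.floor_le (x / l)
  have h1 := (Int.lt_floor_add_one (x / l)).le
  have hx : x ∈ gridCell l ⌊x / l⌋ := (mem_gridCell_iff hl).2 rfl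
  by_cases ht : t ∈ gridCell l ⌊x / l⌋
  · by_cases ht2 : t ∈ Set.Ico (⌊x / l⌋ * l) x
    · simp only [cellProfile, Set.indicator_of_mem ht, Set.indicator_of_mem ht2]
      rw [mul_one, ← Complex.ofReal_one, ← Complex.ofReal_sub, Complex.norm_real, Real.norm_eq_abs,
        abs_le]
      constructor <;> linarith
    · simp only [cellProfile, Set.indicator_of_mem ht, Set.indicator_of_notMem ht2]
      rw [mul_one, zero_sub, norm_neg, Complex.norm_real, Real.norm_eq_abs, abs_le]
      constructor <;> linarith
  · have ht2 : t ∉ Set.Ico (⌊x / l⌋ * l) x := fun h => ht ⟨h.1, h.2.trans hx.2⟩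
    simp [cellProfile, ht, ht2]

theorem integral_norm_cellProfile_sq_le (hl : 0 < l) (x : ℝ) :
    ∫ t, ‖cellProfile l x t‖ ^ 2 ≤ l := by
  have hi : Integrable ((gridCell l ⌊x / l⌋).indicator fun _ => (1 : ℝ)) :=
    (integrable_indicator_iff measurableSet_Ico).2 (by simp)
  calc ∫ t, ‖cellProfile l x t‖ ^ 2
      ≤ ∫ t, (gridCell l ⌊x / l⌋).indicator (fun _ => (1 : ℝ)) t := by
        refine integral_mono (memLp_cellProfile l x).integrable_norm_sq hi fun t => ?_
        refine (pow_le_pow_left₀ (norm_nonneg _) (norm_cellProfile_le hl x t) 2).trans ?_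
        by_cases ht : t ∈ gridCell l ⌊x / l⌋ <;> simp [ht]
    _ = l := by
        rw [gridCell, integral_indicator measurableSet_Ico]
        simp [Measure.real, add_mul, hl.le]

/-- The primitive vanishes at the left end of the cell containing `x`, so only the integral from
there to `x` matters, and this is the conjugate transform of a function supported in that cell. -/
theorem cellPrimitive_eq (hl : 0 < l) (x k : ℝ) :
    cellPrimitive l x k = star (angularFourier (cellProfile l x) k) := by
  set j := ⌊x / l⌋ with hj
  have hx : x ∈ gridCell l j := (mem_gridCell_iff hl).2 rfl
  have hi := (locallyIntegrable_planeWave_sub hl k).intervalIntegrable'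
  have h1 : cellPrimitive l x k = ∫ t in (j * l)..x, (planeWave t k - cellKernel l t k) := by
    rw [cellPrimitive, ← intervalIntegral.integral_add_adjacent_intervals (hi 0 (j * l)) (hi _ _)]
    have := cellPrimitive_grid hl k j
    rw [cellPrimitive] at this
    rw [this, zero_add]
  rw [h1, integral_planeWave_sub_cellKernel hl k ⟨hx.1, hx.2.le⟩,
    ← star_angularFourier_indicator hx.1, cellAverage_eq hl]
  have hb : ∀ {u : ℝ → ℂ}, Integrable u →
      Integrable fun t : ℝ => Complex.exp (-(Complex.I * k * t)) * u t := fun hu =>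
    hu.bdd_mul (c := 1) (by fun_prop) (ae_of_all _ fun t => by
      rw [Complex.norm_exp]; simp)
  have h2 : angularFourier (cellProfile l x) k
      = angularFourier ((Set.Ico (j * l) x).indicator fun _ => 1) k
        - ((x / l - j : ℝ) : ℂ) * angularFourier ((gridCell l j).indicator fun _ => 1) k := by
    have hc : Integrable fun t : ℝ => Complex.exp (-(Complex.I * k * t)) *
      (gridCell l j).indicator (fun _ => 1) t := hb (indicator_Ico_integrable _ _)
    have hd : Integrable fun t : ℝ => Complex.exp (-(Complex.I * k * t)) *
      (Set.Ico (j * l) x).indicator (fun _ => 1) t := hb (indicator_Ico_integrable _ _)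
    rw [angularFourier, angularFourier, angularFourier, ← integral_const_mul,
      ← integral_sub hd (hc.const_mul _)]
    refine integral_congr_ae (ae_of_all _ fun t => ?_)
    simp only [cellProfile, ← hj]
    ring
  rw [h2, star_sub, star_mul', RCLike.star_def, Complex.conj_ofReal]
  congr 1
  rw [← mul_assoc, ← Complex.ofReal_mul]
  congr 2
  field_simp

/-- By Plancherel, since the profile is bounded by one and lives on one cell of length `l`. This
smallness in `l` makes the discretisation error small. -/
theorem isKernel_cellPrimitive (hl : 0 < l) : IsKernel (cellPrimitive l) (2 * Real.pi * l) where
  measurable := by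
    refine measurable_uncurry_of_continuous_of_measurable (u := cellPrimitive l) (fun k => ?_)
      fun x => ?_
    · exact intervalIntegral.continuous_primitive
        ((locallyIntegrable_planeWave_sub hl k).intervalIntegrable') 0
    · have : cellPrimitive l x = fun k => star (angularFourier (cellProfile l x) k) :=
        funext (cellPrimitive_eq hl x)
      rw [this]
      exact (continuous_angularFourier (integrable_cellProfile l x)).star.measurable
  memLp x := by
    have : cellPrimitive l x = fun k => star (angularFourier (cellProfile l x) k) :=
      funext (cellPrimitive_eq hl x)
    rw [this]
    exact (memLp_angularFourier (integrable_cellProfile l x) (memLp_cellProfile l x)).star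
  bound x := by
    simp_rw [cellPrimitive_eq hl, norm_star]
    rw [integral_norm_angularFourier_sq (integrable_cellProfile l x) (memLp_cellProfile l x)]
    exact mul_le_mul_of_nonneg_left (integral_norm_cellProfile_sq_le hl x) (by positivity)

end Cells

/-! ### Momentum cutoffs of form factors and their tails. -/

section Cutoff

variable {h : ℝ → ℝ → ℂ} {D : ℝ}

theorem measurable_momentumCutoff (hm : Measurable fun q : ℝ × ℝ => h q.1 q.2) (K : ℝ) :
    Measurable fun q : ℝ × ℝ => momentumCutoff K h q.1 q.2 := by
  have := hm.indicator (measurable_snd (measurableSet_Icc (a := -K) (b := K)) :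
    MeasurableSet ((Prod.snd : ℝ × ℝ → ℝ) ⁻¹' Set.Icc (-K) K))
  exact this

theorem norm_momentumCutoff_le (K x k : ℝ) : ‖momentumCutoff K h x k‖ ≤ ‖h x k‖ :=
  norm_indicator_le_norm_self _ _

theorem IsKernel.momentumCutoff (hh : IsKernel h D) (K : ℝ) :
    IsKernel (momentumCutoff K h) D where
  measurable := measurable_momentumCutoff hh.measurable K
  memLp x := (hh.memLp x).indicator measurableSet_Icc
  bound x := (integral_mono ((hh.memLp x).indicator measurableSet_Icc).integrable_norm_sq
    (hh.memLp x).integrable_norm_sq fun k =>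
      pow_le_pow_left₀ (norm_nonneg _) (norm_momentumCutoff_le K x k) 2).trans (hh.bound x)

theorem isKernel_momentumCutoff_of_norm_le {b : ℝ} (hm : Measurable fun q : ℝ × ℝ => h q.1 q.2)
    (hb : ∀ x k, ‖h x k‖ ≤ b) (K : ℝ) :
    IsKernel (momentumCutoff K h) (∫ k, (Set.Icc (-K) K).indicator (fun _ => b ^ 2) k) where
  measurable := measurable_momentumCutoff hm K
  memLp x := by
    have hm' : Measurable (momentumCutoff K h x) :=
      (measurable_momentumCutoff hm K).comp (measurable_const.prodMk measurable_id)
    refine (memLp_indicator_const (μ := volume) 2 (measurableSet_Icc (a := -K) (b := K)) b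
      (Or.inr (by simp))).mono hm'.aestronglyMeasurable (ae_of_all _ fun k => ?_)
    by_cases hk : k ∈ Set.Icc (-K) K
    · simpa [_root_.momentumCutoff, hk] using (hb x k).trans (le_abs_self b)
    · simp [_root_.momentumCutoff, hk]
  bound x := by
    refine integral_mono_of_nonneg (ae_of_all _ fun _ => sq_nonneg _)
      ((integrable_indicator_iff measurableSet_Icc).2 (by simp)) (ae_of_all _ fun k => ?_)
    by_cases hk : k ∈ Set.Icc (-K) K
    · simpa [_root_.momentumCutoff, hk] using pow_le_pow_left₀ (norm_nonneg _) (hb x k) 2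
    · simp [_root_.momentumCutoff, hk]

theorem IsKernel.tail (hh : IsKernel h D) (hn : ∀ x k, ‖h x k‖ = ‖h 0 k‖) (K : ℝ) :
    IsKernel (fun x k => h x k - _root_.momentumCutoff K h x k)
      (∫ k in (Set.Icc (-K) K)ᶜ, ‖h 0 k‖ ^ 2) where
  measurable := hh.measurable.sub (measurable_momentumCutoff hh.measurable K)
  memLp x := (hh.memLp x).sub ((hh.memLp x).indicator measurableSet_Icc)
  bound x := by
    rw [← integral_indicator measurableSet_Icc.compl]
    refine le_of_eq (integral_congr_ae (ae_of_all _ fun k => ?_))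
    by_cases hk : k ∈ Set.Icc (-K) K
    · simp [_root_.momentumCutoff, hk]
    · have hk' : k ∈ (Set.Icc (-K) K)ᶜ := hk
      simp only [Set.indicator_of_mem hk', _root_.momentumCutoff, Set.indicator_of_notMem hk, sub_zero]
      rw [hn]

theorem tendsto_integral_tail {F : ℝ → ℝ} (hF : Integrable F) :
    Tendsto (fun K => ∫ k in (Set.Icc (-K) K)ᶜ, F k) atTop (𝓝 0) := by
  have h1 : ∀ K, ∫ k in (Set.Icc (-K) K)ᶜ, F k = (∫ k, F k) - ∫ k in Set.Icc (-K) K, F k := fun K =>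
    setIntegral_compl measurableSet_Icc hF
  simp_rw [h1]
  have hc : AECover volume atTop fun K : ℝ => Set.Icc (-K) K :=
    aecover_Icc tendsto_neg_atTop_atBot tendsto_id
  have := (hc.integral_tendsto_of_countably_generated hF).const_sub (∫ k, F k)
  simpa using this

end Cutoff

/-! ### The cost of replacing plane waves by cell averages. -/

namespace PolaronState

variable (Ψ : PolaronState)

theorem annihilation_eq_interaction (K : ℝ) :
    Ψ.annihilation K = Ψ.interaction (momentumCutoff K planeWave) := by
  refine tsum_congr fun n => ?_
  rw [coupling, ← integral_const_mul]
  refine integral_congr_ae (ae_of_all _ fun p => ?_)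
  simp only
  rw [mul_left_comm, ← integral_const_mul (Real.sqrt (n + 1) : ℂ),
    ← integral_indicator measurableSet_Icc]
  refine congrArg (star (Ψ.ψ n p) * ·) (integral_congr_ae (ae_of_all _ fun k => ?_))
  by_cases hk : k ∈ Set.Icc (-K) K
  · simp only [momentumCutoff, Set.indicator_of_mem hk, planeWave]; ring
  · simp [momentumCutoff, hk]

/-- Replacing the plane waves by their averages over cells of width `l`. -/
theorem cell_energy_le {α : ℝ} (hα : 0 < α) {V : ℝ → ℝ} {E : ℝ} (hE : Ψ.HasEnergy α V E) {l : ℝ}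
    (hl : 0 < l) :
    Ψ.kinetic + Ψ.number - Real.sqrt (α / (2 * Real.pi)) * (2 * (Ψ.interaction (cellKernel l)).re)
      - α ^ 2 * (Ψ.potential fun x => V (α * x))
      - 2 * Real.sqrt (α * l) * (Real.sqrt Ψ.kinetic * Real.sqrt Ψ.number
        + Real.sqrt (Ψ.number + Ψ.normSq) * Real.sqrt Ψ.kinetic) ≤ E := by
  set Q := Real.sqrt Ψ.kinetic * Real.sqrt Ψ.number
        + Real.sqrt (Ψ.number + Ψ.normSq) * Real.sqrt Ψ.kinetic with hQ
  have hcell := isKernel_cellKernel hl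
  have hnorm : ∀ x k, ‖cellKernel l x k‖ = ‖cellKernel l 0 k‖ := fun x k => by
    rw [cellKernel, cellKernel, norm_cellAverage, norm_cellAverage ⌊0 / l⌋]
  set τ : ℝ → ℝ := fun K => ∫ k in (Set.Icc (-K) K)ᶜ, ‖cellKernel l 0 k‖ ^ 2 with hτ
  have hτ0 : Tendsto τ atTop (𝓝 0) := tendsto_integral_tail (hcell.memLp 0).integrable_norm_sq
  -- The cut-off plane wave is the full cell kernel, minus its momentum tail, plus the cut-off
  -- difference. The tail vanishes as `K` grows; integration by parts bounds the difference
  -- uniformly in `K`.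
  have key : ∀ K, (Ψ.annihilation K).re ≤ (Ψ.interaction (cellKernel l)).re
      + Real.sqrt (τ K) * (Real.sqrt Ψ.normSq * Real.sqrt Ψ.number)
      + Real.sqrt (2 * Real.pi * l) * Q := by
    intro K
    have k1 : IsKernel (momentumCutoff K planeWave) _ :=
      isKernel_momentumCutoff_of_norm_le (b := 1) continuous_planeWave.measurable
        (fun x k => (norm_planeWave x k).le) K
    have k2 := hcell.momentumCutoff K
    have hpm : Measurable fun q : ℝ × ℝ => planeWave q.1 q.2 - cellKernel l q.1 q.2 :=
      continuous_planeWave.measurable.sub (measurable_cellKernel hl)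
    have hc1 : ∀ x k, ‖cellKernel l x k‖ ≤ 1 := by
      intro x k
      rw [cellKernel, cellAverage, norm_mul, Complex.norm_real, Real.norm_of_nonneg (by positivity)]
      have := intervalIntegral.norm_integral_le_of_norm_le_const (a := ⌊x / l⌋ * l)
        (b := (⌊x / l⌋ + 1) * l) (f := fun t => planeWave t k) (C := 1)
        fun t _ => (norm_planeWave t k).le
      rw [show (⌊x / l⌋ + 1) * l - ⌊x / l⌋ * l = l by ring, abs_of_pos hl, one_mul] at this
      calc _ ≤ l⁻¹ * l := mul_le_mul_of_nonneg_left this (by positivity)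
        _ = 1 := inv_mul_cancel₀ hl.ne'
    have k3 : IsKernel (momentumCutoff K fun x k => planeWave x k - cellKernel l x k) _ :=
      isKernel_momentumCutoff_of_norm_le (b := 1 + 1) hpm (fun x k => (norm_sub_le _ _).trans
        (add_le_add (norm_planeWave x k).le (hc1 x k))) K
    have k4 := hcell.tail hnorm K
    have e1 := Ψ.interaction_sub k1 k2 k3 fun x k => by
      by_cases hk : k ∈ Set.Icc (-K) K <;> simp [momentumCutoff, hk]
    have e2 := Ψ.interaction_sub hcell k2 k4 fun x k => rfl
    have b1 := Ψ.norm_interaction_le_of_isPrimitive k3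
      ((isKernel_cellPrimitive hl).momentumCutoff K) (fun k => by
        by_cases hk : k ∈ Set.Icc (-K) K
        · simp only [momentumCutoff, Set.indicator_of_mem hk]
          exact ⟨0, ae_of_all _ fun x => by simp [cellPrimitive]⟩
        · simp only [momentumCutoff, Set.indicator_of_notMem hk]
          exact ⟨0, ae_of_all _ fun x => by simp⟩) (fun k => by
        by_cases hk : k ∈ Set.Icc (-K) K
        · simp only [momentumCutoff, Set.indicator_of_mem hk]
          exact locallyIntegrable_planeWave_sub hl k
        · simp only [momentumCutoff, Set.indicator_of_notMem hk]
          exact locallyIntegrable_const 0)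
    have b2 := (Ψ.norm_interaction_le k4).2
    have e3 : Ψ.annihilation K = Ψ.interaction (cellKernel l)
        - Ψ.interaction (fun x k => cellKernel l x k - momentumCutoff K (cellKernel l) x k)
        + Ψ.interaction (momentumCutoff K fun x k => planeWave x k - cellKernel l x k) := by
      rw [annihilation_eq_interaction, e1, e2]; ring
    rw [e3, Complex.add_re, Complex.sub_re]
    have c1 := (Complex.abs_re_le_norm _).trans b1
    have c2 := (Complex.abs_re_le_norm _).trans b2
    have c3 := (abs_le.1 c2).1
    have c4 := (abs_le.1 c1).2
    linarith
  have hs : Real.sqrt (α / (2 * Real.pi)) * Real.sqrt (2 * Real.pi * l) = Real.sqrt (α * l) := by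
    rw [← Real.sqrt_mul (by positivity)]
    congr 1
    field_simp
  have hlim : Tendsto (fun K => Ψ.kinetic + Ψ.number - Real.sqrt (α / (2 * Real.pi)) *
      (2 * ((Ψ.interaction (cellKernel l)).re
      + Real.sqrt (τ K) * (Real.sqrt Ψ.normSq * Real.sqrt Ψ.number)
      + Real.sqrt (2 * Real.pi * l) * Q)) - α ^ 2 * (Ψ.potential fun x => V (α * x))) atTop
      (𝓝 (Ψ.kinetic + Ψ.number - Real.sqrt (α / (2 * Real.pi)) *
      (2 * ((Ψ.interaction (cellKernel l)).re
      + Real.sqrt 0 * (Real.sqrt Ψ.normSq * Real.sqrt Ψ.number)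
      + Real.sqrt (2 * Real.pi * l) * Q)) - α ^ 2 * (Ψ.potential fun x => V (α * x)))) :=
    ((((((hτ0.sqrt.mul_const _).const_add _).add_const _).const_mul 2).const_mul _).const_sub
      _).sub_const _
  have h := le_of_tendsto_of_tendsto' hlim hE fun K => by
    unfold cutoffEnergy
    have := mul_le_mul_of_nonneg_left (key K) (Real.sqrt_nonneg (α / (2 * Real.pi)))
    linarith
  rw [Real.sqrt_zero, zero_mul, add_zero] at h
  refine le_trans (le_of_eq ?_) h
  rw [← hs]
  ring

end PolaronState

/-! ### Multiplication by functions of the electron position. -/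

section Multiplication

variable {n : ℕ} {f g : PolaronConfig n → ℂ} {χ : ℝ → ℝ}

theorem MeasureTheory.MemLp.electron_mul {b : ℝ} (hf : MemLp f 2 volume) (hχ : Continuous χ)
    (hb : ∀ x, ‖χ x‖ ≤ b) : MemLp (fun p => (χ p.1 : ℂ) * f p) 2 volume := by
  refine hf.of_le_mul (c := b) ((Complex.continuous_ofReal.comp
    (hχ.comp continuous_fst)).aestronglyMeasurable.mul hf.1) (ae_of_all _ fun p => ?_)
  rw [norm_mul, Complex.norm_real]
  exact mul_le_mul_of_nonneg_right (hb _) (norm_nonneg _)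

/-- Use `φ χ` as a test function for `f` and expand its derivative. -/
theorem IsWeakElectronDeriv.electron_mul (hw : IsWeakElectronDeriv f g) (hf : MemLp f 2 volume)
    (hg : MemLp g 2 volume) (hχ : ContDiff ℝ ∞ χ) :
    IsWeakElectronDeriv (fun p => (χ p.1 : ℂ) * f p)
      (fun p => ((deriv χ p.1 : ℝ) : ℂ) * f p + (χ p.1 : ℂ) * g p) := by
  intro φ hφ hφc
  have hfl : LocallyIntegrable f volume := hf.locallyIntegrable (by norm_num)
  have hgl : LocallyIntegrable g volume := hg.locallyIntegrable (by norm_num)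
  have hχ1 : ContDiff ℝ ∞ fun p : PolaronConfig n => χ p.1 := hχ.comp contDiff_fst
  have hdχ : Continuous (deriv χ) := hχ.continuous_deriv (by norm_num)
  have h := hw (fun p => φ p * χ p.1) (hφ.mul hχ1) hφc.mul_right
  have hd : ∀ p : PolaronConfig n, fderiv ℝ (fun p => φ p * χ p.1) p (1, 0)
      = fderiv ℝ φ p (1, 0) * χ p.1 + φ p * deriv χ p.1 := by
    intro p
    have h1 : HasFDerivAt φ (fderiv ℝ φ p) p :=
      (hφ.differentiable (by norm_num) p).hasFDerivAt
    have h2 : HasFDerivAt (fun p : PolaronConfig n => χ p.1)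
        ((ContinuousLinearMap.toSpanSingleton ℝ (deriv χ p.1)).comp (ContinuousLinearMap.fst ℝ ℝ (Fin n → ℝ))) p :=
      ((hχ.differentiable (by norm_num) p.1).hasDerivAt.hasFDerivAt).comp p hasFDerivAt_fst
    have h3 := h1.fun_mul h2
    rw [h3.fderiv]
    simp
    ring
  have c1 : Continuous fun p : PolaronConfig n => fderiv ℝ φ p (1, 0) :=
    (hφ.continuous_fderiv (by norm_num)).clm_apply continuous_const
  have s1 : HasCompactSupport fun p : PolaronConfig n => fderiv ℝ φ p (1, 0) :=
    hφc.fderiv_apply (𝕜 := ℝ) (1, 0)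
  have cχ : Continuous fun p : PolaronConfig n => χ p.1 := hχ1.continuous
  have cdχ : Continuous fun p : PolaronConfig n => deriv χ p.1 := hdχ.comp continuous_fst
  have i1 : Integrable fun p : PolaronConfig n => (fderiv ℝ φ p (1, 0) * χ p.1) • f p :=
    hfl.integrable_smul_left_of_hasCompactSupport (c1.mul cχ) s1.mul_right
  have i2 : Integrable fun p : PolaronConfig n => (φ p * deriv χ p.1) • f p :=
    hfl.integrable_smul_left_of_hasCompactSupport (hφ.continuous.mul cdχ) hφc.mul_right
  have i3 : Integrable fun p : PolaronConfig n => (φ p * χ p.1) • g p :=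
    hgl.integrable_smul_left_of_hasCompactSupport (hφ.continuous.mul cχ) hφc.mul_right
  simp_rw [hd, add_smul] at h
  rw [integral_add i1 i2] at h
  have e1 : ∫ p : PolaronConfig n, fderiv ℝ φ p (1, 0) • ((χ p.1 : ℂ) * f p)
      = ∫ p : PolaronConfig n, (fderiv ℝ φ p (1, 0) * χ p.1) • f p := by
    refine integral_congr_ae (ae_of_all _ fun p => ?_)
    simp only [Complex.real_smul]; push_cast; ring
  have e2 : ∫ p : PolaronConfig n, φ p • (((deriv χ p.1 : ℝ) : ℂ) * f p + (χ p.1 : ℂ) * g p)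
      = (∫ p : PolaronConfig n, (φ p * deriv χ p.1) • f p)
        + ∫ p : PolaronConfig n, (φ p * χ p.1) • g p := by
    rw [← integral_add i2 i3]
    refine integral_congr_ae (ae_of_all _ fun p => ?_)
    simp only [Complex.real_smul]; push_cast; ring
  rw [e1, e2, neg_add]
  rw [← h]
  ring

end Multiplication

/-! ### Averages over translates, and smooth windows. -/

section Average

/-- `f` is integrable with integral `c`. -/
def HasTotal (f : ℝ → ℝ) (c : ℝ) : Prop := Integrable f ∧ ∫ x, f x = c

variable {f g : ℝ → ℝ} {c d : ℝ}

theorem HasTotal.add (hf : HasTotal f c) (hg : HasTotal g d) :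
    HasTotal (fun x => f x + g x) (c + d) :=
  ⟨hf.1.add hg.1, by rw [integral_add hf.1 hg.1, hf.2, hg.2]⟩

theorem HasTotal.sub (hf : HasTotal f c) (hg : HasTotal g d) :
    HasTotal (fun x => f x - g x) (c - d) :=
  ⟨hf.1.sub hg.1, by rw [integral_sub hf.1 hg.1, hf.2, hg.2]⟩

theorem HasTotal.const_mul (hf : HasTotal f c) (a : ℝ) : HasTotal (fun x => a * f x) (a * c) :=
  ⟨hf.1.const_mul a, by rw [integral_const_mul, hf.2]⟩

theorem HasTotal.sum {ι : Type*} {s : Finset ι} {F : ι → ℝ → ℝ} {C : ι → ℝ}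
    (h : ∀ i ∈ s, HasTotal (F i) (C i)) : HasTotal (fun x => ∑ i ∈ s, F i x) (∑ i ∈ s, C i) :=
  ⟨integrable_finsetSum _ fun i hi => (h i hi).1, by
    rw [integral_finsetSum _ fun i hi => (h i hi).1]
    exact Finset.sum_congr rfl fun i hi => (h i hi).2⟩

theorem HasTotal.mono (hf : HasTotal f c) (hg : HasTotal g d) (h : ∀ x, f x ≤ g x) : c ≤ d := by
  rw [← hf.2, ← hg.2]
  exact integral_mono hf.1 hg.1 h

/-- The average of a function of the electron position and further variables over all translates
of a window. -/
theorem hasTotal_window {n : ℕ} {w : ℝ → ℝ} (hwc : Continuous w) (hw : Integrable w)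
    {F : PolaronConfig n → ℝ} (hF : Integrable F) :
    HasTotal (fun y => ∫ p : PolaronConfig n, w (p.1 - y) * F p) ((∫ x, w x) * ∫ p, F p) := by
  have hm : AEStronglyMeasurable (fun q : PolaronConfig n × ℝ => w (q.1.1 - q.2) * F q.1)
      (volume.prod volume) :=
    (hwc.comp (continuous_fst.fst.sub continuous_snd)).aestronglyMeasurable.mul hF.1.comp_fst
  have hi : Integrable (fun q : PolaronConfig n × ℝ => w (q.1.1 - q.2) * F q.1)
      (volume.prod volume) := by
    rw [integrable_prod_iff hm]
    constructor
    · exact ae_of_all _ fun p => (hw.comp_sub_left p.1).mul_const (F p)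
    · simp only [norm_mul]
      have : ∀ p : PolaronConfig n, ∫ y, ‖w (p.1 - y)‖ * ‖F p‖ = (∫ x, ‖w x‖) * ‖F p‖ := by
        intro p
        rw [integral_mul_const, integral_sub_left_eq_self (fun x => ‖w x‖) volume p.1]
      simp_rw [this]
      exact hF.norm.const_mul _
  refine ⟨hi.integral_prod_right, ?_⟩
  rw [← integral_prod_symm _ hi, integral_prod _ hi]
  have : ∀ p : PolaronConfig n, ∫ y, w (p.1 - y) * F p = (∫ x, w x) * F p := by
    intro p
    rw [integral_mul_const, integral_sub_left_eq_self w volume p.1]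
  simp_rw [this]
  rw [integral_const_mul]

end Average

/-- A smooth window of width `R`. -/
structure IsWindow (χ : ℝ → ℝ) (R D : ℝ) : Prop where
  contDiff : ContDiff ℝ ∞ χ
  eq_zero : ∀ x, R < |x| → χ x = 0
  integral_sq : ∫ x, χ x ^ 2 = 1
  integral_deriv_sq : ∫ x, deriv χ x ^ 2 = D

/-- Rescale one bump to `(mR)^(-1/2) η(x/R)` with `m = ∫ η²`; the constant `∫ η'² / m` does not
depend on `R`. -/
theorem exists_isWindow : ∃ D : ℝ, 0 ≤ D ∧ ∀ R : ℝ, 0 < R → ∃ χ : ℝ → ℝ, IsWindow χ R (D / R ^ 2) := by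
  let η : ContDiffBump (0 : ℝ) := ⟨1 / 2, 1, by norm_num, by norm_num⟩
  have hη0 : ∀ x, 1 < |x| → η x = 0 := fun x hx => η.zero_of_le_dist (by
    rw [dist_zero_right, Real.norm_eq_abs]; exact hx.le)
  have hηs : ContDiff ℝ ∞ η := η.contDiff
  have hηc : HasCompactSupport η := η.hasCompactSupport
  set m := ∫ x, η x ^ 2 with hm
  have hmpos : 0 < m := by
    refine (hηs.continuous.pow 2).integral_pos_of_hasCompactSupport_nonneg_nonzero ?_
      (fun x => sq_nonneg _) (x := 0) ?_
    · exact hηc.comp_left (g := fun x => x ^ 2) (by simp)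
    · have : η 0 = 1 := η.one_of_mem_closedBall (by simp [η])
      simp [this]
  refine ⟨(∫ x, deriv η x ^ 2) / m, div_nonneg (integral_nonneg fun _ => sq_nonneg _) hmpos.le,
    fun R hR => ?_⟩
  set c := Real.sqrt (1 / (m * R)) with hc
  have hc2 : c ^ 2 = 1 / (m * R) := Real.sq_sqrt (by positivity)
  refine ⟨fun x => c * η (R⁻¹ * x), ?_, ?_, ?_, ?_⟩
  · exact contDiff_const.mul (hηs.comp (contDiff_const.mul contDiff_id))
  · intro x hx
    rw [hη0, mul_zero]
    rw [abs_mul, abs_of_pos (inv_pos.2 hR), ← div_eq_inv_mul, lt_div_iff₀ hR]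
    linarith
  · simp_rw [mul_pow]
    rw [integral_const_mul, Measure.integral_comp_mul_left (fun x => η x ^ 2), inv_inv,
      abs_of_pos hR, hc2, smul_eq_mul, ← hm]
    field_simp
  · have hd : ∀ x, deriv (fun x => c * η (R⁻¹ * x)) x = c * R⁻¹ * deriv η (R⁻¹ * x) := by
      intro x
      have h1 : HasDerivAt η (deriv η (R⁻¹ * x)) (R⁻¹ * x) :=
        (hηs.differentiable (by norm_num) _).hasDerivAt
      have h2 := (h1.comp x ((hasDerivAt_id x).const_mul R⁻¹)).const_mul c
      refine HasDerivAt.deriv (h2.congr_deriv ?_)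
      ring
    simp_rw [hd, mul_pow]
    rw [integral_const_mul, Measure.integral_comp_mul_left (fun x => deriv η x ^ 2), inv_inv,
      abs_of_pos hR, hc2, smul_eq_mul]
    field_simp

namespace IsWindow

variable {χ : ℝ → ℝ} {R D : ℝ}

theorem hasCompactSupport (h : IsWindow χ R D) : HasCompactSupport χ :=
  HasCompactSupport.intro (isCompact_Icc (a := -R) (b := R)) fun x hx => h.eq_zero x (by
    rw [Set.mem_Icc, ← abs_le] at hx
    exact not_le.1 hx)

/-- `χχ'` is half the derivative of the compactly supported `χ²`. It removes the cross term of the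
localised kinetic energy after averaging. -/
theorem integral_mul_deriv (h : IsWindow χ R D) : ∫ x, χ x * deriv χ x = 0 := by
  have hc := h.contDiff.continuous
  have hdc : Continuous (deriv χ) := h.contDiff.continuous_deriv (by norm_num)
  have hp : IsPrimitive χ (deriv χ) := (h.contDiff.of_le (by norm_num)).isPrimitive
  have hp2 := hp.mul hp hdc.locallyIntegrable hdc.locallyIntegrable
  have i1 : Integrable fun x => χ x * χ x :=
    (hc.mul hc).integrable_of_hasCompactSupport h.hasCompactSupport.mul_right
  have i2 : Integrable fun x => χ x * deriv χ x :=
    (hc.mul hdc).integrable_of_hasCompactSupport h.hasCompactSupport.mul_right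
  have i3 : Integrable fun x => deriv χ x * χ x := by simpa only [mul_comm] using i2
  have h0 := hp2.integral_eq_zero i1 (i3.add i2)
  rw [integral_add i3 i2] at h0
  have e : ∫ x, deriv χ x * χ x = ∫ x, χ x * deriv χ x := by simp only [mul_comm]
  linarith

end IsWindow

theorem annihilate_electron_mul {n : ℕ} (F : ℝ → ℂ) (χ : ℝ → ℝ) (u : PolaronConfig (n + 1) → ℂ)
    (p : PolaronConfig n) :
    annihilate F (fun p => (χ p.1 : ℂ) * u p) p = (χ p.1 : ℂ) * annihilate F u p := by
  simp only [annihilate, contract]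
  rw [← integral_const_mul]
  refine integral_congr_ae (ae_of_all _ fun k => ?_)
  simp only
  ring

theorem sqrt_mul_annihilate_cellMode {n : ℕ} {l : ℝ} (hl : 0 < l) (j : ℤ)
    (u : PolaronConfig (n + 1) → ℂ) (p : PolaronConfig n) :
    (Real.sqrt (2 * Real.pi / l) : ℂ) * annihilate (cellMode l j) u p
      = ∫ k, cellAverage l j k * u (p.1, Fin.cons k p.2) := by
  simp only [annihilate, contract]
  rw [← integral_const_mul]
  refine integral_congr_ae (ae_of_all _ fun k => ?_)
  simp only
  rw [star_cellMode hl]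
  ring

theorem norm_sq_add_real_mul (a b : ℝ) (u v : ℂ) : ‖(b : ℂ) * u + (a : ℂ) * v‖ ^ 2
    = a ^ 2 * ‖v‖ ^ 2 + 2 * (a * b) * (star u * v).re + b ^ 2 * ‖u‖ ^ 2 := by
  simp only [Complex.norm_sq_eq_re_sq_add_im_sq]
  simp
  ring

/-- The cells that meet a window. -/
theorem exists_cell_of_mem_window {l : ℝ} (hl : 0 < l) {R : ℝ} {x y : ℝ} (hx : |x - y| ≤ R) :
    ∃ i : Fin (⌊2 * R / l⌋₊ + 2), ⌊x / l⌋ = ⌊(y - R) / l⌋ + (i : ℕ) := by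
  have h1 := abs_le.1 hx
  have hR : 0 ≤ R := (abs_nonneg _).trans hx
  have h2 : ⌊(y - R) / l⌋ ≤ ⌊x / l⌋ := Int.floor_le_floor (by gcongr; linarith)
  -- The window has length `2R` and need not align with the grid, so the index differences run from
  -- `0` to at most `⌊2R/l⌋ + 1`.
  have h3 : ⌊x / l⌋ < ⌊(y - R) / l⌋ + (⌊2 * R / l⌋₊ + 2 : ℕ) := by
    rw [Int.floor_lt]
    have a1 := Int.lt_floor_add_one ((y - R) / l)
    have a2 := Nat.lt_floor_add_one (2 * R / l)
    have a3 : x / l ≤ (y - R) / l + 2 * R / l := by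
      rw [← add_div]; gcongr; linarith
    push_cast
    linarith
  obtain ⟨m, hm⟩ := Int.eq_ofNat_of_zero_le (sub_nonneg.2 h2)
  refine ⟨⟨m, by omega⟩, ?_⟩
  simp only
  omega

/-! ### Localisation of the electron and the Pekar bound for one window. -/

namespace PolaronState

variable (Ψ : PolaronState)

/-- The Pekar lower bound for a state that is localised in a window. -/
theorem window_lower_bound {V : ℝ → ℝ} {B : ℝ} (hVm : Continuous V)
    (hV0 : ∀ x, 0 ≤ V x) (hVB : ∀ x, V x ≤ B) {k : ℝ} (hk : 1 / 2 ≤ k) (hk1 : k ≤ 1) {α : ℝ}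
    (hα : 0 < α) {l : ℝ} (hl : 0 < l) {χ : ℝ → ℝ} {R D : ℝ} (hχ : IsWindow χ R D) (N : ℕ) (y : ℝ) :
    (α ^ 2 * (pekarEnergy V - pekarStability V B * (1 - k)) - k / 2 * (⌊2 * R / l⌋₊ + 2 : ℕ))
        * (∑ n ∈ Finset.range (N + 1), ∫ p, χ (p.1 - y) ^ 2 * ‖Ψ.ψ n p‖ ^ 2)
      ≤ k * (∑ n ∈ Finset.range (N + 1), ((∫ p, χ (p.1 - y) ^ 2 * ‖Ψ.dψ n p‖ ^ 2)
          + (∫ p, 2 * (χ (p.1 - y) * deriv χ (p.1 - y)) * (star (Ψ.ψ n p) * Ψ.dψ n p).re)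
          + ∫ p, deriv χ (p.1 - y) ^ 2 * ‖Ψ.ψ n p‖ ^ 2))
        + k * (∑ n ∈ Finset.range (N + 1), (n : ℝ) * ∫ p, χ (p.1 - y) ^ 2 * ‖Ψ.ψ n p‖ ^ 2)
        - α ^ 2 * (∑ n ∈ Finset.range (N + 1),
            ∫ p, χ (p.1 - y) ^ 2 * (V (α * p.1) * ‖Ψ.ψ n p‖ ^ 2))
        - Real.sqrt (α / (2 * Real.pi)) * (2 * ∑ n ∈ Finset.range N, Real.sqrt (n + 1) *
          ∫ p : PolaronConfig n, χ (p.1 - y) ^ 2 * (star (Ψ.ψ n p) *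
            ∫ k, cellKernel l p.1 k * Ψ.ψ (n + 1) (p.1, Fin.cons k p.2)).re) := by
  set c : ℝ → ℝ := fun x => χ (x - y) with hc
  have hcs : ContDiff ℝ ∞ c := hχ.contDiff.comp (contDiff_id.sub contDiff_const)
  have hdc : deriv c = fun x => deriv χ (x - y) := by
    ext x
    exact deriv_comp_sub_const χ y x
  have hχc := hχ.contDiff.continuous
  have hdχc : Continuous (deriv χ) := hχ.contDiff.continuous_deriv (by norm_num)
  obtain ⟨b, hb⟩ := hχ.hasCompactSupport.exists_bound_of_continuous hχc
  obtain ⟨d, hd⟩ := hχ.hasCompactSupport.deriv.exists_bound_of_continuous hdχc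
  have hcb : ∀ x, ‖c x‖ ≤ b := fun x => hb _
  have hdcb : ∀ x, ‖deriv c x‖ ≤ d := fun x => by rw [hdc]; exact hd _
  have hdcc : Continuous (deriv c) := hcs.continuous_deriv (by norm_num)
  set u : (n : ℕ) → PolaronConfig n → ℂ := fun n p => (c p.1 : ℂ) * Ψ.ψ n p with hu
  set du : (n : ℕ) → PolaronConfig n → ℂ := fun n p =>
    ((deriv c p.1 : ℝ) : ℂ) * Ψ.ψ n p + (c p.1 : ℂ) * Ψ.dψ n p with hdu
  have mu : ∀ n, MemLp (u n) 2 volume := fun n => (Ψ.memLp_ψ n).electron_mul hcs.continuous hcb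
  have mdu : ∀ n, MemLp (du n) 2 volume := fun n =>
    ((Ψ.memLp_ψ n).electron_mul hdcc hdcb).add ((Ψ.memLp_dψ n).electron_mul hcs.continuous hcb)
  -- The leftmost cell that can meet the window.
  set j₀ := ⌊(y - R) / l⌋ with hj₀
  have key := mode_lower_bound hVm hV0 hVB hk hk1 hα mu mdu (fun n σ => by
      filter_upwards [Ψ.symm n σ] with p hp
      simp only [hu, hp]) (fun n => ((Ψ.weakDeriv n).electron_mul (Ψ.memLp_ψ n) (Ψ.memLp_dψ n)
        hcs).shift (mu n) (mdu n)) N (M := ⌊2 * R / l⌋₊ + 2)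
    (fun i => cellMode l (j₀ + (i : ℕ))) (fun i => memLp_cellMode hl _) (fun i j => by
      rw [integral_star_cellMode_mul hl]
      simp [Fin.ext_iff]) (fun i => gridCell l (j₀ + (i : ℕ))) (fun i => measurableSet_Ico)
    (fun i j hij => Set.disjoint_left.2 fun x hx hx' => hij (by
      have h := ((mem_gridCell_iff hl).1 hx).symm.trans ((mem_gridCell_iff hl).1 hx')
      ext
      omega)) hl (fun i => by
      rw [gridCell, Real.volume_Ico, ← sub_mul]; simp)
  have e1 : ∀ n, ∫ p, ‖u n p‖ ^ 2 = ∫ p, χ (p.1 - y) ^ 2 * ‖Ψ.ψ n p‖ ^ 2 := fun n => by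
    refine integral_congr_ae (ae_of_all _ fun p => ?_)
    simp only [hu, norm_mul, Complex.norm_real, mul_pow, Real.norm_eq_abs, sq_abs, hc]
  have e2 : ∀ n, ∫ p, V (α * p.1) * ‖u n p‖ ^ 2
      = ∫ p, χ (p.1 - y) ^ 2 * (V (α * p.1) * ‖Ψ.ψ n p‖ ^ 2) := fun n => by
    refine integral_congr_ae (ae_of_all _ fun p => ?_)
    simp only [hu, norm_mul, Complex.norm_real, mul_pow, Real.norm_eq_abs, sq_abs, hc]
    ring
  have bdd : ∀ {n : ℕ} {w : ℝ → ℝ} {F : PolaronConfig n → ℝ} {b : ℝ}, Continuous w →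
      (∀ x, ‖w x‖ ≤ b) → Integrable F → Integrable fun p => w (p.1 - y) * F p := by
    intro n w F b hw hwb hF
    exact hF.bdd_mul (c := b) (hw.comp (continuous_fst.sub continuous_const)).aestronglyMeasurable
      (ae_of_all _ fun p => hwb _)
  have hχ2b : ∀ x, ‖χ x ^ 2‖ ≤ b ^ 2 := fun x => by
    rw [norm_pow]; exact pow_le_pow_left₀ (norm_nonneg _) (hb x) 2
  have e3 : ∀ n, ∫ p, ‖du n p‖ ^ 2 = (∫ p, χ (p.1 - y) ^ 2 * ‖Ψ.dψ n p‖ ^ 2)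
          + (∫ p, 2 * (χ (p.1 - y) * deriv χ (p.1 - y)) * (star (Ψ.ψ n p) * Ψ.dψ n p).re)
          + ∫ p, deriv χ (p.1 - y) ^ 2 * ‖Ψ.ψ n p‖ ^ 2 := fun n => by
    have i0 : Integrable (fun p => (star (Ψ.ψ n p) * Ψ.dψ n p)) :=
      (Ψ.memLp_ψ n).star.integrable_mul (Ψ.memLp_dψ n)
    have i1 : Integrable (fun p => χ (p.1 - y) ^ 2 * ‖Ψ.dψ n p‖ ^ 2) :=
      bdd (w := fun x => χ x ^ 2) (hχc.pow 2) hχ2b (Ψ.memLp_dψ n).integrable_norm_sq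
    have i2 : Integrable (fun p => 2 * (χ (p.1 - y) * deriv χ (p.1 - y)) *
        (star (Ψ.ψ n p) * Ψ.dψ n p).re) :=
      bdd (w := fun x => 2 * (χ x * deriv χ x)) (b := 2 * (b * d))
        (continuous_const.mul (hχc.mul hdχc)) (fun x => by
          rw [norm_mul, norm_mul, Real.norm_ofNat]
          exact mul_le_mul_of_nonneg_left (mul_le_mul (hb x) (hd x) (norm_nonneg _)
            ((norm_nonneg _).trans (hb x))) (by norm_num)) i0.re
    have i3 : Integrable (fun p => deriv χ (p.1 - y) ^ 2 * ‖Ψ.ψ n p‖ ^ 2) :=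
      bdd (w := fun x => deriv χ x ^ 2) (b := d ^ 2) (hdχc.pow 2) (fun x => by
        rw [norm_pow]; exact pow_le_pow_left₀ (norm_nonneg _) (hd x) 2)
        (Ψ.memLp_ψ n).integrable_norm_sq
    have i12 : Integrable (fun p => χ (p.1 - y) ^ 2 * ‖Ψ.dψ n p‖ ^ 2 +
      2 * (χ (p.1 - y) * deriv χ (p.1 - y)) * (star (Ψ.ψ n p) * Ψ.dψ n p).re) := i1.add i2
    rw [← integral_add i1 i2, ← integral_add i12 i3]
    refine integral_congr_ae (ae_of_all _ fun p => ?_)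
    simp only [hdu, hdc]
    rw [norm_sq_add_real_mul]
  -- On the support of the window exactly one selected cell contains the electron, so the sum of the
  -- cell couplings rebuilds `cellKernel`; off the support both sides vanish.
  have e4 : ∀ n : ℕ, ∑ i : Fin (⌊2 * R / l⌋₊ + 2), Real.sqrt (2 * Real.pi / l) *
      (∫ p : PolaronConfig n, (gridCell l (j₀ + (i : ℕ))).indicator (fun _ => (1 : ℂ)) p.1 *
            (star (u n p) * annihilate (cellMode l (j₀ + (i : ℕ))) (u (n + 1)) p)).re
      = ∫ p : PolaronConfig n, χ (p.1 - y) ^ 2 * (star (Ψ.ψ n p) *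
            ∫ k, cellKernel l p.1 k * Ψ.ψ (n + 1) (p.1, Fin.cons k p.2)).re := by
    intro n
    have i0 : ∀ i : Fin (⌊2 * R / l⌋₊ + 2), Integrable (fun p : PolaronConfig n =>
        (gridCell l (j₀ + (i : ℕ))).indicator (fun _ => (1 : ℂ)) p.1 *
            (star (u n p) * annihilate (cellMode l (j₀ + (i : ℕ))) (u (n + 1)) p)) := fun i => by
      have h1 : Integrable (fun p => star (u n p) *
          annihilate (cellMode l (j₀ + (i : ℕ))) (u (n + 1)) p) :=
        (mu n).star.integrable_mul ((memLp_cellMode hl _).annihilate (mu (n + 1)))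
      refine h1.bdd_mul (c := 1) ((measurable_const.indicator measurableSet_Ico).comp
        measurable_fst).aestronglyMeasurable (ae_of_all _ fun p => ?_)
      refine (norm_indicator_le_norm_self _ _).trans ?_
      simp
    have h2 : ∀ i : Fin (⌊2 * R / l⌋₊ + 2), Real.sqrt (2 * Real.pi / l) *
      (∫ p : PolaronConfig n, (gridCell l (j₀ + (i : ℕ))).indicator (fun _ => (1 : ℂ)) p.1 *
            (star (u n p) * annihilate (cellMode l (j₀ + (i : ℕ))) (u (n + 1)) p)).re
      = ∫ p : PolaronConfig n, ((Real.sqrt (2 * Real.pi / l) : ℂ) *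
        ((gridCell l (j₀ + (i : ℕ))).indicator (fun _ => (1 : ℂ)) p.1 *
            (star (u n p) * annihilate (cellMode l (j₀ + (i : ℕ))) (u (n + 1)) p))).re := by
      intro i
      have e7 := integral_re (𝕜 := ℂ) ((i0 i).const_mul (Real.sqrt (2 * Real.pi / l) : ℂ))
      simp only [RCLike.re_eq_complex_re] at e7
      rw [e7, integral_const_mul, Complex.re_ofReal_mul]
    simp_rw [h2]
    have i5 : ∀ i : Fin (⌊2 * R / l⌋₊ + 2), Integrable (fun p : PolaronConfig n =>
        ((Real.sqrt (2 * Real.pi / l) : ℂ) *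
        ((gridCell l (j₀ + (i : ℕ))).indicator (fun _ => (1 : ℂ)) p.1 *
            (star (u n p) * annihilate (cellMode l (j₀ + (i : ℕ))) (u (n + 1)) p))).re) :=
      fun i => ((i0 i).const_mul _).re
    rw [← integral_finsetSum _ fun i _ => i5 i]
    refine integral_congr_ae (ae_of_all _ fun p => ?_)
    simp only [hu, annihilate_electron_mul]
    have h3 : ∀ i : Fin (⌊2 * R / l⌋₊ + 2), (Real.sqrt (2 * Real.pi / l) : ℂ) *
        ((gridCell l (j₀ + (i : ℕ))).indicator (fun _ => (1 : ℂ)) p.1 *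
            (star ((c p.1 : ℂ) * Ψ.ψ n p) * ((c p.1 : ℂ) *
              annihilate (cellMode l (j₀ + (i : ℕ))) (Ψ.ψ (n + 1)) p)))
        = ((c p.1 ^ 2 : ℝ) : ℂ) * ((gridCell l (j₀ + (i : ℕ))).indicator (fun _ => (1 : ℂ)) p.1 *
          (star (Ψ.ψ n p) * ∫ k, cellAverage l (j₀ + (i : ℕ)) k *
            Ψ.ψ (n + 1) (p.1, Fin.cons k p.2))) := by
      intro i
      rw [← sqrt_mul_annihilate_cellMode hl]
      simp only [star_mul', RCLike.star_def, Complex.conj_ofReal]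
      push_cast
      ring
    simp_rw [h3, Complex.re_ofReal_mul]
    rw [← Finset.mul_sum]
    by_cases hz : c p.1 = 0
    · have hz' : χ (p.1 - y) = 0 := hz
      simp [hz, hz']
    · congr 1
      have hR : |p.1 - y| ≤ R := by
        by_contra hcon
        exact hz (hχ.eq_zero _ (not_le.1 hcon))
      obtain ⟨i, hi⟩ := exists_cell_of_mem_window hl hR
      rw [Finset.sum_eq_single i]
      · rw [Set.indicator_of_mem ((mem_gridCell_iff hl).2 hi), one_mul]
        simp only [cellKernel, hi, hj₀]
      · intro i' _ hii'
        rw [Set.indicator_of_notMem, zero_mul, Complex.zero_re]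
        intro hmem
        have := (mem_gridCell_iff hl).1 hmem
        rw [hi] at this
        exact hii' (by ext; omega)
      · simp
  simp_rw [e1, e2, e3] at key
  refine key.trans (le_of_eq ?_)
  congr 1
  -- `√(2π/l)` is the norm of a cell average, which converts the normalised modes back into averaged
  -- plane waves.
  have hs : Real.sqrt (α / l) = Real.sqrt (α / (2 * Real.pi)) * Real.sqrt (2 * Real.pi / l) := by
    rw [← Real.sqrt_mul (by positivity)]
    congr 1
    field_simp
  rw [hs, mul_assoc, mul_left_comm (Real.sqrt (2 * Real.pi / l))]
  congr 2
  rw [Finset.sum_comm, Finset.mul_sum]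
  refine Finset.sum_congr rfl fun n _ => ?_
  rw [← e4, Finset.mul_sum, Finset.mul_sum]
  refine Finset.sum_congr rfl fun i _ => ?_
  ring

end PolaronState

/-! ### Averaging over windows and summing over all phonon numbers. -/

namespace PolaronState

variable (Ψ : PolaronState)

theorem integrable_potential {V : ℝ → ℝ} {B : ℝ} (hVm : Continuous V) (hV0 : ∀ x, 0 ≤ V x)
    (hVB : ∀ x, V x ≤ B) (α : ℝ) (n : ℕ) : Integrable fun p => V (α * p.1) * ‖Ψ.ψ n p‖ ^ 2 :=
  (Ψ.memLp_ψ n).integrable_norm_sq.bdd_mul (c := B)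
    (hVm.comp (continuous_const.mul continuous_fst)).aestronglyMeasurable
    (ae_of_all _ fun p => by rw [Real.norm_of_nonneg (hV0 _)]; exact hVB _)

theorem summable_potential {V : ℝ → ℝ} {B : ℝ} (hVm : Continuous V) (hV0 : ∀ x, 0 ≤ V x)
    (hVB : ∀ x, V x ≤ B) (α : ℝ) : Summable fun n => ∫ p, V (α * p.1) * ‖Ψ.ψ n p‖ ^ 2 := by
  refine Summable.of_nonneg_of_le (fun n => integral_nonneg fun p => mul_nonneg (hV0 _) (sq_nonneg _))
    (fun n => ?_) (Ψ.summable_normSq.mul_left B)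
  rw [← integral_const_mul]
  exact integral_mono (Ψ.integrable_potential hVm hV0 hVB α n)
    ((Ψ.memLp_ψ n).integrable_norm_sq.const_mul B) fun p =>
      mul_le_mul_of_nonneg_right (hVB _) (sq_nonneg _)

/-- The Pekar lower bound with the phonon field averaged over cells. -/
theorem cell_lower_bound {V : ℝ → ℝ} {B : ℝ} (hVm : Continuous V)
    (hV0 : ∀ x, 0 ≤ V x) (hVB : ∀ x, V x ≤ B) {k : ℝ} (hk : 1 / 2 ≤ k) (hk1 : k ≤ 1) {α : ℝ}
    (hα : 0 < α) {l : ℝ} (hl : 0 < l) {χ : ℝ → ℝ} {R D : ℝ} (hχ : IsWindow χ R D) :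
    (α ^ 2 * (pekarEnergy V - pekarStability V B * (1 - k)) - k / 2 * (⌊2 * R / l⌋₊ + 2 : ℕ))
        * Ψ.normSq
      ≤ k * (Ψ.kinetic + D * Ψ.normSq) + k * Ψ.number - α ^ 2 * (Ψ.potential fun x => V (α * x))
        - Real.sqrt (α / (2 * Real.pi)) * (2 * (Ψ.interaction (cellKernel l)).re) := by
  set A := α ^ 2 * (pekarEnergy V - pekarStability V B * (1 - k))
    - k / 2 * (⌊2 * R / l⌋₊ + 2 : ℕ) with hA
  have hχc := hχ.contDiff.continuous
  have hdχc : Continuous (deriv χ) := hχ.contDiff.continuous_deriv (by norm_num)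
  have hcs := hχ.hasCompactSupport
  have hker := isKernel_cellKernel hl
  have sq_integrable : ∀ {w : ℝ → ℝ}, Continuous w → HasCompactSupport w →
      Integrable fun x => w x ^ 2 := by
    intro w hw hws
    have : Integrable fun x => w x * w x :=
      (hw.mul hw).integrable_of_hasCompactSupport hws.mul_right
    simpa only [sq] using this
  have w1 : ∀ {n : ℕ} {F : PolaronConfig n → ℝ}, Integrable F →
      HasTotal (fun y => ∫ p : PolaronConfig n, χ (p.1 - y) ^ 2 * F p) (∫ p, F p) := by
    intro n F hF
    have := hasTotal_window (w := fun x => χ x ^ 2) (hχc.pow 2)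
      (sq_integrable hχc hcs) hF
    rwa [hχ.integral_sq, one_mul] at this
  have w2 : ∀ {n : ℕ} {F : PolaronConfig n → ℝ}, Integrable F →
      HasTotal (fun y => ∫ p : PolaronConfig n, 2 * (χ (p.1 - y) * deriv χ (p.1 - y)) * F p) 0 := by
    intro n F hF
    have := hasTotal_window (w := fun x => 2 * (χ x * deriv χ x))
      (continuous_const.mul (hχc.mul hdχc))
      (((hχc.mul hdχc).integrable_of_hasCompactSupport hcs.mul_right).const_mul 2) hF
    rwa [integral_const_mul, hχ.integral_mul_deriv, mul_zero, zero_mul] at this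
  have w3 : ∀ {n : ℕ} {F : PolaronConfig n → ℝ}, Integrable F →
      HasTotal (fun y => ∫ p : PolaronConfig n, deriv χ (p.1 - y) ^ 2 * F p) (D * ∫ p, F p) := by
    intro n F hF
    have := hasTotal_window (w := fun x => deriv χ x ^ 2) (hdχc.pow 2)
      (sq_integrable hdχc hcs.deriv) hF
    rwa [hχ.integral_deriv_sq] at this
  have iψ : ∀ n, Integrable fun p => ‖Ψ.ψ n p‖ ^ 2 := fun n => (Ψ.memLp_ψ n).integrable_norm_sq
  have idψ : ∀ n, Integrable fun p => ‖Ψ.dψ n p‖ ^ 2 := fun n => (Ψ.memLp_dψ n).integrable_norm_sq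
  have iψdψ : ∀ n, Integrable fun p => (star (Ψ.ψ n p) * Ψ.dψ n p).re := fun n => by
    have : Integrable fun p => star (Ψ.ψ n p) * Ψ.dψ n p :=
      (Ψ.memLp_ψ n).star.integrable_mul (Ψ.memLp_dψ n)
    exact this.re
  have icoup : ∀ n, Integrable fun p : PolaronConfig n => star (Ψ.ψ n p) *
      ∫ k, cellKernel l p.1 k * Ψ.ψ (n + 1) (p.1, Fin.cons k p.2) := fun n => by
    refine (hker.integrable (Ψ.memLp_ψ n) (Ψ.memLp_ψ (n + 1))).integral_prod_left.congr
      (ae_of_all _ fun p => ?_)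
    simp only
    rw [← integral_const_mul]
    refine integral_congr_ae (ae_of_all _ fun k => ?_)
    simp only
    ring
  have ecoup : ∀ n, ∫ p : PolaronConfig n, (star (Ψ.ψ n p) *
      ∫ k, cellKernel l p.1 k * Ψ.ψ (n + 1) (p.1, Fin.cons k p.2)).re
      = (coupling (cellKernel l) (Ψ.ψ n) (Ψ.ψ (n + 1))).re := fun n => by
    have e7 := integral_re (𝕜 := ℂ) (icoup n)
    simp only [RCLike.re_eq_complex_re] at e7
    exact e7
  -- Integrating over the window centre `y` gives `χ²` weight `1`, the cross term weight `0` and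
  -- `χ'²` weight `D`.
  have avg : ∀ N : ℕ, A * (∑ n ∈ Finset.range (N + 1), ∫ p, ‖Ψ.ψ n p‖ ^ 2)
      ≤ k * (∑ n ∈ Finset.range (N + 1), ((∫ p, ‖Ψ.dψ n p‖ ^ 2) + 0
          + D * ∫ p, ‖Ψ.ψ n p‖ ^ 2))
        + k * (∑ n ∈ Finset.range (N + 1), (n : ℝ) * ∫ p, ‖Ψ.ψ n p‖ ^ 2)
        - α ^ 2 * (∑ n ∈ Finset.range (N + 1), ∫ p, V (α * p.1) * ‖Ψ.ψ n p‖ ^ 2)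
        - Real.sqrt (α / (2 * Real.pi)) * (2 * ∑ n ∈ Finset.range N, Real.sqrt (n + 1) *
          ∫ p : PolaronConfig n, (star (Ψ.ψ n p) *
            ∫ k, cellKernel l p.1 k * Ψ.ψ (n + 1) (p.1, Fin.cons k p.2)).re) := by
    intro N
    refine HasTotal.mono ((HasTotal.sum fun n _ => w1 (iψ n)).const_mul A) ?_
      fun y => Ψ.window_lower_bound hVm hV0 hVB hk hk1 hα hl hχ N y
    exact (((((HasTotal.sum fun n _ => ((w1 (idψ n)).add (w2 (iψdψ n))).add
      (w3 (iψ n))).const_mul k).add ((HasTotal.sum fun n _ =>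
      (w1 (iψ n)).const_mul (n : ℝ)).const_mul k)).sub ((HasTotal.sum fun n _ =>
      w1 (Ψ.integrable_potential hVm hV0 hVB α n)).const_mul (α ^ 2))).sub
      (((HasTotal.sum fun n _ => (w1 (icoup n).re).const_mul (Real.sqrt ((n : ℕ) + 1))).const_mul
        2).const_mul (Real.sqrt (α / (2 * Real.pi)))))
  have t : ∀ {f : ℕ → ℝ}, Summable f →
      Tendsto (fun N => ∑ n ∈ Finset.range (N + 1), f n) atTop (𝓝 (∑' n, f n)) := fun hf =>
    (tendsto_add_atTop_iff_nat 1).2 hf.hasSum.tendsto_sum_nat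
  have t5 : Tendsto (fun N => ∑ n ∈ Finset.range N, Real.sqrt (n + 1) *
      ∫ p : PolaronConfig n, (star (Ψ.ψ n p) *
        ∫ k, cellKernel l p.1 k * Ψ.ψ (n + 1) (p.1, Fin.cons k p.2)).re) atTop
      (𝓝 (Ψ.interaction (cellKernel l)).re) := by
    simp_rw [ecoup]
    have h := Complex.hasSum_re (Ψ.norm_interaction_le hker).1.hasSum
    simp only [Complex.re_ofReal_mul] at h
    exact h.tendsto_sum_nat
  have hsk : Summable fun n => (∫ p, ‖Ψ.dψ n p‖ ^ 2) + 0 + D * ∫ p, ‖Ψ.ψ n p‖ ^ 2 := by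
    simpa only [add_zero] using Ψ.summable_kinetic.add (Ψ.summable_normSq.mul_left D)
  have hsk2 : ∑' n, ((∫ p, ‖Ψ.dψ n p‖ ^ 2) + 0 + D * ∫ p, ‖Ψ.ψ n p‖ ^ 2)
      = Ψ.kinetic + D * Ψ.normSq := by
    simp only [add_zero]
    rw [Ψ.summable_kinetic.tsum_add (Ψ.summable_normSq.mul_left D), tsum_mul_left]
    rfl
  have hlim := le_of_tendsto_of_tendsto' ((t Ψ.summable_normSq).const_mul A)
    (((((t hsk).const_mul k).add ((t Ψ.summable_number).const_mul k)).sub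
      ((t (Ψ.summable_potential hVm hV0 hVB α)).const_mul (α ^ 2))).sub
      ((t5.const_mul 2).const_mul (Real.sqrt (α / (2 * Real.pi))))) avg
  rw [hsk2] at hlim
  exact hlim

end PolaronState

/-- The lower bound on the polaron energy in terms of the width `l` of the cells and the width `R`
of the localisation. -/
theorem exists_polaron_lower_bound {V : ℝ → ℝ} {B : ℝ} (hVm : Continuous V) (hV0 : ∀ x, 0 ≤ V x)
    (hVB : ∀ x, V x ≤ B) : ∃ C : ℝ, 0 < C ∧ ∀ α l R : ℝ, 0 < α → 0 < l → 0 < R →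
      2 * Real.sqrt (α * l) ≤ 1 / 2 → ∀ E ∈ polaronValues α V,
        α ^ 2 * pekarEnergy V
          - C * (α ^ 2 * Real.sqrt (α * l) + R / l + 1 / R ^ 2 + 1) ≤ E := by
  obtain ⟨D, hD, hwin⟩ := exists_isWindow
  set S := pekarStability V B with hS
  refine ⟨2 * |S| + 2 + D, by positivity, fun α l R hα hl hR hε E hE => ?_⟩
  obtain ⟨Ψ, hnorm, hE⟩ := hE
  obtain ⟨χ, hχ⟩ := hwin R hR
  set ε := 2 * Real.sqrt (α * l) with hεdef
  have hε0 : 0 ≤ ε := by positivity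
  have h1 := Ψ.cell_energy_le hα hE hl
  have h2 := Ψ.cell_lower_bound hVm hV0 hVB (k := 1 - ε) (by linarith) (by linarith) hα hl hχ
  rw [hnorm] at h1 h2
  have hT := Ψ.kinetic_nonneg
  -- The window bound is used with `k = 1 - ε`, so a fraction `ε = 2√(αl)` of kinetic energy and
  -- number remains to absorb the cell error `ε Q`.
  have hN := Ψ.number_nonneg
  have hQ : Real.sqrt Ψ.kinetic * Real.sqrt Ψ.number
      + Real.sqrt (Ψ.number + 1) * Real.sqrt Ψ.kinetic ≤ Ψ.kinetic + Ψ.number + 1 := by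
    have a1 := Real.sq_sqrt hT
    have a2 := Real.sq_sqrt hN
    have a3 := Real.sq_sqrt (show 0 ≤ Ψ.number + 1 by linarith)
    nlinarith [sq_nonneg (Real.sqrt Ψ.kinetic - Real.sqrt Ψ.number),
      sq_nonneg (Real.sqrt Ψ.kinetic - Real.sqrt (Ψ.number + 1))]
  have hM : ((⌊2 * R / l⌋₊ + 2 : ℕ) : ℝ) ≤ 2 * (R / l) + 2 := by
    have := Nat.floor_le (show 0 ≤ 2 * R / l by positivity)
    push_cast
    rw [mul_div_assoc] at this
    rw [mul_div_assoc]
    linarith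
  have hM0 : (0 : ℝ) ≤ ((⌊2 * R / l⌋₊ + 2 : ℕ) : ℝ) := Nat.cast_nonneg _
  have h3 := mul_le_mul_of_nonneg_left hQ hε0
  have h4 : (1 - ε) / 2 * ((⌊2 * R / l⌋₊ + 2 : ℕ) : ℝ) ≤ R / l + 1 := by
    nlinarith
  have h5 : (1 - ε) * (D / R ^ 2) ≤ D * (1 / R ^ 2) := by
    have : 0 ≤ D / R ^ 2 := by positivity
    rw [mul_one_div]
    nlinarith
  have h6 : α ^ 2 * (S * ε) ≤ 2 * |S| * (α ^ 2 * Real.sqrt (α * l)) := by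
    have : S * ε ≤ |S| * ε := mul_le_mul_of_nonneg_right (le_abs_self S) hε0
    calc α ^ 2 * (S * ε) ≤ α ^ 2 * (|S| * ε) := mul_le_mul_of_nonneg_left this (sq_nonneg _)
      _ = _ := by rw [hεdef]; ring
  set x1 := α ^ 2 * Real.sqrt (α * l) with hx1
  have p1 : 0 ≤ x1 := by positivity
  have p2 : 0 ≤ R / l := by positivity
  have p3 : 0 ≤ 1 / R ^ 2 := by positivity
  have p4 : 0 ≤ |S| := abs_nonneg S
  have e : 1 - (1 - ε) = ε := by ring
  rw [e] at h2
  simp only [mul_one] at h2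
  -- The summands are the perturbed Pekar coefficients, the zero-point energy of the modes, the
  -- localisation, and the `ε` left over from `Q ≤ T + N + 1`.
  have h7 : 2 * |S| * x1 + R / l + 1 + D * (1 / R ^ 2) + ε
      ≤ (2 * |S| + 2 + D) * (x1 + R / l + 1 / R ^ 2 + 1) := by
    have q1 := mul_nonneg p4 p2
    have q2 := mul_nonneg p4 p3
    have q3 := mul_nonneg hD p1
    have q4 := mul_nonneg hD p2
    nlinarith
  nlinarith

/-! ### Poisson weights of coherent states. -/

section Poisson

/-- The normalised coefficient of the `n`-phonon component of a coherent state. -/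
noncomputable def coherentCoeff (F : ℝ) (n : ℕ) : ℝ := Real.sqrt (Real.exp (-F) / n.factorial)

theorem coherentCoeff_sq (F : ℝ) (n : ℕ) : coherentCoeff F n ^ 2 = Real.exp (-F) / n.factorial :=
  Real.sq_sqrt (by positivity)

/-- This expresses that a coherent state is an eigenvector of annihilation. The powers of the field
sit in `modePower`, not in the coefficient. -/
theorem sqrt_mul_coherentCoeff_succ (F : ℝ) (n : ℕ) :
    Real.sqrt (n + 1) * (coherentCoeff F n * coherentCoeff F (n + 1)) = coherentCoeff F n ^ 2 := by
  have h : coherentCoeff F n = Real.sqrt (n + 1) * coherentCoeff F (n + 1) := by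
    rw [coherentCoeff, coherentCoeff, ← Real.sqrt_mul (by positivity), Nat.factorial_succ]
    congr 1
    push_cast
    field_simp
  rw [mul_left_comm, ← h, sq]

theorem hasSum_coherentCoeff_sq (F : ℝ) :
    HasSum (fun n => coherentCoeff F n ^ 2 * F ^ n) 1 := by
  have h := (NormedSpace.expSeries_div_hasSum_exp F).mul_left (Real.exp (-F))
  rw [← Real.exp_eq_exp_ℝ, ← Real.exp_add, neg_add_cancel, Real.exp_zero] at h
  have e : (fun n => coherentCoeff F n ^ 2 * F ^ n)
      = fun n : ℕ => Real.exp (-F) * (F ^ n / n.factorial) := by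
    funext n
    rw [coherentCoeff_sq]
    ring
  rw [e]
  exact h

theorem hasSum_nat_mul_coherentCoeff_sq (F : ℝ) :
    HasSum (fun n : ℕ => (n : ℝ) * (coherentCoeff F n ^ 2 * F ^ n)) F := by
  rw [← hasSum_nat_add_iff' 1]
  simp only [Finset.sum_range_one, Nat.cast_zero, zero_mul, sub_zero]
  have h := (hasSum_coherentCoeff_sq F).mul_left F
  rw [mul_one] at h
  have e : (fun n : ℕ => ((n + 1 : ℕ) : ℝ) * (coherentCoeff F (n + 1) ^ 2 * F ^ (n + 1)))
      = fun n : ℕ => F * (coherentCoeff F n ^ 2 * F ^ n) := by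
    funext n
    rw [coherentCoeff_sq, coherentCoeff_sq, Nat.factorial_succ]
    push_cast
    field_simp
    ring
  rw [e]
  exact h

end Poisson

/-! ### Components of product form. -/

section Product

/-- The product of `n` copies of a phonon wave function. -/
noncomputable def modePower (f : ℝ → ℂ) {n : ℕ} (k : Fin n → ℝ) : ℂ := ∏ j, f (k j)

variable {f : ℝ → ℂ} {n : ℕ}

theorem memLp_modePower (hf : MemLp f 2 volume) :
    MemLp (modePower f : (Fin n → ℝ) → ℂ) 2 volume :=
  MemLp.wordFunction (f := fun _ => f) (fun _ => hf) (fun _ => 0)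

theorem integral_norm_modePower_sq :
    ∫ k : Fin n → ℝ, ‖modePower f k‖ ^ 2 = (∫ k, ‖f k‖ ^ 2) ^ n := by
  have h := integral_fintype_prod_volume_eq_pow (ι := Fin n) (fun k => ‖f k‖ ^ 2)
  rw [Fintype.card_fin] at h
  rw [← h]
  refine integral_congr_ae (ae_of_all _ fun k => ?_)
  simp only [modePower, norm_prod, Finset.prod_pow]

/-- A real function of the electron position times a power of a phonon wave function. -/
noncomputable def productComponent (a : ℝ) (v : ℝ → ℝ) (f : ℝ → ℂ) (p : PolaronConfig n) : ℂ :=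
  ((a * v p.1 : ℝ) : ℂ) * modePower f p.2

variable {a : ℝ} {v dv : ℝ → ℝ}

theorem norm_productComponent_sq (a : ℝ) (v : ℝ → ℝ) (f : ℝ → ℂ) (p : PolaronConfig n) :
    ‖productComponent a v f p‖ ^ 2 = a ^ 2 * (v p.1 ^ 2 * ‖modePower f p.2‖ ^ 2) := by
  rw [productComponent, norm_mul, Complex.norm_real, mul_pow, Real.norm_eq_abs, sq_abs, mul_pow]
  ring

theorem memLp_productComponent (hv : MemLp v 2 volume) (hf : MemLp f 2 volume) (a : ℝ) :
    MemLp (productComponent a v f : PolaronConfig n → ℂ) 2 volume := by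
  have hm : AEStronglyMeasurable (productComponent a v f : PolaronConfig n → ℂ) volume := by
    have h1 : AEStronglyMeasurable (fun p : PolaronConfig n => v p.1) volume := hv.1.comp_fst
    have h2 : AEStronglyMeasurable (fun p : PolaronConfig n => modePower f p.2) volume :=
      (memLp_modePower hf).1.comp_snd
    exact (Complex.continuous_ofReal.comp_aestronglyMeasurable (h1.const_mul a)).mul h2
  rw [memLp_two_iff_integrable_norm_sq hm]
  simp_rw [norm_productComponent_sq]
  exact (hv.integrable_sq.mul_prod (memLp_modePower hf).integrable_norm_sq).const_mul _

theorem integral_weight_productComponent (w : ℝ → ℝ) :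
    ∫ p : PolaronConfig n, w p.1 * ‖productComponent a v f p‖ ^ 2
      = (∫ x, w x * v x ^ 2) * (a ^ 2 * (∫ k, ‖f k‖ ^ 2) ^ n) := by
  have h := integral_prod_mul (μ := (volume : Measure ℝ)) (ν := (volume : Measure (Fin n → ℝ)))
    (fun x => w x * v x ^ 2) (fun k => a ^ 2 * ‖modePower f k‖ ^ 2)
  rw [integral_const_mul, integral_norm_modePower_sq] at h
  rw [← h]
  refine integral_congr_ae (ae_of_all _ fun p => ?_)
  simp only [norm_productComponent_sq]
  ring

theorem integral_norm_productComponent_sq :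
    ∫ p : PolaronConfig n, ‖productComponent a v f p‖ ^ 2
      = (∫ x, v x ^ 2) * (a ^ 2 * (∫ k, ‖f k‖ ^ 2) ^ n) := by
  simpa using integral_weight_productComponent (a := a) (v := v) (f := f) (n := n) fun _ => 1

/-- Fubini reduces this to the weak derivative of `v` on each line of fixed momenta. -/
theorem isWeakElectronDeriv_productComponent (h : IsPrimitive v dv) (hv : MemLp v 2 volume)
    (hdv : MemLp dv 2 volume) (hf : MemLp f 2 volume) (a : ℝ) :
    IsWeakElectronDeriv (productComponent a v f : PolaronConfig n → ℂ) (productComponent a dv f) := by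
  intro φ hφ hφc
  have l1 : LocallyIntegrable (productComponent a v f : PolaronConfig n → ℂ) volume :=
    (memLp_productComponent hv hf a).locallyIntegrable (by norm_num)
  have l2 : LocallyIntegrable (productComponent a dv f : PolaronConfig n → ℂ) volume :=
    (memLp_productComponent hdv hf a).locallyIntegrable (by norm_num)
  have c1 : Continuous fun p : PolaronConfig n => fderiv ℝ φ p (1, 0) :=
    (hφ.continuous_fderiv (by norm_num)).clm_apply continuous_const
  have s1 : HasCompactSupport fun p : PolaronConfig n => fderiv ℝ φ p (1, 0) :=
    hφc.fderiv_apply (𝕜 := ℝ) (1, 0)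
  have i1 : Integrable (fun p => fderiv ℝ φ p (1, 0) • productComponent a v f p)
      ((volume : Measure ℝ).prod (volume : Measure (Fin n → ℝ))) :=
    l1.integrable_smul_left_of_hasCompactSupport c1 s1
  have i2 : Integrable (fun p => φ p • productComponent a dv f p)
      ((volume : Measure ℝ).prod (volume : Measure (Fin n → ℝ))) :=
    l2.integrable_smul_left_of_hasCompactSupport hφ.continuous hφc
  have hw := h.isWeakDeriv hv hdv
  rw [Measure.volume_eq_prod, integral_prod_symm _ i1, integral_prod_symm _ i2, ← integral_neg]
  refine integral_congr_ae (ae_of_all _ fun k => ?_)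
  simp only
  have hline : ContDiff ℝ ∞ fun x : ℝ => φ (x, k) := hφ.comp (contDiff_id.prodMk contDiff_const)
  have hlinec : HasCompactSupport fun x : ℝ => φ (x, k) :=
    HasCompactSupport.intro (hφc.isCompact.image continuous_fst) fun x hx =>
      image_eq_zero_of_notMem_tsupport fun hx' => hx ⟨(x, k), hx', rfl⟩
  have hd : ∀ x, fderiv ℝ φ (x, k) (1, 0) = deriv (fun x => φ (x, k)) x := by
    intro x
    have h1 : HasFDerivAt φ (fderiv ℝ φ (x, k)) (x, k) :=
      (hφ.differentiable (by norm_num) (x, k)).hasFDerivAt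
    have h2 : HasDerivAt (fun x : ℝ => (x, k)) ((1 : ℝ), (0 : Fin n → ℝ)) x :=
      (hasDerivAt_id x).prodMk (hasDerivAt_const x k)
    exact (h1.comp_hasDerivAt x h2).deriv.symm
  have h3 := hw _ hline hlinec
  have e1 : ∀ x, fderiv ℝ φ (x, k) (1, 0) • productComponent a v f ((x, k) : PolaronConfig n)
      = ((v x * deriv (fun x => φ (x, k)) x : ℝ) : ℂ) * (a * modePower f k) := by
    intro x
    rw [hd, productComponent, Complex.real_smul]
    push_cast
    ring
  have e2 : ∀ x, φ (x, k) • productComponent a dv f ((x, k) : PolaronConfig n)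
      = ((dv x * φ (x, k) : ℝ) : ℂ) * (a * modePower f k) := by
    intro x
    rw [productComponent, Complex.real_smul]
    push_cast
    ring
  simp_rw [e1, e2]
  rw [integral_mul_const, integral_mul_const, integral_complex_ofReal, integral_complex_ofReal, h3]
  push_cast
  ring

theorem coupling_productComponent (h : ℝ → ℝ → ℂ) (a b : ℝ) :
    coupling h (productComponent a v f : PolaronConfig n → ℂ) (productComponent b v f)
      = ((a * b * (∫ k, ‖f k‖ ^ 2) ^ n : ℝ) : ℂ) * ∫ x, (v x ^ 2 : ℝ) * ∫ k, h x k * f k := by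
  have hp := integral_prod_mul (μ := (volume : Measure ℝ)) (ν := (volume : Measure (Fin n → ℝ)))
    (fun x => ((v x ^ 2 : ℝ) : ℂ) * ∫ k, h x k * f k)
    (fun k => ((a * b * ‖modePower f k‖ ^ 2 : ℝ) : ℂ))
  rw [integral_complex_ofReal, integral_const_mul, integral_norm_modePower_sq] at hp
  rw [mul_comm, ← hp]
  refine integral_congr_ae (ae_of_all _ fun p => ?_)
  have e : ∫ k, h p.1 k * productComponent b v f (n := n + 1) (p.1, Fin.cons k p.2)
      = ((b * v p.1 : ℝ) : ℂ) * modePower f p.2 * ∫ k, h p.1 k * f k := by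
    rw [← integral_const_mul]
    refine integral_congr_ae (ae_of_all _ fun k => ?_)
    simp only [productComponent, modePower, Fin.prod_univ_succ, Fin.cons_zero, Fin.cons_succ]
    ring
  simp only
  rw [e, productComponent]
  have e2 : ((‖modePower f p.2‖ ^ 2 : ℝ) : ℂ) = star (modePower f p.2) * modePower f p.2 := by
    rw [RCLike.star_def, Complex.conj_mul']; push_cast; rfl
  simp only [star_mul', RCLike.star_def, Complex.conj_ofReal] at e2 ⊢
  have e3 : ((a * b * ‖modePower f p.2‖ ^ 2 : ℝ) : ℂ) = a * b * ((‖modePower f p.2‖ ^ 2 : ℝ) : ℂ) := by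
    push_cast; ring
  rw [e3, e2]
  push_cast
  ring

end Product

/-! ### Energy terms of coherent product states, and the upper bound. -/

namespace PolaronState

variable {v dv : ℝ → ℝ} {f : ℝ → ℂ}

/-- The product of an electron wave function and a coherent state of the phonon field. -/
noncomputable def coherent (h : IsPrimitive v dv) (hv : MemLp v 2 volume) (hdv : MemLp dv 2 volume)
    (hf : MemLp f 2 volume) : PolaronState where
  ψ n := productComponent (coherentCoeff (∫ k, ‖f k‖ ^ 2) n) v f
  dψ n := productComponent (coherentCoeff (∫ k, ‖f k‖ ^ 2) n) dv f
  memLp_ψ _ := memLp_productComponent hv hf _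
  memLp_dψ _ := memLp_productComponent hdv hf _
  symm n σ := ae_of_all _ fun p => by
    simp only [productComponent, modePower, Function.comp]
    rw [Equiv.prod_comp σ fun j => f (p.2 j)]
  weakDeriv _ := isWeakElectronDeriv_productComponent h hv hdv hf _
  summable_normSq := by
    simp_rw [integral_norm_productComponent_sq]
    exact (hasSum_coherentCoeff_sq _).summable.mul_left _
  summable_kinetic := by
    simp_rw [integral_norm_productComponent_sq]
    exact (hasSum_coherentCoeff_sq _).summable.mul_left _
  summable_number := by
    simp_rw [integral_norm_productComponent_sq]
    refine ((hasSum_nat_mul_coherentCoeff_sq (∫ k, ‖f k‖ ^ 2)).summable.mul_left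
      (∫ x, v x ^ 2)).congr fun n => ?_
    ring

variable (h : IsPrimitive v dv) (hv : MemLp v 2 volume) (hdv : MemLp dv 2 volume)
    (hf : MemLp f 2 volume)

theorem normSq_coherent : (coherent h hv hdv hf).normSq = ∫ x, v x ^ 2 := by
  simp only [normSq, coherent, integral_norm_productComponent_sq]
  rw [tsum_mul_left, (hasSum_coherentCoeff_sq _).tsum_eq, mul_one]

theorem kinetic_coherent : (coherent h hv hdv hf).kinetic = ∫ x, dv x ^ 2 := by
  simp only [kinetic, coherent, integral_norm_productComponent_sq]
  rw [tsum_mul_left, (hasSum_coherentCoeff_sq _).tsum_eq, mul_one]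

theorem number_coherent :
    (coherent h hv hdv hf).number = (∫ x, v x ^ 2) * ∫ k, ‖f k‖ ^ 2 := by
  simp only [number, coherent, integral_norm_productComponent_sq]
  rw [← (hasSum_nat_mul_coherentCoeff_sq (∫ k, ‖f k‖ ^ 2)).tsum_eq, ← tsum_mul_left]
  rw [(hasSum_nat_mul_coherentCoeff_sq (∫ k, ‖f k‖ ^ 2)).tsum_eq]
  refine tsum_congr fun n => ?_
  ring

theorem potential_coherent (W : ℝ → ℝ) :
    (coherent h hv hdv hf).potential W = ∫ x, W x * v x ^ 2 := by
  simp only [potential, coherent, integral_weight_productComponent]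
  rw [tsum_mul_left, (hasSum_coherentCoeff_sq _).tsum_eq, mul_one]

/-- Each lowering term reproduces a Poisson weight, and these sum to one: in a coherent state
annihilation acts as the classical field `f`. -/
theorem interaction_coherent (g : ℝ → ℝ → ℂ) :
    (coherent h hv hdv hf).interaction g = ∫ x, (v x ^ 2 : ℝ) * ∫ k, g x k * f k := by
  have hs := Complex.hasSum_ofReal.2 (hasSum_coherentCoeff_sq (∫ k, ‖f k‖ ^ 2))
  simp only [interaction, coherent, coupling_productComponent]
  have e : ∀ n : ℕ, (Real.sqrt (n + 1) : ℂ) * (((coherentCoeff (∫ k, ‖f k‖ ^ 2) n *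
      coherentCoeff (∫ k, ‖f k‖ ^ 2) (n + 1) * (∫ k, ‖f k‖ ^ 2) ^ n : ℝ) : ℂ) *
        ∫ x, (v x ^ 2 : ℝ) * ∫ k, g x k * f k)
      = ((coherentCoeff (∫ k, ‖f k‖ ^ 2) n ^ 2 * (∫ k, ‖f k‖ ^ 2) ^ n : ℝ) : ℂ) *
        ∫ x, (v x ^ 2 : ℝ) * ∫ k, g x k * f k := by
    intro n
    rw [← mul_assoc, ← Complex.ofReal_mul, ← sqrt_mul_coherentCoeff_succ]
    congr 2
    ring
  simp_rw [e]
  rw [tsum_mul_right, hs.tsum_eq]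
  simp

end PolaronState

/-- The interaction of a charge distribution with the phonon field that it generates. -/
theorem tendsto_integral_momentumCutoff {ρ : ℝ → ℝ} (h1 : Integrable ρ) (h2 : MemLp ρ 2 volume)
    (c : ℝ) :
    Tendsto (fun K => (∫ x, (ρ x : ℂ) * ∫ k, momentumCutoff K planeWave x k *
      (c * angularFourier (fun x => (ρ x : ℂ)) k)).re) atTop (𝓝 (c * (2 * Real.pi * ∫ x, ρ x ^ 2))) := by
  set F := angularFourier fun x => (ρ x : ℂ) with hF
  have h1c : Integrable fun x => (ρ x : ℂ) := h1.ofReal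
  have h2c : MemLp (fun x => (ρ x : ℂ)) 2 volume := h2.ofReal
  have hFc : Continuous F := continuous_angularFourier h1c
  have hFn : ∫ k, ‖F k‖ ^ 2 = 2 * Real.pi * ∫ x, ρ x ^ 2 := by
    rw [hF, integral_norm_angularFourier_sq h1c h2c]
    simp
  have hFi : Integrable fun k => ‖F k‖ ^ 2 := (memLp_angularFourier h1c h2c).integrable_norm_sq
  -- With the momenta confined to a compact interval Fubini applies, and integrating over `x` first
  -- gives the conjugate transform of `ρ`.
  have key : ∀ K, (∫ x, (ρ x : ℂ) * ∫ k, momentumCutoff K planeWave x k * (c * F k)).re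
      = c * ∫ k in Set.Icc (-K) K, ‖F k‖ ^ 2 := by
    intro K
    have hi : Integrable (fun q : ℝ × ℝ => planeWave q.1 q.2 * ((ρ q.1 : ℂ) * (c * F q.2)))
        (volume.prod (volume.restrict (Set.Icc (-K) K))) := by
      have h3 : Integrable (fun k => (c : ℂ) * F k) (volume.restrict (Set.Icc (-K) K)) :=
        (continuous_const.mul hFc).continuousOn.integrableOn_compact isCompact_Icc
      exact (h1c.mul_prod h3).bdd_mul (c := 1) continuous_planeWave.aestronglyMeasurable
        (ae_of_all _ fun q => (norm_planeWave _ _).le)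
    have e1 : ∫ x, (ρ x : ℂ) * ∫ k, momentumCutoff K planeWave x k * (c * F k)
        = ∫ x, ∫ k in Set.Icc (-K) K, planeWave x k * ((ρ x : ℂ) * (c * F k)) := by
      refine integral_congr_ae (ae_of_all _ fun x => ?_)
      simp only
      rw [← integral_const_mul, ← integral_indicator measurableSet_Icc]
      refine integral_congr_ae (ae_of_all _ fun k => ?_)
      by_cases hk : k ∈ Set.Icc (-K) K
      · simp only [momentumCutoff, Set.indicator_of_mem hk]; ring
      · simp [momentumCutoff, hk]
    have e2 : ∫ k in Set.Icc (-K) K, ∫ x, planeWave x k * ((ρ x : ℂ) * (c * F k))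
        = ∫ k in Set.Icc (-K) K, ((c * ‖F k‖ ^ 2 : ℝ) : ℂ) := by
      refine integral_congr_ae (ae_of_all _ fun k => ?_)
      have e3 : ∫ x, planeWave x k * (ρ x : ℂ) = star (F k) := by
        rw [hF, angularFourier, RCLike.star_def, ← integral_conj]
        refine integral_congr_ae (ae_of_all _ fun x => ?_)
        simp [planeWave, ← Complex.exp_conj]
      simp only
      have e4 : ∀ x, planeWave x k * ((ρ x : ℂ) * (c * F k)) = planeWave x k * (ρ x : ℂ) * (c * F k) :=
        fun x => by ring
      simp_rw [e4]
      rw [integral_mul_const, e3, mul_left_comm, RCLike.star_def, Complex.conj_mul']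
      push_cast
      rfl
    rw [e1, integral_integral_swap hi, e2, integral_complex_ofReal, Complex.ofReal_re,
      integral_const_mul]
  simp_rw [key]
  rw [← hFn]
  have hc : AECover volume atTop fun K : ℝ => Set.Icc (-K) K :=
    aecover_Icc tendsto_neg_atTop_atBot tendsto_id
  exact (hc.integral_tendsto_of_countably_generated hFi).const_mul c

/-- The Pekar product states bound the polaron energy from above. -/
theorem sq_mul_pekarFunctional_mem_polaronValues {V : ℝ → ℝ} {B : ℝ} (hVm : Continuous V)
    (hV0 : ∀ x, 0 ≤ V x) (hVB : ∀ x, V x ≤ B) {α : ℝ} (hα : 0 < α) {r : ℝ}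
    (hr : r ∈ pekarValues V) : α ^ 2 * r ∈ polaronValues α V := by
  obtain ⟨u, du, hu, hdu, hw, hu1, rfl⟩ := hr
  have hp := hw.isPrimitive hu hdu
  set s := Real.sqrt α with hs
  have hs2 : s ^ 2 = α := Real.sq_sqrt hα.le
  have hpv : IsPrimitive (fun x => s * u (α * x)) (fun x => s * α * du (α * x)) :=
    hp.comp_mul_left hα.ne' s
  have hv : MemLp (fun x => s * u (α * x)) 2 volume := (hu.comp_mul_left_real hα.ne').const_mul s
  have hdv : MemLp (fun x => s * α * du (α * x)) 2 volume :=
    (hdu.comp_mul_left_real hα.ne').const_mul (s * α)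
  have hscale : ∀ g : ℝ → ℝ, ∫ x, g (α * x) = α⁻¹ * ∫ x, g x := fun g => by
    rw [Measure.integral_comp_mul_left g α, abs_of_pos (inv_pos.2 hα), smul_eq_mul]
  have n1 : ∫ x, (s * u (α * x)) ^ 2 = 1 := by
    simp_rw [mul_pow]
    rw [integral_const_mul, hscale fun x => u x ^ 2, hu1, hs2, mul_one, mul_inv_cancel₀ hα.ne']
  have n2 : ∫ x, (s * α * du (α * x)) ^ 2 = α ^ 2 * ∫ x, du x ^ 2 := by
    simp_rw [mul_pow]
    rw [integral_const_mul, hscale fun x => du x ^ 2, hs2]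
    field_simp
  have n4 : ∫ x, ((s * u (α * x)) ^ 2) ^ 2 = α * ∫ x, u x ^ 4 := by
    have e : ∀ x, ((s * u (α * x)) ^ 2) ^ 2 = α ^ 2 * u (α * x) ^ 4 := fun x => by
      rw [mul_pow, hs2]; ring
    simp_rw [e]
    rw [integral_const_mul, hscale fun x => u x ^ 4]
    field_simp
  have nV : ∫ x, V (α * x) * (s * u (α * x)) ^ 2 = ∫ x, V x * u x ^ 2 := by
    have e : ∀ x, V (α * x) * (s * u (α * x)) ^ 2 = α * (V (α * x) * u (α * x) ^ 2) := fun x => by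
      rw [mul_pow, hs2]; ring
    simp_rw [e]
    rw [integral_const_mul, hscale fun x => V x * u x ^ 2]
    field_simp
  set ρ : ℝ → ℝ := fun x => (s * u (α * x)) ^ 2 with hρ
  have hρ1 : Integrable ρ := hv.integrable_sq
  have hρ2 : MemLp ρ 2 volume := by
    rw [memLp_two_iff_integrable_sq hρ1.1]
    have h4 := hpv.integrable_pow_four hv hdv n1
    refine h4.congr (ae_of_all _ fun x => ?_)
    simp only [hρ]
    ring
  set c := Real.sqrt (α / (2 * Real.pi)) with hc
  have hc2 : c ^ 2 = α / (2 * Real.pi) := Real.sq_sqrt (by positivity)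
  have hρ1c : Integrable fun x => (ρ x : ℂ) := hρ1.ofReal
  have hρ2c : MemLp (fun x => (ρ x : ℂ)) 2 volume := hρ2.ofReal
  have hf0 : MemLp (angularFourier fun x => (ρ x : ℂ)) 2 volume := memLp_angularFourier hρ1c hρ2c
  -- This field minimises `‖f‖²` minus its coupling to `ρ`: the phonon energy is `α² ∫ u⁴` and the
  -- interaction tends to `-2α² ∫ u⁴`.
  have hf : MemLp (fun k => (c : ℂ) * angularFourier (fun x => (ρ x : ℂ)) k) 2 volume :=
    hf0.const_mul (c : ℂ)
  have hfn : ∫ k, ‖(c : ℂ) * angularFourier (fun x => (ρ x : ℂ)) k‖ ^ 2 = α ^ 2 * ∫ x, u x ^ 4 := by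
    simp_rw [norm_mul, mul_pow, Complex.norm_real, Real.norm_eq_abs, sq_abs]
    rw [integral_const_mul, integral_norm_angularFourier_sq hρ1c hρ2c]
    simp_rw [Complex.norm_real, Real.norm_eq_abs, sq_abs]
    rw [n4, hc2]
    field_simp
  refine ⟨PolaronState.coherent hpv hv hdv hf, ?_, ?_⟩
  · rw [PolaronState.normSq_coherent, n1]
  · have hlim := tendsto_integral_momentumCutoff hρ1 hρ2 c
    have hE := ((hlim.const_mul 2).const_mul c).const_sub
      (α ^ 2 * (∫ x, du x ^ 2) + α ^ 2 * ∫ x, u x ^ 4) |>.sub_const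
      (α ^ 2 * ∫ x, V x * u x ^ 2)
    rw [PolaronState.HasEnergy]
    convert hE using 1
    · ext K
      rw [PolaronState.cutoffEnergy, PolaronState.kinetic_coherent, PolaronState.number_coherent,
        PolaronState.potential_coherent, PolaronState.annihilation_eq_interaction,
        PolaronState.interaction_coherent, n1, n2, hfn, nV, one_mul]
    · congr 1
      rw [pekarFunctional_eq hVm.aestronglyMeasurable hV0 hVB hp hu hdu hu1, n4]
      have : c * (2 * (c * (2 * Real.pi * (α * ∫ x, u x ^ 4))))
          = c ^ 2 * (4 * Real.pi * α * ∫ x, u x ^ 4) := by ring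
      rw [this, hc2]
      field_simp
      ring

/-! ### Finiteness of the infima and the choice of scales. -/

section Final

variable {V : ℝ → ℝ} {B : ℝ}

theorem nonempty_polaronValues (hVm : Continuous V) (hV0 : ∀ x, 0 ≤ V x) (hVB : ∀ x, V x ≤ B)
    {α : ℝ} (hα : 0 < α) : (polaronValues α V).Nonempty := by
  obtain ⟨r, hr⟩ := nonempty_pekarValues (V := V)
  exact ⟨_, sq_mul_pekarFunctional_mem_polaronValues hVm hV0 hVB hα hr⟩

theorem bddBelow_polaronValues (hVm : Continuous V) (hV0 : ∀ x, 0 ≤ V x) (hVB : ∀ x, V x ≤ B)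
    {α : ℝ} (hα : 0 < α) : BddBelow (polaronValues α V) := by
  obtain ⟨C, -, h⟩ := exists_polaron_lower_bound hVm hV0 hVB
  -- This width makes `2√(αl)` equal to the permitted `1/2`.
  refine ⟨_, fun E hE => h α (1 / (16 * α)) 1 hα (by positivity) one_pos ?_ E hE⟩
  have : α * (1 / (16 * α)) = (1 / 4) ^ 2 := by field_simp; norm_num
  rw [this, Real.sqrt_sq (by norm_num)]
  norm_num

theorem polaronEnergy_le (hVm : Continuous V) (hV0 : ∀ x, 0 ≤ V x) (hVB : ∀ x, V x ≤ B)
    {α : ℝ} (hα : 0 < α) : polaronEnergy α V ≤ α ^ 2 * pekarEnergy V := by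
  rw [mul_comm, ← div_le_iff₀ (by positivity)]
  refine le_csInf nonempty_pekarValues fun r hr => ?_
  rw [div_le_iff₀ (by positivity), mul_comm]
  exact csInf_le (bddBelow_polaronValues hVm hV0 hVB hα)
    (sq_mul_pekarFunctional_mem_polaronValues hVm hV0 hVB hα hr)

/-- The scales balance `α²√(αl)`, `R/l` and `1/R²`, all equal to `α^(10/7)`; with the constant term
this gives four errors, hence `4 * C`. -/
theorem exists_polaronEnergy_ge (hVm : Continuous V) (hV0 : ∀ x, 0 ≤ V x) (hVB : ∀ x, V x ≤ B) :
    ∃ C : ℝ, 0 < C ∧ ∀ α : ℝ, 16 ≤ α →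
      α ^ 2 * pekarEnergy V - C * α ^ (10 / 7 : ℝ) ≤ polaronEnergy α V := by
  obtain ⟨C, hC, h⟩ := exists_polaron_lower_bound hVm hV0 hVB
  refine ⟨4 * C, by positivity, fun α hα16 => ?_⟩
  have hα : 0 < α := by linarith
  have hα1 : 1 ≤ α := by linarith
  have e1 : Real.sqrt (α * α ^ (-(15 / 7) : ℝ)) = α ^ (-(4 / 7) : ℝ) := by
    rw [Real.sqrt_eq_rpow]
    nth_rewrite 1 [← Real.rpow_one α]
    rw [← Real.rpow_add hα, ← Real.rpow_mul hα.le]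
    norm_num
  have e2 : α ^ 2 * α ^ (-(4 / 7) : ℝ) = α ^ (10 / 7 : ℝ) := by
    rw [← Real.rpow_natCast α 2, ← Real.rpow_add hα]
    norm_num
  have e3 : α ^ (-(5 / 7) : ℝ) / α ^ (-(15 / 7) : ℝ) = α ^ (10 / 7 : ℝ) := by
    rw [← Real.rpow_sub hα]
    norm_num
  have e4 : 1 / (α ^ (-(5 / 7) : ℝ)) ^ 2 = α ^ (10 / 7 : ℝ) := by
    rw [← Real.rpow_natCast _ 2, ← Real.rpow_mul hα.le, one_div, ← Real.rpow_neg hα.le]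
    norm_num
  have e5 : 1 ≤ α ^ (10 / 7 : ℝ) := Real.one_le_rpow hα1 (by norm_num)
  -- The threshold `16` comes from here: `α^(-4/7) ≤ α^(-1/2) ≤ 1/4`.
  have e6 : 2 * α ^ (-(4 / 7) : ℝ) ≤ 1 / 2 := by
    have h1 : α ^ (-(4 / 7) : ℝ) ≤ α ^ (-(1 / 2) : ℝ) :=
      Real.rpow_le_rpow_of_exponent_le hα1 (by norm_num)
    have h2 : α ^ (-(1 / 2) : ℝ) ≤ (16 : ℝ) ^ (-(1 / 2) : ℝ) :=
      Real.rpow_le_rpow_of_nonpos (by norm_num) hα16 (by norm_num)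
    have h3 : (16 : ℝ) ^ (-(1 / 2) : ℝ) = 1 / 4 := by
      rw [Real.rpow_neg (by norm_num), ← Real.sqrt_eq_rpow,
        show (16 : ℝ) = 4 ^ 2 by norm_num, Real.sqrt_sq (by norm_num)]
      norm_num
    linarith
  refine le_csInf (nonempty_polaronValues hVm hV0 hVB hα) fun E hE => ?_
  have hl := h α (α ^ (-(15 / 7) : ℝ)) (α ^ (-(5 / 7) : ℝ)) hα (Real.rpow_pos_of_pos hα _)
    (Real.rpow_pos_of_pos hα _) (by rw [e1]; exact e6) E hE
  rw [e1, e2, e3, e4] at hl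
  nlinarith

end Final

theorem theorem1 (V : ℝ → ℝ) (hV_smooth : ContDiff ℝ 1 V) (hV_nonneg : ∀ x, 0 ≤ V x)
    (hV_even : ∀ x, V (-x) = V x) (hV_decr : AntitoneOn V (Set.Ici 0))
    (hV_lim : Tendsto V (cocompact ℝ) (𝓝 0)) :
    -- both infima are finite
    IsGLB (pekarValues V) (pekarEnergy V) ∧
    (∀ α : ℝ, 0 < α → IsGLB (polaronValues α V) (polaronEnergy α V)) ∧
    -- the strong-coupling limit
    Tendsto (fun α : ℝ => polaronEnergy α V / α ^ 2) atTop (𝓝 (pekarEnergy V)) ∧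
    -- the explicit bounds
    (∀ α : ℝ, 0 < α → polaronEnergy α V ≤ α ^ 2 * pekarEnergy V) ∧
    ∃ C : ℝ, 0 < C ∧ ∃ α₀ : ℝ, 0 < α₀ ∧ ∀ α : ℝ, α₀ ≤ α →
      α ^ 2 * pekarEnergy V - C * α ^ (71 / 49 : ℝ) ≤ polaronEnergy α V := by
  have hVm : Continuous V := hV_smooth.continuous
  have hVB : ∀ x, V x ≤ V 0 := fun x => by
    have h : V |x| ≤ V 0 := hV_decr Set.self_mem_Ici (abs_nonneg x) (abs_nonneg x)
    rcases abs_cases x with ⟨hx, -⟩ | ⟨hx, -⟩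
    · rwa [hx] at h
    · rwa [hx, hV_even] at h
  obtain ⟨C, hC, hlow⟩ := exists_polaronEnergy_ge hVm hV_nonneg hVB
  have hup : ∀ α : ℝ, 0 < α → polaronEnergy α V ≤ α ^ 2 * pekarEnergy V := fun α hα =>
    polaronEnergy_le hVm hV_nonneg hVB hα
  refine ⟨isGLB_pekarEnergy hVm.aestronglyMeasurable hV_nonneg hVB, fun α hα =>
    isGLB_csInf (nonempty_polaronValues hVm hV_nonneg hVB hα)
      (bddBelow_polaronValues hVm hV_nonneg hVB hα), ?_, hup, C, hC, 16, by norm_num,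
    fun α hα => ?_⟩
  · have hlim : Tendsto (fun α : ℝ => pekarEnergy V - C * α ^ (-(4 / 7) : ℝ)) atTop
        (𝓝 (pekarEnergy V)) := by
      simpa using ((tendsto_rpow_neg_atTop (show (0 : ℝ) < 4 / 7 by norm_num)).const_mul
        C).const_sub (pekarEnergy V)
    refine tendsto_of_tendsto_of_tendsto_of_le_of_le' hlim tendsto_const_nhds ?_ ?_
    · filter_upwards [eventually_ge_atTop 16] with α hα16
      have hα : 0 < α := by linarith
      rw [le_div_iff₀ (by positivity)]
      refine le_trans (le_of_eq ?_) (hlow α hα16)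
      have e : α ^ (-(4 / 7) : ℝ) * α ^ 2 = α ^ (10 / 7 : ℝ) := by
        rw [← Real.rpow_natCast α 2, ← Real.rpow_add hα]
        norm_num
      rw [← e]
      ring
    · filter_upwards [eventually_gt_atTop 0] with α hα
      rw [div_le_iff₀ (by positivity), mul_comm]
      exact hup α hα
  -- The exponent `10/7 = 70/49` obtained is smaller than `71/49`.
  · refine le_trans ?_ (hlow α hα)
    have : α ^ (10 / 7 : ℝ) ≤ α ^ (71 / 49 : ℝ) :=
      Real.rpow_le_rpow_of_exponent_le (by linarith) (by norm_num)
    have := mul_le_mul_of_nonneg_left this hC.le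
    linarith
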